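/- Fix arities $r_1,\dots,r_t\ge 0$. A finite structure of type $(r_1,\dots,r_t)$ is $\mathcal A=(A,R_1,\dots,R_t)$ with $A$ a finite set and $R_i\subseteq A^{r_i}$. A maximization problem $\mathcal Q$ on such structures (given by its optimum $\mathrm{opt}_{\mathcal Q}(\mathcal A)\in\mathbb N$) is in MAX NP if there are relation symbols $\mathcal S=(S_1,\dots,S_u)$, numbers $c_x,c_y$ and a quantifier-free formula $\psi(\mathbf x,\mathbf y,\mathcal S)$ in disjunctive normal form over $R_1,\dots,R_t,S_1,\dots,S_u$ such that for all finite structures $\mathcal A$ of this type $$\mathrm{opt}_{\mathcal Q}(\mathcal A)=\max_{\mathcal S}\left|\{\mathbf x\in A^{c_x}:(\mathcal A,\mathcal S)\models(\exists\mathbf y\in A^{c_y})\,\psi(\mathbf x,\mathbf y,\mathcal S)\}\right| ;$$ it is in MAX SNP if the same holds with a formula $\psi(\mathbf x,\mathcal S)$ and without the quantifier $\exists\mathbf y$. An instance $(\mathcal A,k)$, with $A=\{0,\dots,n-1\}$ and $k\in\mathbb N$, is encoded as a string over a fixed finite alphabet $\Sigma$: $n$ in unary, the truth tables of $R_1,\dots,R_t$,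 and $k$ in binary, with separators. The standard parameterization $p\text{-}\mathcal Q$ consists of the language $d\text{-}\mathcal Q\subseteq\Sigma^*$ of all encoded pairs $(\mathcal A,k)$ with $\mathrm{opt}_{\mathcal Q}(\mathcal A)\ge k$ and the parameter $\kappa:(\mathcal A,k)\mapsto k$ (and $\kappa=0$ on strings that encode no instance). A kernelization of size $h:\mathbb N\to\mathbb N$ is a polynomial-time computable function $K:\Sigma^*\to\Sigma^*$ such that for all $w\in\Sigma^*$: $w\in d\text{-}\mathcal Q\Leftrightarrow K(w)\in d\text{-}\mathcal Q$, and $|K(w)|\le h(\kappa(w))$; it is polynomial if $h$ is a polynomial. **Theorem.** The parameter $\kappa$ is polynomial-time computable. If $\mathcal Q$ is in MAX NP, then $p\text{-}\mathcal Q$ admits a polynomial kernelization; the same holds if $\mathcal Q$ is in MAX SNP. More precisely, let $\psi$ express $\mathcal Q$ in MAX NP as above, let $s$ be the maximum number of occurrences of the symbols $S_1,\dots,S_u$ in a disjunct of $\psi$, and let $m=\max(1,r_1,\dots,r_t)$. For a structure $\mathcal A$ let $Y_{\mathcal A}(\mathbf x)$ be the set of all $\mathbf y\in A^{c_y}$ such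 that $(\mathcal A,\mathcal S)\models\psi(\mathbf x,\mathbf y,\mathcal S)$ for some $\mathcal S$, and let $X_{\mathcal A}=\{\mathbf x\in A^{c_x}: Y_{\mathcal A}(\mathbf x)\neq\emptyset\}$. Then: 1. If $|X_{\mathcal A}|\ge k\cdot 2^s$, then $\mathrm{opt}_{\mathcal Q}(\mathcal A)\ge k$. 2. There are a function $K$ and a constant $C$ (not depending on the instance) such that $K$ is a kernelization of $p\text{-}\mathcal Q$ of size $C\cdot(k^{(s+1)m}+1)$, and such that for every instance $(\mathcal A,k)$ with $|X_{\mathcal A}|<k\cdot 2^s$ the string $K(\mathcal A,k)$ encodes, up to renaming elements, the instance $(\mathcal A',k)$, where $\mathcal A'$ is the restriction of $\mathcal A$ to the set $A'$ of all components of the tuples $\mathbf x\in X_{\mathcal A}$ and $\mathbf y\in Y'(\mathbf x)$, $\mathbf x\in X_{\mathcal A}$, for some sets $Y'(\mathbf x)\subseteq Y_{\mathcal A}(\mathbf x)$ with $|Y'(\mathbf x)|\le C\cdot k^s$. -/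

import Mathlib

namespace MaxNP

/-! ### Relational structures, formulas, and the classes MAX NP and MAX SNP -/

/-- A relational structure of type `(r 0, …, r (t-1))` on the universe `A`: a tuple consisting of
one `r i`-ary relation over `A` for each `i`. -/
abbrev RelStr {t : ℕ} (r : Fin t → ℕ) (A : Type) : Type :=
  ∀ i : Fin t, Set (Fin (r i) → A)

/-- Literals with variables in `V` over the vocabulary of the input symbols `R i` (of arity `r i`)
and the quantified symbols `S j` (of arity `q j`); the Boolean is the sign of the literal. -/
inductive Lit {t u : ℕ} (r : Fin t → ℕ) (q : Fin u → ℕ) (V : Type) : Type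
  | input (pos : Bool) (i : Fin t) (z : Fin (r i) → V) : Lit r q V
  | guess (pos : Bool) (j : Fin u) (z : Fin (q j) → V) : Lit r q V

/-- Truth of a literal in `(A, R, S)` under the variable assignment `v`. -/
def Lit.Holds {t u : ℕ} {r : Fin t → ℕ} {q : Fin u → ℕ} {V A : Type}
    (R : RelStr r A) (S : RelStr q A) (v : V → A) : Lit r q V → Prop
  | .input true i z => v ∘ z ∈ R i
  | .input false i z => v ∘ z ∉ R i
  | .guess true j z => v ∘ z ∈ S j
  | .guess false j z => v ∘ z ∉ S j

/-- Is this literal an occurrence of one of the quantified symbols `S j`? -/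
def Lit.isGuess {t u : ℕ} {r : Fin t → ℕ} {q : Fin u → ℕ} {V : Type} : Lit r q V → Bool
  | .input _ _ _ => false
  | .guess _ _ _ => true

/-- Quantifier-free formulas in disjunctive normal form: a disjunction of conjunctions of
literals. -/
abbrev DNF {t u : ℕ} (r : Fin t → ℕ) (q : Fin u → ℕ) (V : Type) : Type :=
  List (List (Lit r q V))

/-- Truth of a formula in disjunctive normal form. -/
def DNF.Holds {t u : ℕ} {r : Fin t → ℕ} {q : Fin u → ℕ} {V A : Type} (ψ : DNF r q V)
    (R : RelStr r A) (S : RelStr q A) (v : V → A) : Prop :=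
  ∃ d ∈ ψ, ∀ l ∈ d, l.Holds R S v

/-- A maximization problem on finite structures of type `r`, given by its optimum value. -/
abbrev MaxProblem {t : ℕ} (r : Fin t → ℕ) : Type 1 :=
  ∀ (A : Type) [Finite A], RelStr r A → ℕ

/-- The syntactic data of a MAX NP problem: quantified relation symbols `S j` of arity `q j`,
variables `x` (there are `cx`) and `y` (there are `cy`), and a formula `ψ(x, y, S)`. -/
structure Formula {t : ℕ} (r : Fin t → ℕ) where
  {u : ℕ}
  q : Fin u → ℕ
  cx : ℕ
  cy : ℕ
  ψ : DNF r q (Fin cx ⊕ Fin cy)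

namespace Formula

variable {t : ℕ} {r : Fin t → ℕ} (φ : Formula r) {A : Type}

/-- `(A, R, S) ⊨ ψ(x, y, S)`. -/
def Holds (R : RelStr r A) (S : RelStr φ.q A) (x : Fin φ.cx → A) (y : Fin φ.cy → A) : Prop :=
  φ.ψ.Holds R S (Sum.elim x y)

/-- The number of tuples `x` with `(A, R, S) ⊨ ∃ y, ψ(x, y, S)`. -/
noncomputable def value (R : RelStr r A) (S : RelStr φ.q A) : ℕ :=
  {x : Fin φ.cx → A | ∃ y : Fin φ.cy → A, φ.Holds R S x y}.ncard

/-- The optimum of `Q` on every finite structure is `max_S |{x : (A, R, S) ⊨ ∃ y, ψ(x, y, S)}|`. -/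
def Expresses (Q : MaxProblem r) : Prop :=
  ∀ (A : Type) [Finite A] (R : RelStr r A), IsGreatest (Set.range (φ.value R)) (Q A R)

/-- The set `Y_A(x)` of all `y` such that `ψ(x, y, S)` holds for some `S`. -/
def witnesses (R : RelStr r A) (x : Fin φ.cx → A) : Set (Fin φ.cy → A) :=
  {y | ∃ S : RelStr φ.q A, φ.Holds R S x y}

/-- The set `X_A` of all `x` such that `∃ y, ψ(x, y, S)` holds for some `S`. -/
def satisfiable (R : RelStr r A) : Set (Fin φ.cx → A) :=
  {x | ∃ S : RelStr φ.q A, ∃ y : Fin φ.cy → A, φ.Holds R S x y}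

/-- The maximum number of occurrences of the symbols `S j` in a disjunct of `ψ`. -/
def s : ℕ := (φ.ψ.map fun d => d.countP Lit.isGuess).foldr max 0

end Formula

/-- `Q` belongs to MAX NP. -/
def InMaxNP {t : ℕ} {r : Fin t → ℕ} (Q : MaxProblem r) : Prop :=
  ∃ φ : Formula r, φ.Expresses Q

/-- `Q` belongs to MAX SNP: its optimum is `max_S |{x : (A, R, S) ⊨ ψ(x, S)}|`. -/
def InMaxSNP {t : ℕ} {r : Fin t → ℕ} (Q : MaxProblem r) : Prop :=
  ∃ (u : ℕ) (q : Fin u → ℕ) (c : ℕ) (ψ : DNF r q (Fin c)),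
    ∀ (A : Type) [Finite A] (R : RelStr r A),
      IsGreatest (Set.range fun S : RelStr q A => {x : Fin c → A | ψ.Holds R S x}.ncard) (Q A R)

/-! ### Parameterized problems and kernelizations -/

/-- A language over the alphabet `Γ` together with a parameter for every string. -/
structure ParamProblem (Γ : Type) where
  lang : Set (List Γ)
  param : List Γ → ℕ

namespace ParamProblem

variable {Γ : Type} (P : ParamProblem Γ)

/-- The parameter is a polynomial-time computable function (with values written in binary). -/
def HasPolyTimeParam : Prop :=
  Nonempty (Turing.TM2ComputableInPolyTime (id : List Γ → List Γ) Computability.encodeNat P.param)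

/-- `K` is a kernelization of `P` whose kernels have size at most `h`: it is computable by a Turing
machine in polynomial time, preserves membership, and `|K w| ≤ h (κ w)`. -/
def IsKernelization (K : List Γ → List Γ) (h : ℕ → ℕ) : Prop :=
  Nonempty (Turing.TM2ComputableInPolyTime (id : List Γ → List Γ) (id : List Γ → List Γ) K) ∧
    ∀ w : List Γ, (w ∈ P.lang ↔ K w ∈ P.lang) ∧ (K w).length ≤ h (P.param w)

/-- `P` admits a polynomial kernelization. -/
def AdmitsPolyKernelization : Prop :=
  ∃ (K : List Γ → List Γ) (p : Polynomial ℕ), P.IsKernelization K fun k => p.eval k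

end ParamProblem

/-! ### Instances as strings, and the standard parameterization -/

/-- An instance `(𝒜, k)` whose structure `𝒜` has the universe `{0, …, n-1}`. -/
@[ext]
structure Instance {t : ℕ} (r : Fin t → ℕ) where
  n : ℕ
  rel : RelStr r (Fin n)
  k : ℕ

/-- The alphabet: the two bits, and `none` as a separator. -/
abbrev Symb : Type := Option Bool

open scoped Classical in
/-- The truth table of a `d`-ary relation over `{0, …, n-1}`, of length `n ^ d`. -/
noncomputable def table {n d : ℕ} (T : Set (Fin d → Fin n)) : List Symb :=
  List.ofFn fun j : Fin (n ^ d) => some (decide (finFunctionFinEquiv.symm j ∈ T))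

/-- The string encoding an instance: `n` in unary, a separator, the truth tables of all relations,
each followed by a separator, and `k` in binary. -/
noncomputable def Instance.encode {t : ℕ} {r : Fin t → ℕ} (I : Instance r) : List Symb :=
  List.replicate I.n (some true) ++ none ::
    ((List.ofFn fun i => table (I.rel i) ++ [none]).flatten ++
      (Computability.encodeNat I.k).map some)

theorem Instance.encode_injective {t : ℕ} {r : Fin t → ℕ} :
    Function.Injective (Instance.encode (r := r)) := by
  rintro ⟨n, R, k⟩ ⟨n', R', k'⟩ h
  simp only [Instance.encode] at h
  have hn : n = n' := by
    have := congrArg (fun l : List Symb => (l.takeWhile fun a => a.isSome).length) h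
    simpa [List.takeWhile_append] using this
  subst hn
  have h1 := List.cons_injective (List.append_cancel_left h)
  have hlen : (List.map List.length (List.ofFn fun i => table (R i) ++ [(none : Symb)])) =
      List.map List.length (List.ofFn fun i => table (R' i) ++ [(none : Symb)]) := by
    simp [List.map_ofFn, Function.comp_def, table]
  obtain ⟨h2, h3⟩ := List.append_inj h1 (by rw [List.length_flatten, List.length_flatten, hlen])
  have hk : k = k' := by
    have h4 := List.map_injective_iff.mpr (Option.some_injective Bool) h3
    simpa using congrArg Computability.decodeNat h4
  have hR : R = R' := by
    have h5 := List.ofFn_injective (List.eq_iff_flatten_eq.mpr ⟨h2, hlen⟩)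
    funext i
    have h6 := List.ofFn_injective (List.append_cancel_right (congrFun h5 i))
    ext v
    have h7 := congrFun h6 (finFunctionFinEquiv v)
    simpa using h7
  rw [hk, hR]

open scoped Classical in
/-- The standard parameterization of `Q`: the language of all (encoded) pairs `(𝒜, k)` with
`opt_Q(𝒜) ≥ k`, and the parameter `(𝒜, k) ↦ k`, which is `0` on strings that encode nothing. -/
noncomputable def standardParam {t : ℕ} {r : Fin t → ℕ} (Q : MaxProblem r) :
    ParamProblem Symb where
  lang := {w | ∃ I : Instance r, I.encode = w ∧ I.k ≤ Q (Fin I.n) I.rel}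
  param w := if h : ∃ I : Instance r, I.encode = w then h.choose.k else 0

theorem standardParam_param_encode {t : ℕ} {r : Fin t → ℕ} (Q : MaxProblem r) (I : Instance r) :
    (standardParam Q).param I.encode = I.k := by
  have h : ∃ J : Instance r, J.encode = I.encode := ⟨I, rfl⟩
  have h' : (standardParam Q).param I.encode = h.choose.k := dif_pos h
  rw [h', Instance.encode_injective h.choose_spec]

theorem encode_mem_standardParam_lang {t : ℕ} {r : Fin t → ℕ} (Q : MaxProblem r)
    (I : Instance r) : I.encode ∈ (standardParam Q).lang ↔ I.k ≤ Q (Fin I.n) I.rel := by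
  constructor
  · rintro ⟨J, hJ, h⟩
    rwa [Instance.encode_injective hJ] at h
  · exact fun h => ⟨I, rfl, h⟩

/-- `I'` is, up to renaming the elements along `f`, the instance obtained from `I` by restricting
the structure to the components of the tuples `x ∈ X_A` and `y ∈ Y' x` for `x ∈ X_A`; the number
`k` is kept. -/
def IsRestriction {t : ℕ} {r : Fin t → ℕ} (φ : Formula r) (I I' : Instance r)
    (Y' : (Fin φ.cx → Fin I.n) → Set (Fin φ.cy → Fin I.n)) (f : Fin I'.n ↪ Fin I.n) : Prop :=
  Set.range f = {a | ∃ x ∈ φ.satisfiable I.rel,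
      a ∈ Set.range x ∨ ∃ y ∈ Y' x, a ∈ Set.range y} ∧
    (∀ (i : Fin t) (v : Fin (r i) → Fin I'.n), v ∈ I'.rel i ↔ f ∘ v ∈ I.rel i) ∧
    I'.k = I.k

end MaxNP

/-!
# Polynomial kernels for the problems in MAX NP

If all `S` are equally likely, then each `x ∈ X_A` satisfies `∃ y, ψ(x, y, S)` with probability at
least `2 ^ (-s)`: once the at most `s` atoms `S j (…)` of a suitable disjunct have the right truth
values, the disjunct is true. So some `S` satisfies at least `|X_A| / 2 ^ s` of the tuples
(`exists_le_value`), and an instance with `|X_A| ≥ k * 2 ^ s` has the answer yes.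

Otherwise let `b = |X_A| * s`. For a fixed `x ∈ X_A`, consider the pairs of a tuple `y` and a
disjunct that can be made true at `x` and `y`; such a pair requires a set of at most `s` ground
literals over the quantified symbols. From these pairs a greedy procedure (`kept`) selects at most
`(b + 1) ^ s` many such that whenever the literals of some pair avoid a set of `b` literals, then
so do those of a selected pair (`exists_mem_kept_disjoint`). This is a sunflower-type argument with
explicit thresholds: a pair is rejected only if some subset `T` of its literals is contained in
`(b + 1) ^ (s - |T|)` selected ones already. Let `Y' x` consist of the tuples `y` of selected pairs.
Given `S`, the witnesses of the `x ∈ X_A` can be replaced one after the other by witnesses in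
`Y' x`, because the complements of the literals required for the other tuples are at most `b` many
(`exists_model_of_representative`). Hence restricting the structure to the elements that occur in
the tuples of `X_A` and of the sets `Y' x` does not change the optimum (`opt_restriction_eq`), and
the number of remaining elements is at most a constant times `k ^ (s + 1)`.

For the running time, a small language of structured programs over word registers is compiled to
the multi-stack Turing machines of Mathlib (`nonempty_computable_of_exec`). On top of it,
`PolyTime` is a class of functions that is closed under composition, case distinctions, bounded
quantifiers, counting, and iteration with polynomially bounded values (`PolyTime.iterate`). The
kernelization is written with tuples replaced by their indices in the truth tables, so that all of
its ingredients are predicates and functions on words and natural numbers that visibly belong to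
this class; the greedy selection is a course-of-values recursion (`PolyTime.course_of_values`). The
parameter itself may be exponential in the length of the input, and is compared to `|X_A|` by a
truncated Horner scheme (`PolyTime.min_binVal`).
-/

namespace MaxNP

/-! ### A structured programming language for stack machines -/

/-- The contents of a register. -/
abbrev Word : Type := List Symb

/-- Structured programs over registers `r : R`, each of which holds a word and is used as a stack.
`cond r b p q` branches on the topmost symbol of `r`, and `loop r p` repeats `p` as long as `r` is
not empty. -/
inductive Prog (R : Type) : Type
  | skip : Prog R
  | push (r : R) (c : Symb) : Prog R
  | pop (r : R) : Prog R
  | seq (p q : Prog R) : Prog R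
  | cond (r : R) (b : Option Symb → Bool) (p q : Prog R) : Prog R
  | loop (r : R) (p : Prog R) : Prog R

open Function (update)

/-- `Exec p s s' t`: started with register contents `s`, the program `p` terminates after `t` steps
with register contents `s'`. -/
inductive Exec {R : Type} [DecidableEq R] : Prog R → (R → Word) → (R → Word) → ℕ → Prop
  | skip (s) : Exec .skip s s 1
  | push (r c s) : Exec (.push r c) s (update s r (c :: s r)) 1
  | pop (r s) : Exec (.pop r) s (update s r (s r).tail) 1
  | seq {p q s s' s'' t t'} : Exec p s s' t → Exec q s' s'' t' → Exec (.seq p q) s s'' (t + t')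
  | condTrue {r b p q s s' t} : b (s r).head? = true → Exec p s s' t →
      Exec (.cond r b p q) s s' (t + 1)
  | condFalse {r b p q s s' t} : b (s r).head? = false → Exec q s s' t →
      Exec (.cond r b p q) s s' (t + 1)
  | loopDone {r p s} : s r = [] → Exec (.loop r p) s s 1
  | loopStep {r p s s' s'' t t'} : s r ≠ [] → Exec p s s' t → Exec (.loop r p) s' s'' t' →
      Exec (.loop r p) s s'' (t + t' + 1)

namespace Prog

variable {R R' : Type}

/-- Renaming of registers. -/
def map (e : R → R') : Prog R → Prog R'
  | skip => skip
  | push r c => push (e r) c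
  | pop r => pop (e r)
  | seq p q => seq (p.map e) (q.map e)
  | cond r b p q => cond (e r) b (p.map e) (q.map e)
  | loop r p => loop (e r) (p.map e)

/-! ### Compilation to multi-stack Turing machines -/

/-- The control states of the machine that runs a program: one for each instruction. -/
def Lbl : Prog R → Type
  | skip => Unit
  | push _ _ => Unit
  | pop _ => Unit
  | seq p q => p.Lbl ⊕ q.Lbl
  | cond _ _ p q => Option (p.Lbl ⊕ q.Lbl)
  | loop _ p => Option p.Lbl

/-- The machine that runs a program has finitely many control states. -/
@[reducible] def lblFintype : (p : Prog R) → Fintype p.Lbl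
  | skip => inferInstanceAs (Fintype Unit)
  | push _ _ => inferInstanceAs (Fintype Unit)
  | pop _ => inferInstanceAs (Fintype Unit)
  | seq p q =>
    letI := p.lblFintype
    letI := q.lblFintype
    inferInstanceAs (Fintype (p.Lbl ⊕ q.Lbl))
  | cond _ _ p q =>
    letI := p.lblFintype
    letI := q.lblFintype
    inferInstanceAs (Fintype (Option (p.Lbl ⊕ q.Lbl)))
  | loop _ p =>
    letI := p.lblFintype
    inferInstanceAs (Fintype (Option p.Lbl))

/-- The control state in which a program starts. -/
def entry : (p : Prog R) → p.Lbl
  | skip => ()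
  | push _ _ => ()
  | pop _ => ()
  | seq p _ => .inl p.entry
  | cond _ _ _ _ => none
  | loop _ _ => none

end Prog

/-- The stack alphabets: the stack `none` is an output stack over `Γ₁`, and every register is a
stack of symbols. -/
abbrev StackAlph (R Γ₁ : Type) : Option R → Type
  | none => Γ₁
  | some _ => Symb

namespace Prog

variable {R : Type} {Γ₁ Λ : Type}

open Turing.TM2 (Stmt)

/-- The code of a program, placed in a machine with control states `Λ` along `emb`, that continues
at the control state `exit` after termination. -/
def code : (p : Prog R) → (p.Lbl → Λ) → Λ → p.Lbl → Stmt (StackAlph R Γ₁) Λ (Option Symb)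
  | skip, _, exit, _ => .goto fun _ => exit
  | push r c, _, exit, _ => .push (some r) (fun _ => c) (.goto fun _ => exit)
  | pop r, _, exit, _ => .pop (some r) (fun v _ => v) (.goto fun _ => exit)
  | seq p q, emb, exit, l =>
    match l with
    | .inl l => p.code (fun l => emb (.inl l)) (emb (.inr q.entry)) l
    | .inr l => q.code (fun l => emb (.inr l)) exit l
  | cond r b p q, emb, exit, l =>
    match l with
    | none => .peek (some r) (fun _ h => h) (.branch b
        (.load (fun _ => none) (.goto fun _ => emb (some (.inl p.entry))))
        (.load (fun _ => none) (.goto fun _ => emb (some (.inr q.entry)))))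
    | some (.inl l) => p.code (fun l => emb (some (.inl l))) exit l
    | some (.inr l) => q.code (fun l => emb (some (.inr l))) exit l
  | loop r p, emb, exit, l =>
    match l with
    | none => .peek (some r) (fun _ h => h) (.branch Option.isSome
        (.load (fun _ => none) (.goto fun _ => emb (some p.entry)))
        (.load (fun _ => none) (.goto fun _ => exit)))
    | some l => p.code (fun l => emb (some l)) (emb none) l

end Prog

/-- The stacks of the machine when the output stack holds `o` and the registers hold `s`. -/
def stackVals {R Γ₁ : Type} (o : List Γ₁) (s : R → Word) : ∀ k : Option R, List (StackAlph R Γ₁ k)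
  | none => o
  | some r => s r

@[simp] theorem stackVals_none {R Γ₁ : Type} (o : List Γ₁) (s : R → Word) :
    stackVals o s none = o := rfl

@[simp] theorem stackVals_some {R Γ₁ : Type} (o : List Γ₁) (s : R → Word) (r : R) :
    stackVals o s (some r) = s r := rfl

@[simp] theorem update_stackVals_some {R Γ₁ : Type} [DecidableEq R] (o : List Γ₁) (s : R → Word)
    (r : R) (w : Word) : update (stackVals o s) (some r) w = stackVals o (update s r w) := by
  funext k
  cases k with
  | none => simp
  | some k =>
    by_cases h : k = r
    · subst h; simp
    · simp [h]

@[simp] theorem update_stackVals_none {R Γ₁ : Type} [DecidableEq R] (o o' : List Γ₁)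
    (s : R → Word) :
    update (stackVals o s) none o' = stackVals o' s := by
  funext k
  cases k <;> simp

/-- The machine with program `M` gets from `c` to `c'` in `t` steps. -/
def Reach {K Λ σ : Type} {Γ : K → Type} [DecidableEq K] (M : Λ → Turing.TM2.Stmt Γ Λ σ) (t : ℕ)
    (c c' : Turing.TM2.Cfg Γ Λ σ) : Prop :=
  (flip bind (Turing.TM2.step M))^[t] (some c) = some c'

section Reach

variable {K Λ σ : Type} {Γ : K → Type} [DecidableEq K] {M : Λ → Turing.TM2.Stmt Γ Λ σ}
  {t t' : ℕ} {c c' c'' : Turing.TM2.Cfg Γ Λ σ}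

theorem Reach.trans (h : Reach M t c c') (h' : Reach M t' c' c'') : Reach M (t + t') c c'' := by
  rw [Reach, Nat.add_comm, Function.iterate_add_apply, h, h']

theorem Reach.of_step (h : Turing.TM2.step M c = some c') : Reach M 1 c c' := h

end Reach

/-- Correctness of the compilation, with the step count of `Exec` being that of the machine. -/
theorem Exec.reach {R Γ₁ Λ : Type} [DecidableEq R] {p : Prog R} {s s' : R → Word} {t : ℕ}
    (h : Exec p s s' t) (M : Λ → Turing.TM2.Stmt (StackAlph R Γ₁) Λ (Option Symb))
    (emb : p.Lbl → Λ) (exit : Λ) (hM : ∀ l, M (emb l) = p.code emb exit l) (o : List Γ₁) :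
    Reach M t ⟨some (emb p.entry), none, stackVals o s⟩ ⟨some exit, none, stackVals o s'⟩ := by
  induction h generalizing exit with
  | skip s => exact Reach.of_step (by simp [hM, Prog.code])
  | push r c s => exact Reach.of_step (by simp [hM, Prog.code])
  | pop r s => exact Reach.of_step (by simp [hM, Prog.code])
  | seq h₁ h₂ ih₁ ih₂ =>
    exact (ih₁ _ _ fun l => hM (.inl l)).trans (ih₂ (fun l => emb (.inr l)) _ fun l => hM (.inr l))
  | @condTrue r b p q s s' t hb h ih =>
    have h0 : Reach M 1 ⟨some (emb none), none, stackVals o s⟩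
        ⟨some (emb (some (.inl p.entry))), none, stackVals o s⟩ :=
      Reach.of_step (by rw [Turing.TM2.step, hM none]; simp [Prog.code, hb])
    rw [Nat.add_comm]
    exact h0.trans (ih (fun l => emb (some (.inl l))) _ fun l => hM (some (.inl l)))
  | @condFalse r b p q s s' t hb h ih =>
    have h0 : Reach M 1 ⟨some (emb none), none, stackVals o s⟩
        ⟨some (emb (some (.inr q.entry))), none, stackVals o s⟩ :=
      Reach.of_step (by rw [Turing.TM2.step, hM none]; simp [Prog.code, hb])
    rw [Nat.add_comm]
    exact h0.trans (ih (fun l => emb (some (.inr l))) _ fun l => hM (some (.inr l)))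
  | @loopDone r p s hs =>
    have h0 : Reach M 1 ⟨some (emb none), none, stackVals o s⟩
        ⟨some exit, none, stackVals o s⟩ :=
      Reach.of_step (by rw [Turing.TM2.step, hM none]; simp [Prog.code, hs])
    exact h0
  | @loopStep r p s s' s'' t t' hs h₁ h₂ ih₁ ih₂ =>
    have hs' : (s r).head?.isSome = true := by
      cases h : s r <;> simp_all
    have h0 : Reach M 1 ⟨some (emb none), none, stackVals o s⟩
        ⟨some (emb (some p.entry)), none, stackVals o s⟩ :=
      Reach.of_step (by rw [Turing.TM2.step, hM none]; simp [Prog.code, hs'])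
    have := (h0.trans (ih₁ (fun l => emb (some l)) (emb none) fun l => hM (some l))).trans
      (ih₂ emb exit hM)
    rwa [show t + t' + 1 = 1 + t + t' by omega]

/-- The code of the machine that runs `p` and then moves the register `out` to the output stack,
translating its symbols along `g`. -/
def machineCode {R Γ₁ : Type} (p : Prog R) (out : R) (g : Symb → Γ₁) :
    Option p.Lbl → Turing.TM2.Stmt (StackAlph R Γ₁) (Option p.Lbl) (Option Symb)
  | some l => p.code some none l
  | none => .pop (some out) (fun _ h => h) (.branch Option.isSome
      (.push none (fun v => g (v.getD none)) (.load (fun _ => none) (.goto fun _ => none)))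
      (.load (fun _ => none) .halt))

/-- The machine with code `machineCode p out g`, reading its input from the register `inp`. -/
def machine {R Γ₁ : Type} [DecidableEq R] [Fintype R] (p : Prog R) (inp out : R)
    (g : Symb → Γ₁) : Turing.FinTM2 where
  K := Option R
  k₀ := some inp
  k₁ := none
  Γ := StackAlph R Γ₁
  Λ := Option p.Lbl
  main := some p.entry
  ΛFin := letI := p.lblFintype; inferInstanceAs (Fintype (Option p.Lbl))
  σ := Option Symb
  initialState := none
  Γk₀Fin := inferInstanceAs (Fintype Symb)
  m := machineCode p out g

theorem machineCode_drain {R Γ₁ : Type} [DecidableEq R] (p : Prog R) (out : R)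
    (g : Symb → Γ₁) (o : List Γ₁) (s : R → Word) (w : Word) (hs : s out = w) :
    Reach (machineCode p out g) (w.length + 1)
      ⟨some none, none, stackVals o s⟩
      ⟨none, none, stackVals (w.reverse.map g ++ o) (update s out [])⟩ := by
  induction w generalizing o s with
  | nil =>
    refine Reach.of_step ?_
    simp [machineCode, hs]
  | cons c w ih =>
    have h0 : Reach (machineCode p out g) 1 ⟨some none, none, stackVals o s⟩
        ⟨some none, none, stackVals (g c :: o) (update s out w)⟩ := by
      refine Reach.of_step ?_
      simp [machineCode, hs]
    have := h0.trans (ih (g c :: o) (update s out w) (by simp))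
    rw [List.length_cons, Nat.add_comm]
    simpa using this

theorem initList_stk_self (tm : Turing.FinTM2) (l : List (tm.Γ tm.k₀)) :
    (Turing.initList tm l).stk tm.k₀ = l := by
  simp [Turing.initList]

theorem initList_stk_of_ne (tm : Turing.FinTM2) (l : List (tm.Γ tm.k₀)) {k : tm.K}
    (hk : k ≠ tm.k₀) : (Turing.initList tm l).stk k = [] := by
  simp [Turing.initList, hk]

theorem haltList_stk_self (tm : Turing.FinTM2) (l : List (tm.Γ tm.k₁)) :
    (Turing.haltList tm l).stk tm.k₁ = l := by
  simp [Turing.haltList]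

theorem haltList_stk_of_ne (tm : Turing.FinTM2) (l : List (tm.Γ tm.k₁)) {k : tm.K}
    (hk : k ≠ tm.k₁) : (Turing.haltList tm l).stk k = [] := by
  simp [Turing.haltList, hk]

theorem cfg_eq_mk {K Λ σ : Type} {Γ : K → Type} {c : Turing.TM2.Cfg Γ Λ σ} {l : Option Λ} {v : σ}
    {S : ∀ k, List (Γ k)} (hl : c.l = l) (hv : c.var = v) (hS : ∀ k, c.stk k = S k) :
    c = ⟨l, v, S⟩ := by
  obtain ⟨l', v', S'⟩ := c
  obtain rfl : S' = S := funext hS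
  subst hl hv
  rfl

/-- A function that is computed by a program in polynomial time is computed by a Turing machine in
polynomial time. Since moving the register `out` to the output stack reverses it, the program has to
leave the reverse of the result there, and all other registers empty. -/
theorem nonempty_computable_of_exec {R α β αΓ Γ₁ : Type} [DecidableEq R] [Fintype R] (p : Prog R)
    (inp out : R) (ι : Symb ≃ αΓ) (g : Symb → Γ₁) (ea : α → List αΓ) (eb : β → List Γ₁) (F : α → β)
    (f : α → Word) (T : Polynomial ℕ) (hF : ∀ a, eb (F a) = (f a).map g)
    (hp : ∀ a, ∃ t ≤ T.eval (ea a).length,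
      Exec p (update (fun _ => []) inp ((ea a).map ι.symm))
        (update (fun _ => []) out (f a).reverse) t)
    (hl : ∀ a, (f a).length ≤ T.eval (ea a).length) :
    Nonempty (Turing.TM2ComputableInPolyTime ea eb F) := by
  refine ⟨{ tm := machine p inp out g
            inputAlphabet := ι
            outputAlphabet := Equiv.refl _
            time := T + T + 1
            outputsFun := fun a => ?_ }⟩
  have key : ∃ t ≤ (T + T + 1).eval (ea a).length, Reach (machineCode p out g) t
      (Turing.initList (machine p inp out g) ((ea a).map ι.symm))
      (Turing.haltList (machine p inp out g) (eb (F a))) := by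
    obtain ⟨t, ht, h⟩ := hp a
    refine ⟨t + ((f a).length + 1), ?_, ?_⟩
    · simp only [Polynomial.eval_add, Polynomial.eval_one]
      have := hl a
      omega
    have h1 := h.reach (machineCode p out g) some none (fun l => rfl) []
    have h2 := machineCode_drain p out g [] (update (fun _ => []) out (f a).reverse)
      (f a).reverse (by simp)
    have h3 := h1.trans h2
    rw [List.length_reverse] at h3
    have e1 : Turing.initList (machine p inp out g) ((ea a).map ι.symm) =
        ⟨some (some p.entry), none, stackVals []
          (update (fun _ => []) inp ((ea a).map ι.symm))⟩ := by
      refine cfg_eq_mk rfl rfl fun k => ?_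
      cases k with
      | none => exact initList_stk_of_ne (machine p inp out g) _ (Option.some_ne_none _).symm
      | some k =>
        rw [stackVals_some]
        by_cases hk : k = inp
        · subst hk
          rw [Function.update_self]
          exact initList_stk_self (machine p k out g) _
        · rw [Function.update_of_ne hk]
          exact initList_stk_of_ne (machine p inp out g) _ fun h => hk (Option.some_injective _ h)
    have e2 : Turing.haltList (machine p inp out g) (eb (F a)) =
        ⟨none, none, stackVals ((f a).reverse.reverse.map g ++ [])
          (update (update (fun _ => []) out (f a).reverse) out [])⟩ := by
      refine cfg_eq_mk rfl rfl fun k => ?_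
      cases k with
      | none =>
        rw [stackVals_none, List.reverse_reverse, List.append_nil, ← hF]
        exact haltList_stk_self (machine p inp out g) _
      | some k =>
        rw [stackVals_some, Function.update_idem, Function.update_eq_self_iff.2 rfl]
        exact haltList_stk_of_ne (machine p inp out g) _ (Option.some_ne_none _)
    rw [e1, e2]
    exact h3
  have e3 : (eb (F a)).map (Equiv.refl Γ₁).invFun = eb (F a) := List.map_id _
  exact ⟨⟨key.choose, Eq.trans key.choose_spec.2
    (congrArg (fun l => some (Turing.haltList (machine p inp out g) l)) e3.symm)⟩,
    key.choose_spec.1⟩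


/-! ### Running times of structured programs -/

/-- `Runs p s s' T`: started with register contents `s`, the program `p` terminates after at most
`T` steps with register contents `s'`. -/
def Runs {R : Type} [DecidableEq R] (p : Prog R) (s s' : R → Word) (T : ℕ) : Prop :=
  ∃ t ≤ T, Exec p s s' t

section Runs

variable {R : Type} [DecidableEq R] {p q : Prog R} {s s' s'' : R → Word} {T T' : ℕ}

theorem Runs.mono (h : Runs p s s' T) (hT : T ≤ T') : Runs p s s' T' :=
  let ⟨t, ht, h⟩ := h
  ⟨t, ht.trans hT, h⟩

theorem Runs.of_eq (h : Runs p s s' T) (hs : s' = s'') : Runs p s s'' T := hs ▸ h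

theorem Runs.skip (s : R → Word) : Runs .skip s s 1 := ⟨1, le_rfl, .skip s⟩

theorem Runs.push (r : R) (c : Symb) (s : R → Word) :
    Runs (.push r c) s (update s r (c :: s r)) 1 := ⟨1, le_rfl, .push r c s⟩

theorem Runs.pop (r : R) (s : R → Word) : Runs (.pop r) s (update s r (s r).tail) 1 :=
  ⟨1, le_rfl, .pop r s⟩

theorem Runs.seq (h : Runs p s s' T) (h' : Runs q s' s'' T') : Runs (.seq p q) s s'' (T + T') :=
  let ⟨t, ht, h⟩ := h
  let ⟨t', ht', h'⟩ := h'
  ⟨t + t', by omega, h.seq h'⟩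

theorem Runs.condTrue {r : R} {b : Option Symb → Bool} (hb : b (s r).head? = true)
    (h : Runs p s s' T) : Runs (.cond r b p q) s s' (T + 1) :=
  let ⟨t, ht, h⟩ := h
  ⟨t + 1, by omega, .condTrue hb h⟩

theorem Runs.condFalse {r : R} {b : Option Symb → Bool} (hb : b (s r).head? = false)
    (h : Runs q s s' T) : Runs (.cond r b p q) s s' (T + 1) :=
  let ⟨t, ht, h⟩ := h
  ⟨t + 1, by omega, .condFalse hb h⟩

/-- A loop whose control register shrinks by one symbol in each round. -/
theorem Runs.loop {r : R} {w : Word} (S : ℕ → R → Word) (hS : ∀ i ≤ w.length, S i r = w.drop i)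
    (h : ∀ i < w.length, Runs p (S i) (S (i + 1)) T) :
    Runs (.loop r p) (S 0) (S w.length) (w.length * (T + 1) + 1) := by
  suffices ∀ j ≤ w.length, Runs (.loop r p) (S (w.length - j)) (S w.length) (j * (T + 1) + 1) by
    simpa using this w.length le_rfl
  intro j hj
  induction j with
  | zero => exact ⟨1, by omega, .loopDone (by simp [hS])⟩
  | succ j ih =>
    obtain ⟨t, ht, h1⟩ := ih (by omega)
    obtain ⟨t', ht', h2⟩ := h (w.length - (j + 1)) (by omega)
    rw [show w.length - (j + 1) + 1 = w.length - j by omega] at h2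
    refine ⟨t' + t + 1, by rw [Nat.succ_mul]; omega, .loopStep ?_ h2 h1⟩
    rw [hS _ (by omega), Ne, List.drop_eq_nil_iff]
    omega

/-- A program acts on renamed registers as on the original ones, and leaves all others alone. -/
theorem Exec.map {R' : Type} [DecidableEq R'] {e : R → R'} (he : Function.Injective e) {t : ℕ}
    (h : Exec p s s' t) {S S' : R' → Word} (h0 : ∀ r, S (e r) = s r) (h1 : ∀ r, S' (e r) = s' r)
    (h2 : ∀ r', r' ∉ Set.range e → S' r' = S r') : Exec (p.map e) S S' t := by
  induction h generalizing S S' with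
  | skip s =>
    obtain rfl : S = S' := by
      funext r'
      by_cases hr : r' ∈ Set.range e
      · obtain ⟨r, rfl⟩ := hr
        rw [h0, h1]
      · exact (h2 _ hr).symm
    exact .skip S
  | push r c s =>
    obtain rfl : S' = update S (e r) (c :: S (e r)) := by
      funext r'
      by_cases hr : r' ∈ Set.range e
      · obtain ⟨r₁, rfl⟩ := hr
        by_cases hr₁ : r₁ = r
        · subst hr₁; simp [h0, h1]
        · simp [h0, h1, hr₁, he.ne hr₁]
      · rw [h2 _ hr, Function.update_of_ne]
        rintro rfl
        exact hr ⟨r, rfl⟩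
    exact .push _ _ _
  | pop r s =>
    obtain rfl : S' = update S (e r) (S (e r)).tail := by
      funext r'
      by_cases hr : r' ∈ Set.range e
      · obtain ⟨r₁, rfl⟩ := hr
        by_cases hr₁ : r₁ = r
        · subst hr₁; simp [h0, h1]
        · simp [h0, h1, hr₁, he.ne hr₁]
      · rw [h2 _ hr, Function.update_of_ne]
        rintro rfl
        exact hr ⟨r, rfl⟩
    exact .pop _ _
  | @seq p q s s' s'' t t' _ _ ih₁ ih₂ =>
    have hM : ∀ r, Function.extend e s' S (e r) = s' r := fun r => he.extend_apply _ _ _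
    exact (ih₁ h0 hM fun r' hr => Function.extend_apply' _ _ _ hr).seq
      (ih₂ hM h1 fun r' hr => by rw [h2 _ hr, Function.extend_apply' _ _ _ hr])
  | condTrue hb _ ih => exact .condTrue (by rwa [h0]) (ih h0 h1 h2)
  | condFalse hb _ ih => exact .condFalse (by rwa [h0]) (ih h0 h1 h2)
  | @loopDone r p s hs =>
    obtain rfl : S = S' := by
      funext r'
      by_cases hr : r' ∈ Set.range e
      · obtain ⟨r, rfl⟩ := hr
        rw [h0, h1]
      · exact (h2 _ hr).symm
    exact .loopDone (by rwa [h0])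
  | @loopStep r p s s' s'' t t' hs _ _ ih₁ ih₂ =>
    have hM : ∀ r, Function.extend e s' S (e r) = s' r := fun r => he.extend_apply _ _ _
    exact .loopStep (by rwa [h0]) (ih₁ h0 hM fun r' hr => Function.extend_apply' _ _ _ hr)
      (ih₂ hM h1 fun r' hr => by rw [h2 _ hr, Function.extend_apply' _ _ _ hr])

theorem Runs.map {R' : Type} [DecidableEq R'] {e : R → R'} (he : Function.Injective e)
    (h : Runs p s s' T) {S S' : R' → Word} (h0 : ∀ r, S (e r) = s r) (h1 : ∀ r, S' (e r) = s' r)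
    (h2 : ∀ r', r' ∉ Set.range e → S' r' = S r') : Runs (p.map e) S S' T :=
  let ⟨t, ht, h⟩ := h
  ⟨t, ht, h.map he h0 h1 h2⟩

end Runs

namespace Prog

variable {R : Type}

/-- Run `P j` for all `j` in a list. -/
def forEach {ι : Type} (P : ι → Prog R) : List ι → Prog R
  | [] => skip
  | j :: l => seq (P j) (forEach P l)

/-- Empty the register `r`. -/
def clear (r : R) : Prog R := loop r (pop r)

/-- Move the topmost symbol of `r` to `r'`, provided that `r` is not empty. -/
def move (r r' : R) : Prog R :=
  seq (cond r (· = some none) (push r' none)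
    (cond r (· = some (some true)) (push r' (some true)) (push r' (some false)))) (pop r)

/-- Move all symbols of `r` to `r'`, which reverses their order. -/
def moveAll (r r' : R) : Prog R := loop r (move r r')

/-- Move the topmost symbol of `r` to both `r'` and `r''`, provided that `r` is not empty. -/
def moveTwo (r r' r'' : R) : Prog R :=
  seq (cond r (· = some none) (push r' none)
    (cond r (· = some (some true)) (push r' (some true)) (push r' (some false)))) (move r r'')

/-- Copy `r` to `r'`, with the help of the register `tmp`. -/
def copy (r r' tmp : R) : Prog R := seq (moveAll r tmp) (loop tmp (moveTwo tmp r r'))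

end Prog

section Runs

variable {R : Type} [DecidableEq R] {s s' : R → Word} {T N : ℕ}

theorem Runs.forEach {ι : Type} [DecidableEq ι] {P : ι → Prog R} (S : Finset ι → R → Word)
    (h : ∀ j A, j ∉ A → Runs (P j) (S A) (S (insert j A)) T) (l : List ι) (hl : l.Nodup)
    (A : Finset ι) (hA : ∀ j ∈ l, j ∉ A) :
    Runs (Prog.forEach P l) (S A) (S (A ∪ l.toFinset)) (l.length * T + 1) := by
  induction l generalizing A with
  | nil => simpa [Prog.forEach] using Runs.skip (S A)
  | cons j l ih =>
    rw [List.nodup_cons] at hl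
    have h1 := h j A (hA j (by simp))
    have h2 := ih hl.2 (insert j A) (by
      intro j' hj'
      rw [Finset.mem_insert]
      rintro (rfl | h')
      · exact hl.1 hj'
      · exact hA j' (by simp [hj']) h')
    refine ((h1.seq h2).of_eq ?_).mono ?_
    · congr 1
      ext j'
      simp only [Finset.mem_union, Finset.mem_insert, List.mem_toFinset, List.mem_cons]
      tauto
    · rw [List.length_cons, Nat.succ_mul]
      omega

theorem Runs.forEach_univ {ι : Type} [DecidableEq ι] [Fintype ι] {P : ι → Prog R}
    (S : Finset ι → R → Word) (h : ∀ j A, j ∉ A → Runs (P j) (S A) (S (insert j A)) T) :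
    Runs (Prog.forEach P Finset.univ.toList) (S ∅) (S Finset.univ)
      (Fintype.card ι * T + 1) := by
  have := Runs.forEach S h Finset.univ.toList (Finset.nodup_toList _) ∅ (by simp)
  simpa using this

theorem Runs.clear (r : R) (s : R → Word) :
    Runs (Prog.clear r) s (update s r []) ((s r).length * 2 + 1) := by
  have := Runs.loop (p := .pop r) (r := r) (w := s r) (T := 1)
    (fun i => update s r ((s r).drop i)) (by simp) (fun i _ => (Runs.pop r _).of_eq (by
      simp [List.tail_drop]))
  simpa [Prog.clear] using this

theorem Runs.pushHead {r r' : R} {c : Symb} {w : Word} (hs : s r = c :: w) :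
    Runs (.cond r (· = some none) (.push r' none)
      (.cond r (· = some (some true)) (.push r' (some true)) (.push r' (some false)))) s
      (update s r' (c :: s r')) 3 := by
  rcases c with _ | _ | _
  · exact (Runs.condTrue (by simp [hs]) (Runs.push _ _ _)).mono (by omega)
  · exact Runs.condFalse (by simp [hs]) (Runs.condFalse (by simp [hs]) (Runs.push _ _ _))
  · exact Runs.condFalse (by simp [hs]) (Runs.condTrue (by simp [hs]) (Runs.push _ _ _))

theorem Runs.move {r r' : R} (hr : r ≠ r') {c : Symb} {w : Word} (hs : s r = c :: w) :
    Runs (Prog.move r r') s (update (update s r' (c :: s r')) r w) 4 :=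
  ((Runs.pushHead hs).seq (Runs.pop _ _)).of_eq (by simp [hr, hs])

theorem Runs.moveTwo {r r' r'' : R} (h1 : r ≠ r') (h2 : r ≠ r'') (h3 : r' ≠ r'') {c : Symb}
    {w : Word} (hs : s r = c :: w) : Runs (Prog.moveTwo r r' r'') s
      (update (update (update s r' (c :: s r')) r'' (c :: s r'')) r w) 7 :=
  ((Runs.pushHead hs).seq (Runs.move h2 (c := c) (w := w) (by simp [h1, hs]))).of_eq
    (by simp [h3.symm])

theorem reverse_take_succ {α : Type} {w : List α} {i : ℕ} (hi : i < w.length) :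
    (w.take (i + 1)).reverse = w[i] :: (w.take i).reverse := by
  rw [List.take_succ_eq_append_getElem hi, List.reverse_append]
  rfl

theorem Runs.moveAll {r r' : R} (hr : r ≠ r') (s : R → Word) :
    Runs (Prog.moveAll r r') s (update (update s r' ((s r).reverse ++ s r')) r [])
      ((s r).length * 5 + 1) := by
  have := Runs.loop (p := .move r r') (r := r) (w := s r) (T := 4)
    (fun i => update (update s r' (((s r).take i).reverse ++ s r')) r ((s r).drop i)) (by simp)
    (fun i hi => (Runs.move hr (c := (s r)[i]) (w := (s r).drop (i + 1)) (by
      rw [Function.update_self, List.drop_eq_getElem_cons hi])).of_eq (by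
      funext k
      by_cases k1 : k = r
      · subst k1; simp
      by_cases k2 : k = r'
      · subst k2; simp [k1, reverse_take_succ hi]
      simp [k1, k2]))
  simpa [Prog.moveAll] using this

theorem Runs.copy {r r' tmp : R} (h1 : r ≠ r') (h2 : r ≠ tmp) (h3 : r' ≠ tmp)
    (hs : s tmp = []) (hs' : s r' = []) :
    Runs (Prog.copy r r' tmp) s (update s r' (s r)) ((s r).length * 13 + 2) := by
  have e1 := Runs.moveAll h2 s
  obtain ⟨w, hw⟩ : ∃ w, s r = w.reverse := ⟨(s r).reverse, by simp⟩
  have e2 := Runs.loop (p := .moveTwo tmp r r') (r := tmp) (w := w) (T := 7)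
    (fun i => update (update (update s r' ((w.take i).reverse)) r
      ((w.take i).reverse)) tmp (w.drop i)) (by simp)
    (fun i hi => (Runs.moveTwo h2.symm h3.symm h1 (c := w[i])
        (w := w.drop (i + 1)) (by
      rw [Function.update_self, List.drop_eq_getElem_cons hi])).of_eq (by
      funext k
      by_cases k1 : k = tmp
      · subst k1; simp
      by_cases k2 : k = r
      · subst k2; simp [h1, h2, reverse_take_succ hi]
      by_cases k3 : k = r'
      · subst k3; simp [h1.symm, h3, reverse_take_succ hi]
      simp [k1, k2, k3]))
  have e0 : update (update s tmp ((s r).reverse ++ s tmp)) r [] =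
      update (update (update s r' ((w.take 0).reverse)) r ((w.take 0).reverse)) tmp (w.drop 0) := by
    funext k
    by_cases k1 : k = tmp
    · subst k1; simp [h2.symm, hw, hs]
    by_cases k2 : k = r
    · subst k2; simp [h2]
    by_cases k3 : k = r'
    · subst k3; simp [h1.symm, h3, hs']
    simp [k1, k2, k3]
  rw [e0] at e1
  refine ((e1.seq e2).of_eq ?_).mono ?_
  · funext k
    by_cases k1 : k = tmp
    · subst k1; simp [h3.symm, hs]
    by_cases k2 : k = r
    · subst k2; simp [h2, h1, hw]
    by_cases k3 : k = r'
    · subst k3; simp [h1.symm, h3, hw]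
    simp [k1, k2, k3]
  · simp only [hw, List.length_reverse]
    omega

/-- Emptying a family of registers. -/
theorem Runs.clearAll {κ : Type} [DecidableEq κ] [Fintype κ] (d : κ → R)
    (hN : ∀ j, (s (d j)).length ≤ N) (h1 : ∀ j, s' (d j) = [])
    (h2 : ∀ r, r ∉ Set.range d → s' r = s r) :
    Runs (Prog.forEach (fun j => Prog.clear (d j)) Finset.univ.toList) s s'
      (Fintype.card κ * (N * 2 + 1) + 1) := by
  classical
  have := Runs.forEach_univ (P := fun j => Prog.clear (d j))
    (fun A r => if ∃ j ∈ A, d j = r then [] else s r) (T := N * 2 + 1) (fun j A _ => by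
      refine ((Runs.clear (d j) _).of_eq ?_).mono ?_
      · funext r
        by_cases hr : r = d j
        · subst hr
          simp
        · simp [hr, Ne.symm hr]
      · have := hN j
        split_ifs
        · simp
        · omega)
  simp only [Finset.notMem_empty, false_and, exists_false, if_false] at this
  refine this.of_eq ?_
  funext r
  by_cases hr : r ∈ Set.range d
  · obtain ⟨j, rfl⟩ := hr
    simp [h1]
  · rw [h2 r hr, if_neg]
    rintro ⟨j, _, hj⟩
    exact hr ⟨j, hj⟩

/-- Copying a family of registers to another one. -/
theorem Runs.copyAll {κ : Type} [DecidableEq κ] [Fintype κ] (c d : κ → R) (tmp : R)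
    (hd : Function.Injective d) (hcd : ∀ i j, c i ≠ d j) (hc : ∀ j, c j ≠ tmp)
    (hd' : ∀ j, d j ≠ tmp)
    (h0 : ∀ j, s (d j) = []) (ht : s tmp = []) (hN : ∀ j, (s (c j)).length ≤ N)
    (h1 : ∀ j, s' (d j) = s (c j)) (h2 : ∀ r, r ∉ Set.range d → s' r = s r) :
    Runs (Prog.forEach (fun j => Prog.copy (c j) (d j) tmp) Finset.univ.toList) s s'
      (Fintype.card κ * (N * 13 + 2) + 1) := by
  classical
  have e1 : ∀ (A : Finset κ) r, r ∉ Set.range d → (if ∃ j ∈ A, d j = r then s' r else s r) = s r :=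
    fun A r hr => if_neg fun ⟨j, _, hj⟩ => hr ⟨j, hj⟩
  have := Runs.forEach_univ (P := fun j => Prog.copy (c j) (d j) tmp)
    (fun A r => if ∃ j ∈ A, d j = r then s' r else s r) (T := N * 13 + 2) (fun j A hj => by
      have hcj : c j ∉ Set.range d := fun ⟨i, hi⟩ => hcd j i hi.symm
      refine ((Runs.copy (hcd j j) (hc j) (hd' j) ?_ ?_).of_eq ?_).mono ?_
      · rw [e1 A tmp fun ⟨i, hi⟩ => hd' i hi, ht]
      · rw [if_neg, h0]
        rintro ⟨i, hi, hij⟩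
        exact hj (hd hij ▸ hi)
      · funext r
        by_cases hr : r = d j
        · subst hr
          simp [e1 A _ hcj, h1]
        · simp [hr, Ne.symm hr]
      · rw [e1 A _ hcj]
        have := hN j
        omega)
  simp only [Finset.notMem_empty, false_and, exists_false, if_false] at this
  refine this.of_eq ?_
  funext r
  by_cases hr : r ∈ Set.range d
  · obtain ⟨j, rfl⟩ := hr
    simp
  · exact (e1 _ r hr).trans (h2 r hr).symm

end Runs


/-! ### Functions on families of words that are computable in polynomial time -/

theorem eval_mono_nat (p : Polynomial ℕ) {m n : ℕ} (h : m ≤ n) : p.eval m ≤ p.eval n := by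
  rw [Polynomial.eval_eq_sum_range, Polynomial.eval_eq_sum_range]
  gcongr

section wsize

variable {ι κ : Type} [Fintype ι] [Fintype κ]

/-- The total length of a family of words. -/
def wsize (x : ι → Word) : ℕ := ∑ i, (x i).length

theorem length_le_wsize (x : ι → Word) (i : ι) : (x i).length ≤ wsize x :=
  Finset.single_le_sum (f := fun i => (x i).length) (fun _ _ => Nat.zero_le _) (Finset.mem_univ i)

@[simp] theorem wsize_elim (x : ι → Word) (y : κ → Word) :
    wsize (Sum.elim x y) = wsize x + wsize y := by
  simp [wsize]

theorem wsize_comp_le_of_injective (x : ι → Word) {ρ : κ → ι} (hρ : Function.Injective ρ) :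
    wsize (fun j => x (ρ j)) ≤ wsize x := by
  classical
  unfold wsize
  rw [← Finset.sum_image (f := fun i => (x i).length) (s := Finset.univ) (g := ρ) hρ.injOn]
  exact Finset.sum_le_sum_of_subset (Finset.subset_univ _)

theorem wsize_comp_le (x : ι → Word) (ρ : κ → ι) :
    wsize (fun j => x (ρ j)) ≤ Fintype.card κ * wsize x := by
  unfold wsize
  refine (Finset.sum_le_card_nsmul _ _ (wsize x) fun j _ => length_le_wsize x _).trans ?_
  simp [wsize]

end wsize

/-- Register contents: input registers, output registers, and auxiliary registers. -/
abbrev regs {ι κ T : Type} (x : ι → Word) (y : κ → Word) (z : T → Word) : ι ⊕ κ ⊕ T → Word :=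
  Sum.elim x (Sum.elim y z)

/-- Empty registers. -/
abbrev noWords {T : Type} : T → Word := fun _ => []

/-- There is a program that, for all `a`, computes the words `y a` from the words `x a` in time
polynomial in the size of `x a`, keeping its input and cleaning up its auxiliary registers; and the
size of `y a` is polynomial in that of `x a`. The index `a` is arbitrary: a program sees only the
words `x a`, so that `x` also expresses assumptions on the input. -/
def PolyComp {α ι κ : Type} [Fintype ι] [DecidableEq ι] [Fintype κ] [DecidableEq κ]
    (x : α → ι → Word) (y : α → κ → Word) : Prop :=
  ∃ (T : Type) (_ : Fintype T) (_ : DecidableEq T) (p : Prog (ι ⊕ κ ⊕ T)) (b : Polynomial ℕ),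
    ∀ a, wsize (y a) ≤ b.eval (wsize (x a)) ∧
      Runs p (regs (x a) noWords noWords) (regs (x a) (y a) noWords) (b.eval (wsize (x a)))

namespace PolyComp

variable {α ι κ μ : Type} [Fintype ι] [DecidableEq ι] [Fintype κ] [DecidableEq κ]
  [Fintype μ] [DecidableEq μ] {x : α → ι → Word} {y : α → κ → Word} {z : α → μ → Word}

/-- Restriction to a subfamily of the instances. -/
theorem restrict {α' : Type} (h : PolyComp x y) (f : α' → α) :
    PolyComp (fun a => x (f a)) (fun a => y (f a)) := by
  obtain ⟨T, _, _, p, b, h⟩ := h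
  exact ⟨T, inferInstance, inferInstance, p, b, fun a => h (f a)⟩

/-- Additional input registers do no harm. -/
theorem weaken (ρ : κ → ι) (hρ : Function.Injective ρ)
    (h : PolyComp (fun a j => x a (ρ j)) z) : PolyComp x z := by
  obtain ⟨T, _, _, p, b, h⟩ := h
  refine ⟨T, inferInstance, inferInstance, p.map (Sum.map ρ id), b, fun a => ?_⟩
  have hb := eval_mono_nat b (wsize_comp_le_of_injective (x a) hρ)
  refine ⟨(h a).1.trans hb, ((h a).2.map (Sum.map_injective.2 ⟨hρ, Function.injective_id⟩)
    ?_ ?_ ?_).mono hb⟩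
  · rintro (j | j | j) <;> rfl
  · rintro (j | j | j) <;> rfl
  · rintro (i | j | j) hr
    · rfl
    · exact (hr ⟨.inr (.inl j), rfl⟩).elim
    · exact (hr ⟨.inr (.inr j), rfl⟩).elim

/-- Selecting, duplicating and permuting words. -/
theorem proj (x : α → ι → Word) (ρ : κ → ι) : PolyComp x (fun a j => x a (ρ j)) := by
  refine ⟨Unit, inferInstance, inferInstance,
    Prog.forEach (fun j => Prog.copy (.inl (ρ j)) (.inr (.inl j)) (.inr (.inr ())))
      Finset.univ.toList,
    (Fintype.card κ : Polynomial ℕ) * (.X * 13 + 2) + 1, fun a => ⟨?_, ?_⟩⟩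
  · refine (wsize_comp_le (x a) ρ).trans ?_
    simp only [Polynomial.eval_add, Polynomial.eval_mul, Polynomial.eval_natCast, Nat.cast_id,
      Polynomial.eval_X, Polynomial.eval_ofNat, Polynomial.eval_one]
    have := Nat.mul_le_mul_left (Fintype.card κ) (show wsize (x a) ≤ wsize (x a) * 13 + 2 by omega)
    omega
  · simp only [Polynomial.eval_add, Polynomial.eval_mul, Polynomial.eval_natCast, Nat.cast_id,
      Polynomial.eval_X, Polynomial.eval_ofNat, Polynomial.eval_one]
    refine Runs.copyAll _ _ _ ?_ ?_ ?_ ?_ ?_ ?_ ?_ ?_ ?_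
    · exact fun i j h => Sum.inl_injective (Sum.inr_injective h)
    · simp
    · simp
    · simp
    · simp
    · simp
    · exact fun j => length_le_wsize (x a) (ρ j)
    · simp
    · rintro (i | j | j) hr
      · rfl
      · exact (hr ⟨j, rfl⟩).elim
      · rfl

/-- Local definitions: the words `y a` may be used to compute `z a`. -/
theorem letIn (h₁ : PolyComp x y) (h₂ : PolyComp (fun a => Sum.elim (x a) (y a)) z) :
    PolyComp x z := by
  obtain ⟨T₁, _, _, p₁, b₁, h₁⟩ := h₁
  obtain ⟨T₂, _, _, p₂, b₂, h₂⟩ := h₂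
  let e₁ : ι ⊕ κ ⊕ T₁ → ι ⊕ μ ⊕ (κ ⊕ T₁ ⊕ T₂) :=
    Sum.elim .inl (Sum.elim (fun j => .inr (.inr (.inl j))) fun t => .inr (.inr (.inr (.inl t))))
  let e₂ : (ι ⊕ κ) ⊕ μ ⊕ T₂ → ι ⊕ μ ⊕ (κ ⊕ T₁ ⊕ T₂) :=
    Sum.elim (Sum.elim .inl fun j => .inr (.inr (.inl j)))
      (Sum.elim (fun j => .inr (.inl j)) fun t => .inr (.inr (.inr (.inr t))))
  have he₁ : Function.Injective e₁ := by
    rintro (i | i | i) (j | j | j) h <;> simp_all [e₁]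
  have he₂ : Function.Injective e₂ := by
    rintro ((i | i) | i | i) ((j | j) | j | j) h <;> simp_all [e₂]
  refine ⟨κ ⊕ T₁ ⊕ T₂, inferInstance, inferInstance, .seq (.seq (p₁.map e₁) (p₂.map e₂))
    (.forEach (fun j => .clear (.inr (.inr (.inl j)))) Finset.univ.toList),
    b₂.comp (.X + b₁) + (b₁ + (Fintype.card κ : Polynomial ℕ) * (b₁ * 2 + 1) + 1),
    fun a => ?_⟩
  have hy := (h₁ a).1
  have hb : b₂.eval (wsize (x a) + wsize (y a)) ≤ b₂.eval (wsize (x a) + b₁.eval (wsize (x a))) :=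
    eval_mono_nat b₂ (by omega)
  have hz := (h₂ a).1
  have r₂ := (h₂ a).2
  rw [wsize_elim] at hz r₂
  simp only [Polynomial.eval_add, Polynomial.eval_mul, Polynomial.eval_natCast, Nat.cast_id,
    Polynomial.eval_X, Polynomial.eval_ofNat, Polynomial.eval_one, Polynomial.eval_comp]
  refine ⟨by omega, ?_⟩
  have s₁ := (h₁ a).2.map he₁ (S := regs (x a) noWords noWords)
    (S' := regs (x a) noWords (Sum.elim (y a) noWords))
    (by rintro (j | j | j) <;> rfl) (by rintro (j | j | j) <;> rfl) (by
      rintro (i | i | i | i | i) hr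
      · rfl
      · rfl
      · exact (hr ⟨.inr (.inl i), rfl⟩).elim
      · rfl
      · rfl)
  have s₂ := r₂.map he₂ (S := regs (x a) noWords (Sum.elim (y a) noWords))
    (S' := regs (x a) (z a) (Sum.elim (y a) noWords))
    (by rintro ((j | j) | j | j) <;> rfl) (by rintro ((j | j) | j | j) <;> rfl) (by
      rintro (i | i | i | i | i) hr
      · rfl
      · exact (hr ⟨.inr (.inl i), rfl⟩).elim
      · rfl
      · rfl
      · rfl)
  have s₃ := Runs.clearAll (κ := κ) (fun j => (.inr (.inr (.inl j)) : ι ⊕ μ ⊕ (κ ⊕ T₁ ⊕ T₂)))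
    (s := regs (x a) (z a) (Sum.elim (y a) noWords)) (s' := regs (x a) (z a) noWords)
    (N := b₁.eval (wsize (x a))) (fun j => (length_le_wsize (y a) j).trans hy) (fun j => rfl) (by
      rintro (i | i | i | i | i) hr
      · rfl
      · rfl
      · exact (hr ⟨i, rfl⟩).elim
      · rfl
      · rfl)
  exact ((s₁.seq s₂).seq s₃).mono (by omega)

theorem comp (h₁ : PolyComp x y) (h₂ : PolyComp y z) : PolyComp x z :=
  h₁.letIn (weaken (x := fun a => Sum.elim (x a) (y a)) Sum.inr Sum.inr_injective h₂)

theorem reindex (h : PolyComp x y) (ρ : μ → κ) : PolyComp x (fun a j => y a (ρ j)) :=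
  h.comp (proj y ρ)

theorem pair (h₁ : PolyComp x y) (h₂ : PolyComp x z) :
    PolyComp x (fun a => Sum.elim (y a) (z a)) := by
  refine h₁.letIn ((weaken (x := fun a => Sum.elim (x a) (y a)) Sum.inl Sum.inl_injective
    h₂).letIn ?_)
  have := proj (fun a => Sum.elim (Sum.elim (x a) (y a)) (z a))
    (Sum.elim (fun j => .inl (.inr j)) fun j => .inr j : κ ⊕ μ → (ι ⊕ κ) ⊕ μ)
  refine (Eq.mp ?_ this)
  congr 1
  funext a j
  cases j <;> rfl

/-- Case distinction on the first symbol of an input word. -/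
theorem ite {y' : α → κ → Word} (i : ι) (t : Option Symb → Bool) (h₁ : PolyComp x y)
    (h₂ : PolyComp x y') : PolyComp x (fun a => if t (x a i).head? then y a else y' a) := by
  obtain ⟨T₁, _, _, p₁, b₁, h₁⟩ := h₁
  obtain ⟨T₂, _, _, p₂, b₂, h₂⟩ := h₂
  let e₁ : ι ⊕ κ ⊕ T₁ → ι ⊕ κ ⊕ (T₁ ⊕ T₂) := Sum.map id (Sum.map id Sum.inl)
  let e₂ : ι ⊕ κ ⊕ T₂ → ι ⊕ κ ⊕ (T₁ ⊕ T₂) := Sum.map id (Sum.map id Sum.inr)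
  have he₁ : Function.Injective e₁ := by
    rintro (i | i | i) (j | j | j) h <;> simp_all [e₁]
  have he₂ : Function.Injective e₂ := by
    rintro (i | i | i) (j | j | j) h <;> simp_all [e₂]
  refine ⟨T₁ ⊕ T₂, inferInstance, inferInstance, .cond (.inl i) t (p₁.map e₁) (p₂.map e₂),
    b₁ + b₂ + 1, fun a => ?_⟩
  simp only [Polynomial.eval_add, Polynomial.eval_one]
  have s₁ := (h₁ a).2.map he₁ (S := regs (x a) noWords noWords)
    (S' := regs (x a) (y a) noWords)
    (by rintro (j | j | j) <;> rfl) (by rintro (j | j | j) <;> rfl) (by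
      rintro (i | i | i | i) hr
      · rfl
      · exact (hr ⟨.inr (.inl i), rfl⟩).elim
      · rfl
      · rfl)
  have s₂ := (h₂ a).2.map he₂ (S := regs (x a) noWords noWords)
    (S' := regs (x a) (y' a) noWords)
    (by rintro (j | j | j) <;> rfl) (by rintro (j | j | j) <;> rfl) (by
      rintro (i | i | i | i) hr
      · rfl
      · exact (hr ⟨.inr (.inl i), rfl⟩).elim
      · rfl
      · rfl)
  have z₁ := (h₁ a).1
  have z₂ := (h₂ a).1
  by_cases ht : t (x a i).head? = true
  · rw [if_pos ht]
    exact ⟨by omega, (Runs.condTrue (s := regs (x a) noWords noWords) (r := .inl i)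
      ht s₁).mono (by omega)⟩
  · rw [if_neg ht]
    exact ⟨by omega, (Runs.condFalse (s := regs (x a) noWords noWords) (r := .inl i)
      (by simpa using ht) s₂).mono (by omega)⟩

/-- Post-processing of a single output word by one instruction. -/
theorem instr {u u' : α → Word} {q : Prog Unit} (h : PolyComp x (fun a (_ : Unit) => u a))
    (hq : ∀ a, Runs q (fun _ => u a) (fun _ => u' a) 1)
    (hl : ∀ a, (u' a).length ≤ (u a).length + 1) :
    PolyComp x (fun a (_ : Unit) => u' a) := by
  obtain ⟨T, _, _, p, b, h⟩ := h
  refine ⟨T, inferInstance, inferInstance, .seq p (q.map fun _ => .inr (.inl ())), b + 1,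
    fun a => ⟨?_, ?_⟩⟩
  · have := (h a).1
    have := hl a
    simp only [wsize, Finset.univ_unique, Finset.sum_const, Finset.card_singleton, one_smul,
      Polynomial.eval_add, Polynomial.eval_one] at *
    omega
  · simp only [Polynomial.eval_add, Polynomial.eval_one]
    refine (h a).2.seq ((hq a).map (Function.injective_of_subsingleton _) (fun _ => rfl)
      (fun _ => rfl) ?_)
    rintro (i | i | i) hr
    · rfl
    · exact (hr ⟨(), rfl⟩).elim
    · rfl

theorem cons {u : α → Word} (h : PolyComp x (fun a (_ : Unit) => u a)) (c : Symb) :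
    PolyComp x (fun a (_ : Unit) => c :: u a) :=
  h.instr (q := .push () c) (fun a => (Runs.push _ _ _).of_eq (by funext r; simp)) (by simp)

theorem tail {u : α → Word} (h : PolyComp x (fun a (_ : Unit) => u a)) :
    PolyComp x (fun a (_ : Unit) => (u a).tail) :=
  h.instr (q := .pop ()) (fun a => (Runs.pop _ _).of_eq (by funext r; simp))
    (fun a => by simp; omega)

theorem nil (x : α → ι → Word) : PolyComp x (fun _ (_ : Unit) => []) :=
  ⟨Empty, inferInstance, inferInstance, .skip, 1, fun a =>
    ⟨by simp [wsize], by simpa using Runs.skip _⟩⟩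

theorem const_unit (x : α → ι → Word) (w : Word) : PolyComp x (fun _ (_ : Unit) => w) := by
  induction w with
  | nil => exact nil x
  | cons c w ih => exact ih.cons c

set_option synthInstance.maxSize 1000 in
/-- Bounded iteration: if the words `B a (i + 1)` are computed from `x a` and `B a i`, and all
`B a i` have polynomial size, then the result of as many rounds as the word `x a r` has symbols
can be computed. -/
theorem iter (r : ι) (B : α → ℕ → κ → Word) (h₀ : PolyComp x fun a => B a 0)
    (h₁ : PolyComp (α := (a : α) × Fin (x a r).length) (fun q => Sum.elim (x q.1) (B q.1 q.2))
      fun q => B q.1 (q.2 + 1))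
    (hB : ∃ p : Polynomial ℕ, ∀ a, ∀ i ≤ (x a r).length, wsize (B a i) ≤ p.eval (wsize (x a))) :
    PolyComp x fun a => B a (x a r).length := by
  obtain ⟨T₀, _, _, p₀, b₀, h₀⟩ := h₀
  obtain ⟨T₁, _, _, p₁, b₁, h₁⟩ := h₁
  obtain ⟨b, hB⟩ := hB
  -- auxiliary registers: the counter, a temporary register, the next value, and those of `p₀`, `p₁`
  let ctr : ι ⊕ κ ⊕ Unit ⊕ Unit ⊕ κ ⊕ T₀ ⊕ T₁ := .inr (.inr (.inl ()))
  let tmp : ι ⊕ κ ⊕ Unit ⊕ Unit ⊕ κ ⊕ T₀ ⊕ T₁ := .inr (.inr (.inr (.inl ())))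
  let nxt : κ → ι ⊕ κ ⊕ Unit ⊕ Unit ⊕ κ ⊕ T₀ ⊕ T₁ := fun j => .inr (.inr (.inr (.inr (.inl j))))
  let out : κ → ι ⊕ κ ⊕ Unit ⊕ Unit ⊕ κ ⊕ T₀ ⊕ T₁ := fun j => .inr (.inl j)
  let e₀ : ι ⊕ κ ⊕ T₀ → ι ⊕ κ ⊕ Unit ⊕ Unit ⊕ κ ⊕ T₀ ⊕ T₁ :=
    Sum.map id (Sum.map id fun t => .inr (.inr (.inr (.inl t))))
  let e₁ : (ι ⊕ κ) ⊕ κ ⊕ T₁ → ι ⊕ κ ⊕ Unit ⊕ Unit ⊕ κ ⊕ T₀ ⊕ T₁ :=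
    Sum.elim (Sum.elim .inl out) (Sum.elim nxt fun t => .inr (.inr (.inr (.inr (.inr (.inr t))))))
  have he₀ : Function.Injective e₀ := by
    rintro (i | i | i) (j | j | j) h <;> simp_all [e₀]
  have he₁ : Function.Injective e₁ := by
    rintro ((i | i) | i | i) ((j | j) | j | j) h <;> simp_all [e₁, out, nxt]
  let body : Prog (ι ⊕ κ ⊕ Unit ⊕ Unit ⊕ κ ⊕ T₀ ⊕ T₁) := .seq (.pop ctr) (.seq (p₁.map e₁)
    (.seq (.forEach (fun j => .clear (out j)) Finset.univ.toList)
      (.seq (.forEach (fun j => .copy (nxt j) (out j) tmp) Finset.univ.toList)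
        (.forEach (fun j => .clear (nxt j)) Finset.univ.toList))))
  -- register contents: `B a i` in the output, `c` in the counter, `n` in the next value
  let st (a : α) (y : κ → Word) (c : Word) (n : κ → Word) :
      ι ⊕ κ ⊕ Unit ⊕ Unit ⊕ κ ⊕ T₀ ⊕ T₁ → Word :=
    regs (x a) y (Sum.elim (fun _ => c) (Sum.elim noWords (Sum.elim n noWords)))
  let cκ : Polynomial ℕ := (Fintype.card κ : Polynomial ℕ)
  let tb : Polynomial ℕ := 1 + (b₁.comp (.X + b) + ((cκ * (b * 2 + 1) + 1) +
    ((cκ * (b * 13 + 2) + 1) + (cκ * (b * 2 + 1) + 1))))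
  refine ⟨Unit ⊕ Unit ⊕ κ ⊕ T₀ ⊕ T₁, inferInstance, inferInstance,
    .seq (.seq (p₀.map e₀) (.copy (.inl r) ctr tmp))
    (.loop ctr body), b₀ + (.X * 13 + 2) + (.X * (tb + 1) + 1) + b, fun a => ?_⟩
  have hr : (x a r).length ≤ wsize (x a) := length_le_wsize _ _
  have s₀ : Runs (p₀.map e₀) (regs (x a) noWords noWords) (st a (B a 0) [] noWords)
      (b₀.eval (wsize (x a))) :=
    (h₀ a).2.map he₀ (by rintro (j | j | j) <;> rfl) (by rintro (j | j | j) <;> rfl) (by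
      rintro (i | i | i | i | i | i | i) hr
      · rfl
      · exact (hr ⟨.inr (.inl i), rfl⟩).elim
      all_goals rfl)
  have s₁ : Runs (.copy (.inl r) ctr tmp) (st a (B a 0) [] noWords)
      (st a (B a 0) (x a r) noWords) (wsize (x a) * 13 + 2) :=
    ((Runs.copy (by simp [ctr]) (by simp [tmp]) (by simp [ctr, tmp]) rfl rfl).of_eq (by
      funext k
      rcases k with i | i | i | i | i | i | i <;> simp [st, ctr])).mono (by
        simp only [st, Sum.elim_inl]
        omega)
  have s₂ : ∀ i < (x a r).length, Runs body (st a (B a i) ((x a r).drop i) noWords)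
      (st a (B a (i + 1)) ((x a r).drop (i + 1)) noWords) (tb.eval (wsize (x a))) := by
    intro i hi
    have g₁ : Runs (.pop ctr) (st a (B a i) ((x a r).drop i) noWords)
        (st a (B a i) ((x a r).drop (i + 1)) noWords) 1 :=
      (Runs.pop _ _).of_eq (by
        funext k
        rcases k with i | i | i | i | i | i | i <;> simp [st, ctr, List.tail_drop])
    have g₂ : Runs (p₁.map e₁) (st a (B a i) ((x a r).drop (i + 1)) noWords)
        (st a (B a i) ((x a r).drop (i + 1)) (B a (i + 1)))
        (b₁.eval (wsize (x a) + b.eval (wsize (x a)))) := by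
      have hq := (h₁ ⟨a, i, hi⟩).2
      rw [wsize_elim] at hq
      refine (hq.mono (eval_mono_nat b₁ (Nat.add_le_add_left (hB a i hi.le) _))).map he₁
        (by rintro ((j | j) | j | j) <;> rfl) (by rintro ((j | j) | j | j) <;> rfl) ?_
      rintro (i | i | i | i | i | i | i) hr
      · rfl
      · rfl
      · rfl
      · rfl
      · exact (hr ⟨.inr (.inl i), rfl⟩).elim
      · rfl
      · rfl
    have g₃ := Runs.clearAll out (s := st a (B a i) ((x a r).drop (i + 1)) (B a (i + 1)))
      (s' := st a noWords ((x a r).drop (i + 1)) (B a (i + 1))) (N := b.eval (wsize (x a)))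
      (fun j => (length_le_wsize (B a i) j).trans (hB a i hi.le)) (fun j => rfl) (by
        rintro (i | i | i | i | i | i | i) hr
        · rfl
        · exact (hr ⟨i, rfl⟩).elim
        all_goals rfl)
    have g₄ := Runs.copyAll nxt out tmp (s := st a noWords ((x a r).drop (i + 1)) (B a (i + 1)))
      (s' := st a (B a (i + 1)) ((x a r).drop (i + 1)) (B a (i + 1))) (N := b.eval (wsize (x a)))
      (fun i j h => by simpa [out] using h) (by simp [nxt, out]) (by simp [nxt, tmp])
      (by simp [out, tmp]) (fun j => rfl) rfl
      (fun j => (length_le_wsize (B a (i + 1)) j).trans (hB a (i + 1) hi)) (fun j => rfl) (by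
        rintro (i | i | i | i | i | i | i) hr
        · rfl
        · exact (hr ⟨i, rfl⟩).elim
        all_goals rfl)
    have g₅ := Runs.clearAll nxt
      (s := st a (B a (i + 1)) ((x a r).drop (i + 1)) (B a (i + 1)))
      (s' := st a (B a (i + 1)) ((x a r).drop (i + 1)) noWords) (N := b.eval (wsize (x a)))
      (fun j => (length_le_wsize (B a (i + 1)) j).trans (hB a (i + 1) hi)) (fun j => rfl) (by
        rintro (i | i | i | i | i | i | i) hr
        · rfl
        · rfl
        · rfl
        · rfl
        · exact (hr ⟨i, rfl⟩).elim
        all_goals rfl)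
    refine (g₁.seq (g₂.seq (g₃.seq (g₄.seq g₅)))).mono (le_of_eq ?_)
    simp only [tb, cκ, Polynomial.eval_add, Polynomial.eval_mul, Polynomial.eval_natCast,
      Nat.cast_id, Polynomial.eval_X, Polynomial.eval_ofNat, Polynomial.eval_one,
      Polynomial.eval_comp]
  have s₃ := Runs.loop (r := ctr) (p := body)
    (fun i => st a (B a i) ((x a r).drop i) noWords) (w := x a r) (fun i _ => rfl) s₂
  simp only [List.drop_length, List.drop_zero] at s₃
  have e : st a (B a (x a r).length) [] noWords = regs (x a) (B a (x a r).length) noWords := by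
    funext k
    rcases k with i | i | i | i | i | i | i <;> rfl
  rw [e] at s₃
  simp only [Polynomial.eval_add, Polynomial.eval_mul,
    Polynomial.eval_X, Polynomial.eval_ofNat, Polynomial.eval_one]
  refine ⟨(hB a _ le_rfl).trans (by omega), ((s₀.seq s₁).seq s₃).mono ?_⟩
  have := Nat.mul_le_mul_right (tb.eval (wsize (x a)) + 1) hr
  omega

end PolyComp


/-! ### Functions that are computable in polynomial time -/

/-- A representation of the elements of `α` by families of words, indexed by `ι`. Natural numbers
are represented in unary: all of those that occur in the kernelization, except for the parameter,
are polynomial in the length of the input. -/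
class Env (α : Type) where
  ι : Type
  [fin : Fintype ι]
  [dec : DecidableEq ι]
  enc : α → ι → Word

attribute [reducible, instance] Env.fin Env.dec

instance : Env Word := { ι := Unit, enc := fun w _ => w }

instance : Env Symb := { ι := Unit, enc := fun c _ => [c] }

instance : Env ℕ := { ι := Unit, enc := fun n _ => List.replicate n (some true) }

open scoped Classical in
/-- Truth values are represented by the empty word and a word with one symbol. -/
noncomputable instance : Env Prop :=
  { ι := Unit, enc := fun P _ => if P then [some true] else [] }

instance {α β : Type} [Env α] [Env β] : Env (α × β) :=
  { ι := Env.ι α ⊕ Env.ι β, enc := fun p => Sum.elim (Env.enc p.1) (Env.enc p.2) }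

/-- The size of the representation of an element. -/
def esize {α : Type} [Env α] (a : α) : ℕ := wsize (Env.enc a)

@[simp] theorem esize_word (w : Word) : esize w = w.length := by
  simp [esize, wsize, Env.enc, Env.ι]

@[simp] theorem esize_nat (n : ℕ) : esize n = n := by
  simp [esize, wsize, Env.enc, Env.ι]

@[simp] theorem esize_prod {α β : Type} [Env α] [Env β] (a : α) (b : β) :
    esize (a, b) = esize a + esize b :=
  wsize_elim _ _

/-- `f` is computable in time polynomial in the size of its argument. For predicates `f`, this means
that `f` is decidable in polynomial time. -/
@[fun_prop]
def PolyTime {α β : Type} [Env α] [Env β] (f : α → β) : Prop :=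
  PolyComp (fun a => Env.enc a) fun a => Env.enc (f a)

/-- `h` is bounded by a polynomial in the size of its argument. -/
def PolyBounded {α : Type} [Env α] (h : α → ℕ) : Prop :=
  ∃ p : Polynomial ℕ, ∀ a, h a ≤ p.eval (esize a)

namespace PolyBounded

variable {α : Type} [Env α] {g h : α → ℕ}

theorem mono (hh : PolyBounded h) (hgh : ∀ a, g a ≤ h a) : PolyBounded g :=
  let ⟨p, hp⟩ := hh
  ⟨p, fun a => (hgh a).trans (hp a)⟩

theorem add (hg : PolyBounded g) (hh : PolyBounded h) : PolyBounded fun a => g a + h a := by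
  obtain ⟨p, hp⟩ := hg
  obtain ⟨q, hq⟩ := hh
  exact ⟨p + q, fun a => by simpa using Nat.add_le_add (hp a) (hq a)⟩

theorem mul (hg : PolyBounded g) (hh : PolyBounded h) : PolyBounded fun a => g a * h a := by
  obtain ⟨p, hp⟩ := hg
  obtain ⟨q, hq⟩ := hh
  exact ⟨p * q, fun a => by simpa using Nat.mul_le_mul (hp a) (hq a)⟩

end PolyBounded

namespace PolyTime

variable {α β γ δ : Type} [Env α] [Env β] [Env γ] [Env δ]

theorem bounded {f : α → β} (hf : PolyTime f) : PolyBounded fun a => esize (f a) := by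
  obtain ⟨T, _, _, p, b, h⟩ := hf
  exact ⟨b, fun a => (h a).1⟩

theorem bounded_nat {f : α → ℕ} (hf : PolyTime f) : PolyBounded f :=
  hf.bounded.mono fun a => by simp

theorem recode {f : α → β} {g : α → γ} (hf : PolyTime f) (ρ : Env.ι γ → Env.ι β)
    (h : ∀ a j, Env.enc (g a) j = Env.enc (f a) (ρ j)) : PolyTime g := by
  have := PolyComp.reindex hf ρ
  refine Eq.mp ?_ this
  unfold PolyTime
  congr 1
  funext a j
  exact (h a j).symm

@[fun_prop]
theorem comp {g : β → γ} {f : α → β} (hg : PolyTime g) (hf : PolyTime f) :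
    PolyTime fun a => g (f a) :=
  PolyComp.comp hf (PolyComp.restrict hg f)

@[fun_prop]
theorem id : PolyTime fun a : α => a := PolyComp.proj _ fun j => j

@[fun_prop]
theorem fst : PolyTime fun p : α × β => p.1 := id.recode Sum.inl fun _ _ => rfl

@[fun_prop]
theorem snd : PolyTime fun p : α × β => p.2 := id.recode Sum.inr fun _ _ => rfl

@[fun_prop]
theorem prodMk {f : α → β} {g : α → γ} (hf : PolyTime f) (hg : PolyTime g) :
    PolyTime fun a => (f a, g a) :=
  PolyComp.pair hf hg

@[fun_prop]
theorem const_word (w : Word) : PolyTime fun _ : α => w := PolyComp.const_unit _ w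

@[fun_prop]
theorem const_nat (n : ℕ) : PolyTime fun _ : α => n :=
  (const_word (List.replicate n (some true))).recode (fun j => j) fun _ _ => rfl

@[fun_prop]
theorem const_symb (c : Symb) : PolyTime fun _ : α => c :=
  (const_word [c]).recode (fun j => j) fun _ _ => rfl

open scoped Classical in
@[fun_prop]
theorem const_prop (P : Prop) : PolyTime fun _ : α => P :=
  (const_word (if P then [some true] else [])).recode (fun j => j) fun _ _ => rfl

theorem cons_const {f : α → Word} (hf : PolyTime f) (c : Symb) : PolyTime fun a => c :: f a :=
  PolyComp.cons hf c

@[fun_prop]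
theorem tail {f : α → Word} (hf : PolyTime f) : PolyTime fun a => (f a).tail :=
  PolyComp.tail hf

@[fun_prop]
theorem ite {c : α → Prop} [∀ a, Decidable (c a)] {f g : α → β} (hc : PolyTime c)
    (hf : PolyTime f) (hg : PolyTime g) : PolyTime fun a => if c a then f a else g a := by
  have h₁ : PolyComp (fun a => Sum.elim (Env.enc a) (Env.enc (c a))) fun a => Env.enc (f a) :=
    .weaken Sum.inl Sum.inl_injective hf
  have h₂ : PolyComp (fun a => Sum.elim (Env.enc a) (Env.enc (c a))) fun a => Env.enc (g a) :=
    .weaken Sum.inl Sum.inl_injective hg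
  have := PolyComp.letIn hc (h₁.ite (Sum.inr ()) Option.isSome h₂)
  refine Eq.mp ?_ this
  unfold PolyTime
  congr 1
  funext a
  by_cases h : c a <;> simp [Env.enc, h]

theorem head_test (t : Option Symb → Bool) {f : α → Word} (hf : PolyTime f) :
    PolyTime fun a => t (f a).head? = true := by
  have h₁ : PolyComp (fun w : Word => Env.enc w) fun w => Env.enc True := const_prop True
  have h₂ : PolyComp (fun w : Word => Env.enc w) fun w => Env.enc False := const_prop False
  have : PolyTime fun w : Word => t w.head? = true := by
    have := h₁.ite () t h₂
    refine Eq.mp ?_ this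
    unfold PolyTime
    congr 1
    funext a
    change (if t a.head? = true then _ else _) = _
    cases h : t a.head? <;> simp <;> congr 1 <;> simp [h]
  exact this.comp hf

theorem of_iff {P Q : α → Prop} (hP : PolyTime P) (h : ∀ a, Q a ↔ P a) : PolyTime Q := by
  rwa [show Q = P from funext fun a => propext (h a)]

theorem of_eq {f g : α → β} (hf : PolyTime f) (h : ∀ a, g a = f a) : PolyTime g := by
  rwa [show g = f from funext h]

open scoped Classical in
@[fun_prop]
theorem not {P : α → Prop} (hP : PolyTime P) : PolyTime fun a => ¬ P a :=
  (hP.ite (const_prop False) (const_prop True)).of_iff fun a => by by_cases h : P a <;> simp [h]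

open scoped Classical in
@[fun_prop]
theorem and {P Q : α → Prop} (hP : PolyTime P) (hQ : PolyTime Q) : PolyTime fun a => P a ∧ Q a :=
  (hP.ite hQ (const_prop False)).of_iff fun a => by by_cases h : P a <;> simp [h]

open scoped Classical in
@[fun_prop]
theorem or {P Q : α → Prop} (hP : PolyTime P) (hQ : PolyTime Q) : PolyTime fun a => P a ∨ Q a :=
  (hP.ite (const_prop True) hQ).of_iff fun a => by by_cases h : P a <;> simp [h]

open scoped Classical in
theorem imp {P Q : α → Prop} (hP : PolyTime P) (hQ : PolyTime Q) : PolyTime fun a => P a → Q a :=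
  (hP.ite hQ (const_prop True)).of_iff fun a => by by_cases h : P a <;> simp [h]

open scoped Classical in
@[fun_prop]
theorem iff {P Q : α → Prop} (hP : PolyTime P) (hQ : PolyTime Q) : PolyTime fun a => P a ↔ Q a :=
  (hP.ite hQ hQ.not).of_iff fun a => by by_cases h : P a <;> simp [h]

theorem exists_mem_list {ρ : Type} {P : ρ → α → Prop} (l : List ρ)
    (h : ∀ d ∈ l, PolyTime (P d)) : PolyTime fun a => ∃ d ∈ l, P d a := by
  induction l with
  | nil => exact (const_prop False).of_iff (by simp)
  | cons d l ih =>
    exact ((h d (by simp)).or (ih fun d' hd' => h d' (by simp [hd']))).of_iff (by simp)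

theorem forall_mem_list {ρ : Type} {P : ρ → α → Prop} (l : List ρ)
    (h : ∀ d ∈ l, PolyTime (P d)) : PolyTime fun a => ∀ d ∈ l, P d a := by
  induction l with
  | nil => exact (const_prop True).of_iff (by simp)
  | cons d l ih =>
    exact ((h d (by simp)).and (ih fun d' hd' => h d' (by simp [hd']))).of_iff (by simp)

@[fun_prop]
theorem succ {f : α → ℕ} (hf : PolyTime f) : PolyTime fun a => f a + 1 := by
  have h : PolyTime fun a => (List.replicate (f a) (some true) : Word) :=
    hf.recode (fun j => j) fun _ _ => rfl
  exact (h.cons_const (some true)).recode (fun j => j) fun _ _ => rfl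

@[fun_prop]
theorem pred {f : α → ℕ} (hf : PolyTime f) : PolyTime fun a => f a - 1 := by
  have h : PolyTime fun a => (List.replicate (f a) (some true) : Word) :=
    hf.recode (fun j => j) fun _ _ => rfl
  exact h.tail.recode (fun j => j) fun a _ => by simp [Env.enc]

@[fun_prop]
theorem cons {c : α → Symb} {f : α → Word} (hc : PolyTime c) (hf : PolyTime f) :
    PolyTime fun a => c a :: f a := by
  have h : PolyTime fun a => ([c a] : Word) := hc.recode (fun j => j) fun _ _ => rfl
  have h₁ := h.head_test (· = some none)
  have h₂ := h.head_test (· = some (some true))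
  refine Eq.mp ?_ (h₁.ite (hf.cons_const none) (h₂.ite (hf.cons_const (some true))
    (hf.cons_const (some false))))
  congr 1
  funext a
  rcases hc : c a with _ | _ | _ <;> simp

/-- Iteration, as often as the word `c a` has symbols. -/
theorem iterate_word {c : α → Word} {B : α → ℕ → β} {step : α × β → β} (hc : PolyTime c)
    (h₀ : PolyTime fun a => B a 0) (hs : PolyTime step)
    (hB : ∀ a i, i < (c a).length → B a (i + 1) = step (a, B a i))
    (hb : ∃ p : Polynomial ℕ, ∀ a, ∀ i ≤ (c a).length, esize (B a i) ≤ p.eval (esize a)) :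
    PolyTime fun a => B a (c a).length := by
  have g₀ : PolyComp (fun a => Sum.elim (Env.enc a) (Env.enc (c a))) fun a => Env.enc (B a 0) :=
    .weaken Sum.inl Sum.inl_injective h₀
  refine PolyComp.letIn hc (g₀.iter (Sum.inr ()) (fun a i => Env.enc (B a i)) ?_ ?_)
  · refine .weaken (κ := Env.ι (α × β)) (Sum.map Sum.inl _root_.id)
      (Sum.map_injective.2 ⟨Sum.inl_injective, Function.injective_id⟩) ?_
    have := PolyComp.restrict hs
      (fun q : (a : α) × Fin (c a).length => (q.1, B q.1 q.2))
    refine Eq.mp ?_ this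
    congr 1
    · funext q j
      rcases j with j | j <;> rfl
    · funext q
      rw [hB q.1 q.2 q.2.2]
  · obtain ⟨p, hp⟩ := hb
    refine ⟨p, fun a i hi => (hp a i hi).trans (eval_mono_nat p ?_)⟩
    rw [wsize_elim]
    exact Nat.le_add_right _ _

/-- Iteration with a loop variable. -/
theorem iterate {n : α → ℕ} {B : α → ℕ → β} {step : (α × ℕ) × β → β} (hn : PolyTime n)
    (h₀ : PolyTime fun a => B a 0) (hs : PolyTime step)
    (hB : ∀ a i, i < n a → B a (i + 1) = step ((a, i), B a i))
    (hb : ∃ h : α → ℕ, PolyBounded h ∧ ∀ a, ∀ i ≤ n a, esize (B a i) ≤ h a) :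
    PolyTime fun a => B a (n a) := by
  obtain ⟨h, hh, hb⟩ := hb
  have hc : PolyTime fun a => (List.replicate (n a) (some true) : Word) :=
    hn.recode (fun j => j) fun _ _ => rfl
  have := hc.iterate_word (B := fun a i => (i, B a i))
    (step := fun q : α × (ℕ × β) => (q.2.1 + 1, step ((q.1, q.2.1), q.2.2)))
    (by fun_prop) (by fun_prop) (fun a i hi => by
      dsimp only
      rw [hB a i (by simpa using hi)]) (by
      obtain ⟨p, hp⟩ := hn.bounded_nat.add hh
      refine ⟨p, fun a i hi => le_trans ?_ (hp a)⟩
      rw [List.length_replicate] at hi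
      simpa using Nat.add_le_add hi (hb a i hi))
  simpa using snd.comp this

/-! ### Arithmetic and words -/

@[fun_prop]
theorem add {m n : α → ℕ} (hm : PolyTime m) (hn : PolyTime n) : PolyTime fun a => m a + n a :=
  iterate (B := fun a i => m a + i) (step := fun q => q.2 + 1) hn (by simpa using hm)
    (by fun_prop) (fun _ _ _ => rfl)
    ⟨_, hm.bounded_nat.add hn.bounded_nat, fun a i hi => by simpa using hi⟩

@[fun_prop]
theorem mul {m n : α → ℕ} (hm : PolyTime m) (hn : PolyTime n) : PolyTime fun a => m a * n a :=
  iterate (B := fun a i => m a * i) (step := fun q => q.2 + m q.1.1) hn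
    (by simpa using const_nat 0) (by fun_prop) (fun _ _ _ => rfl)
    ⟨_, hm.bounded_nat.mul hn.bounded_nat, fun a i hi => by
      simpa using Nat.mul_le_mul_left (m a) hi⟩

@[fun_prop]
theorem sub {m n : α → ℕ} (hm : PolyTime m) (hn : PolyTime n) : PolyTime fun a => m a - n a :=
  iterate (B := fun a i => m a - i) (step := fun q => q.2 - 1) hn (by simpa using hm)
    (by fun_prop) (fun _ _ _ => rfl) ⟨_, hm.bounded_nat, fun a i _ => by simp⟩

@[fun_prop]
theorem pow {m : α → ℕ} (hm : PolyTime m) (k : ℕ) : PolyTime fun a => m a ^ k := by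
  induction k with
  | zero => simpa using const_nat 1
  | succ k ih => simpa only [pow_succ] using ih.mul hm

theorem sum {ρ : Type} {f : ρ → α → ℕ} (s : Finset ρ) (hf : ∀ j ∈ s, PolyTime (f j)) :
    PolyTime fun a => ∑ j ∈ s, f j a := by
  classical
  induction s using Finset.induction_on with
  | empty => simpa using const_nat 0
  | insert j s hj ih =>
    simp only [Finset.sum_insert hj]
    exact (hf j (by simp)).add (ih fun i hi => hf i (by simp [hi]))

theorem eq_zero {m : α → ℕ} (hm : PolyTime m) : PolyTime fun a => m a = 0 := by
  have h : PolyTime fun a => (List.replicate (m a) (some true) : Word) :=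
    hm.recode (fun j => j) fun _ _ => rfl
  refine (h.head_test Option.isNone).of_iff fun a => ?_
  cases m a <;> simp [List.replicate_succ]

@[fun_prop]
theorem le {m n : α → ℕ} (hm : PolyTime m) (hn : PolyTime n) : PolyTime fun a => m a ≤ n a :=
  (hm.sub hn).eq_zero.of_iff fun a => by omega

@[fun_prop]
theorem lt {m n : α → ℕ} (hm : PolyTime m) (hn : PolyTime n) : PolyTime fun a => m a < n a :=
  (hm.succ.le hn).of_iff fun a => by omega

@[fun_prop]
theorem eq {m n : α → ℕ} (hm : PolyTime m) (hn : PolyTime n) : PolyTime fun a => m a = n a :=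
  ((hm.le hn).and (hn.le hm)).of_iff fun a => by omega

@[fun_prop]
theorem min {m n : α → ℕ} (hm : PolyTime m) (hn : PolyTime n) :
    PolyTime fun a => Min.min (m a) (n a) :=
  ((hm.le hn).ite hm hn).of_eq fun a => by rw [min_def]

theorem count {n : α → ℕ} {P : α → ℕ → Prop} [∀ a, DecidablePred (P a)] (hn : PolyTime n)
    (hP : PolyTime fun p : α × ℕ => P p.1 p.2) : PolyTime fun a => Nat.count (P a) (n a) :=
  iterate (B := fun a i => Nat.count (P a) i)
    (step := fun q => if P q.1.1 q.1.2 then q.2 + 1 else q.2)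
    hn (by simpa using const_nat 0) ((hP.comp fst).ite (by fun_prop) (by fun_prop))
    (fun a i _ => by
      dsimp only
      rw [Nat.count_succ]
      split_ifs <;> rfl)
    ⟨_, hn.bounded_nat, fun a i hi => by simpa using (Nat.count_le (P a)).trans hi⟩

open scoped Classical in
theorem exists_lt {n : α → ℕ} {P : α → ℕ → Prop} (hn : PolyTime n)
    (hP : PolyTime fun p : α × ℕ => P p.1 p.2) : PolyTime fun a => ∃ i < n a, P a i := by
  refine (const_nat 0).lt (count hn hP) |>.of_iff fun a => ?_
  rw [Nat.count_eq_card_filter_range, Finset.card_pos]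
  simp [Finset.Nonempty]

theorem forall_lt {n : α → ℕ} {P : α → ℕ → Prop} (hn : PolyTime n)
    (hP : PolyTime fun p : α × ℕ => P p.1 p.2) : PolyTime fun a => ∀ i < n a, P a i :=
  (exists_lt (P := fun a i => ¬ P a i) hn hP.not).not.of_iff fun a => by push Not; rfl

@[fun_prop]
theorem div {m n : α → ℕ} (hm : PolyTime m) (hn : PolyTime n) : PolyTime fun a => m a / n a := by
  classical
  refine (count (P := fun a i => 0 < n a ∧ (i + 1) * n a ≤ m a) hm (by fun_prop)).of_eq fun a => ?_
  rcases Nat.eq_zero_or_pos (n a) with h | h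
  · simp [h, Nat.count_eq_card_filter_range]
  · rw [Nat.count_eq_card_filter_range, ← Finset.card_range (m a / n a)]
    congr 1
    ext i
    simp only [Finset.mem_range, Finset.mem_filter, h, true_and, ← Nat.le_div_iff_mul_le h,
      Nat.succ_le_iff]
    exact ⟨fun hi => ⟨hi.trans_le (Nat.div_le_self _ _), hi⟩, fun hi => hi.2⟩

@[fun_prop]
theorem mod {m n : α → ℕ} (hm : PolyTime m) (hn : PolyTime n) : PolyTime fun a => m a % n a :=
  (hm.sub (hn.mul (hm.div hn))).of_eq fun a => by rw [Nat.mod_eq_sub]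

@[fun_prop]
theorem length {w : α → Word} (hw : PolyTime w) : PolyTime fun a => (w a).length := by
  refine iterate_word (c := w) (B := fun _ i => i) (step := fun q => q.2 + 1) hw (const_nat 0)
    (by fun_prop) (fun _ _ _ => rfl) ?_
  obtain ⟨p, hp⟩ := hw.bounded
  exact ⟨p, fun a i hi => by simpa using hi.trans (by simpa using hp a)⟩

@[fun_prop]
theorem drop {n : α → ℕ} {w : α → Word} (hn : PolyTime n) (hw : PolyTime w) :
    PolyTime fun a => (w a).drop (n a) :=
  iterate (B := fun a i => (w a).drop i) (step := fun q => q.2.tail) hn (by simpa using hw)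
    (by fun_prop) (fun a i _ => by simp [List.tail_drop])
    ⟨_, hw.bounded, fun a i _ => by simp⟩

theorem getElem?_eq_some {i : α → ℕ} {w : α → Word} (hw : PolyTime w) (hi : PolyTime i) (c : Symb) :
    PolyTime fun a => (w a)[i a]? = some c :=
  ((hi.drop hw).head_test (· = some c)).of_iff fun a => by simp

@[fun_prop]
theorem getD {i : α → ℕ} {w : α → Word} (hw : PolyTime w) (hi : PolyTime i) :
    PolyTime fun a => (w a)[i a]?.getD none := by
  refine ((hw.getElem?_eq_some hi (some true)).ite (const_symb (some true))
    ((hw.getElem?_eq_some hi (some false)).ite (const_symb (some false)) (const_symb none))).of_eq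
    fun a => ?_
  rcases (w a)[i a]? with _ | _ | _ | _ <;> simp

theorem eq_word {u v : α → Word} (hu : PolyTime u) (hv : PolyTime v) :
    PolyTime fun a => u a = v a := by
  have h : PolyTime fun p : α × ℕ =>
      ((u p.1)[p.2]? = some none ↔ (v p.1)[p.2]? = some none) ∧
      ((u p.1)[p.2]? = some (some true) ↔ (v p.1)[p.2]? = some (some true)) ∧
      ((u p.1)[p.2]? = some (some false) ↔ (v p.1)[p.2]? = some (some false)) := by
    have hu' : PolyTime fun p : α × ℕ => u p.1 := by fun_prop
    have hv' : PolyTime fun p : α × ℕ => v p.1 := by fun_prop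
    exact ((hu'.getElem?_eq_some snd _).iff (hv'.getElem?_eq_some snd _)).and
      (((hu'.getElem?_eq_some snd _).iff (hv'.getElem?_eq_some snd _)).and
      ((hu'.getElem?_eq_some snd _).iff (hv'.getElem?_eq_some snd _)))
  refine ((hu.length.eq hv.length).and (forall_lt (P := fun a i =>
      ((u a)[i]? = some none ↔ (v a)[i]? = some none) ∧
      ((u a)[i]? = some (some true) ↔ (v a)[i]? = some (some true)) ∧
      ((u a)[i]? = some (some false) ↔ (v a)[i]? = some (some false))) hu.length h)).of_iff
    fun a => ⟨?_, ?_⟩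
  · intro h
    simp [h]
  · rintro ⟨h₁, h₂⟩
    refine List.ext_getElem h₁ fun i hi hi' => ?_
    have := h₂ i hi
    rw [List.getElem?_eq_getElem hi, List.getElem?_eq_getElem hi'] at this
    rcases h3 : (u a)[i] with _ | _ | _ <;> rcases h4 : (v a)[i] with _ | _ | _ <;>
      simp_all

theorem map_range {n : α → ℕ} {F : α → ℕ → Symb} (hn : PolyTime n)
    (hF : PolyTime fun p : α × ℕ => F p.1 p.2) :
    PolyTime fun a => (List.range (n a)).map (F a) := by
  -- the word is built from its end
  have := iterate (β := Word) (B := fun a i => ((List.range (n a)).map (F a)).drop (n a - i))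
    (step := fun q : (α × ℕ) × Word => F q.1.1 (n q.1.1 - 1 - q.1.2) :: q.2) hn
    ((const_word (α := α) []).of_eq fun a => List.drop_eq_nil_of_le (by simp)) (by
      have : PolyTime fun q : (α × ℕ) × Word => F q.1.1 (n q.1.1 - 1 - q.1.2) :=
        hF.comp (f := fun q : (α × ℕ) × Word => (q.1.1, n q.1.1 - 1 - q.1.2)) (by fun_prop)
      fun_prop) (fun a i hi => by
      dsimp only
      have h1 : n a - (i + 1) < ((List.range (n a)).map (F a)).length := by simp; omega
      rw [List.drop_eq_getElem_cons h1]
      simp only [List.getElem_map, List.getElem_range]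
      congr 2 <;> omega)
    ⟨_, hn.bounded_nat, fun a i hi => by simp⟩
  simpa using this

theorem replicate {n : α → ℕ} (hn : PolyTime n) (c : Symb) :
    PolyTime fun a => (List.replicate (n a) c : Word) :=
  (map_range (F := fun _ _ => c) hn (by fun_prop)).of_eq fun a => by simp

@[fun_prop]
theorem append {u v : α → Word} (hu : PolyTime u) (hv : PolyTime v) :
    PolyTime fun a => u a ++ v a := by
  refine (map_range (n := fun a => (u a).length + (v a).length)
    (F := fun a i => if i < (u a).length then (u a)[i]?.getD none else
      (v a)[i - (u a).length]?.getD none) (by fun_prop) (by fun_prop)).of_eq fun a => ?_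
  refine List.ext_getElem (by simp) fun i hi hi' => ?_
  simp only [List.getElem_map, List.getElem_range]
  rw [List.length_append] at hi
  split_ifs with h
  · simp [h]
  · have : i - (u a).length < (v a).length := by omega
    rw [List.getElem_append_right (by omega)]
    simp [this]

/-- A word function that is computable in polynomial time in the above sense is computable in
polynomial time by a Turing machine. -/
theorem nonempty_computable {Γ₁ β' : Type} {f : Word → Word} (hf : PolyTime f) (g : Symb → Γ₁)
    (eb : β' → List Γ₁) (F : Word → β') (hF : ∀ w, eb (F w) = (f w).map g) :
    Nonempty (Turing.TM2ComputableInPolyTime (_root_.id : Word → Word) eb F) := by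
  obtain ⟨T, _, _, p, b, h⟩ := hf
  let inp : Unit ⊕ Unit ⊕ T := .inl ()
  let out : Unit ⊕ Unit ⊕ T := .inr (.inl ())
  refine nonempty_computable_of_exec (R := Unit ⊕ Unit ⊕ T)
    (.seq (.seq p (.clear inp)) (.moveAll out inp)) inp inp
    (Equiv.refl Symb) g _root_.id eb F f (b + (.X * 2 + 1) + (b * 5 + 1)) hF
    (fun w => ?_) fun w => ?_
  · have h₁ := (h w).2
    have h₀ := (h w).1
    have hw : wsize (Env.enc w) = w.length := esize_word w
    have hfw : wsize (Env.enc (f w)) = (f w).length := esize_word (f w)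
    rw [hw] at h₁ h₀
    rw [hfw] at h₀
    have h₂ := Runs.clear inp (regs (fun _ => w) (fun _ => f w) noWords)
    have h₃ := Runs.moveAll (r := out) (r' := inp) (by simp [inp, out])
      (Function.update (regs (fun _ => w) (fun _ => f w) noWords) inp [])
    obtain ⟨t, ht, hx⟩ := ((Runs.seq h₁ h₂).seq h₃)
    refine ⟨t, ?_, ?_⟩
    · refine ht.trans ?_
      simp [inp, out]
      omega
    · have e₁ : Function.update (fun _ => []) inp (List.map (Equiv.refl Symb).symm w) =
          regs (fun _ => w) noWords noWords := by
        funext k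
        rcases k with k | k | k
        · exact List.map_id w
        all_goals rfl
      have e₂ : Function.update (Function.update (Function.update
          (regs (fun _ => w) (fun _ => f w) noWords) inp []) inp
          ((f w).reverse ++ [])) out [] = Function.update (fun _ => []) inp (f w).reverse := by
        funext k
        rcases k with k | k | k
        · simp only [List.append_nil]
          rfl
        all_goals rfl
      simp only [_root_.id]
      rw [e₁, ← e₂]
      exact hx
  · have h₀ := (h w).1
    have hw : wsize (Env.enc w) = w.length := esize_word w
    have hfw : wsize (Env.enc (f w)) = (f w).length := esize_word (f w)
    rw [hw, hfw] at h₀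
    simp
    omega

end PolyTime


/-! ### Representative subfamilies of a family of small sets -/

section Kept

variable (ok : ℕ → Prop) (L : ℕ → Finset ℕ) (s b : ℕ)

/-- The item `i` is added to the items `F` if, for no `T ⊆ L i`, there are already
`(b + 1) ^ (s - |T|)` many `i' ∈ F` with `T ⊆ L i'`. -/
def Admissible (F : Finset ℕ) (i : ℕ) : Prop :=
  ok i ∧ ∀ T ⊆ L i, (F.filter fun i' => T ⊆ L i').card < (b + 1) ^ (s - T.card)

open scoped Classical in
/-- The items that are kept when the items `0, …, m - 1` are processed one by one. -/
noncomputable def kept : ℕ → Finset ℕ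
  | 0 => ∅
  | m + 1 => if Admissible ok L s b (kept m) m then insert m (kept m) else kept m

variable {ok L s b}

theorem kept_subset_succ (m : ℕ) : kept ok L s b m ⊆ kept ok L s b (m + 1) := by
  rw [kept]
  split_ifs
  · exact Finset.subset_insert _ _
  · exact subset_rfl

theorem kept_mono : Monotone (kept ok L s b) := monotone_nat_of_le_succ kept_subset_succ

theorem lt_and_ok_of_mem_kept {i m : ℕ} (h : i ∈ kept ok L s b m) : i < m ∧ ok i := by
  induction m with
  | zero => simp [kept] at h
  | succ m ih =>
    rw [kept] at h
    split_ifs at h with ha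
    · rcases Finset.mem_insert.1 h with rfl | h
      · exact ⟨Nat.lt_succ_self _, ha.1⟩
      · exact ⟨(ih h).1.trans (Nat.lt_succ_self _), (ih h).2⟩
    · exact ⟨(ih h).1.trans (Nat.lt_succ_self _), (ih h).2⟩

theorem card_kept_filter_le (m : ℕ) (T : Finset ℕ) :
    ((kept ok L s b m).filter fun i => T ⊆ L i).card ≤ (b + 1) ^ (s - T.card) := by
  induction m with
  | zero => simp [kept]
  | succ m ih =>
    rw [kept]
    split_ifs with ha
    · rw [Finset.filter_insert]
      split_ifs with hT
      · exact (Finset.card_insert_le _ _).trans (ha.2 T hT)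
      · exact ih
    · exact ih

theorem card_kept_le (m : ℕ) : (kept ok L s b m).card ≤ (b + 1) ^ s := by
  simpa using card_kept_filter_le (ok := ok) (L := L) (s := s) (b := b) m ∅

/-- The kept items are representative: if some item avoids a set `B` with at most `b` elements, then
so does a kept item. If an item was rejected because of `T ⊆ L i`, then too many kept items contain
`T` for each of them to meet `B`, since the number of kept items containing `T` and a further
element is bounded. -/
theorem exists_mem_kept_disjoint (hL : ∀ i, ok i → (L i).card ≤ s) {i m : ℕ} (him : i < m)
    (hi : ok i) {B : Finset ℕ} (hB : B.card ≤ b) (hd : Disjoint (L i) B) :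
    ∃ i' ∈ kept ok L s b m, Disjoint (L i') B := by
  suffices ∃ i' ∈ kept ok L s b (i + 1), Disjoint (L i') B by
    obtain ⟨i', hi', h⟩ := this
    exact ⟨i', kept_mono him hi', h⟩
  by_cases ha : Admissible ok L s b (kept ok L s b i) i
  · exact ⟨i, by rw [kept, if_pos ha]; exact Finset.mem_insert_self _ _, hd⟩
  rw [kept, if_neg ha]
  simp only [Admissible, hi, true_and, not_forall, not_lt] at ha
  obtain ⟨T, hT, hc⟩ := ha
  by_contra! hall
  set F := (kept ok L s b i).filter fun i' => T ⊆ L i' with hF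
  have hTB : Disjoint T B := Finset.disjoint_of_subset_left hT hd
  have hTs : T.card ≤ s := (Finset.card_le_card hT).trans (hL i hi)
  have hcover : F ⊆ B.biUnion fun e => F.filter fun i' => insert e T ⊆ L i' := by
    intro i' hi'
    obtain ⟨hi'k, hi'T⟩ := Finset.mem_filter.1 hi'
    obtain ⟨e, he, heB⟩ := Finset.not_disjoint_iff.1 (hall i' hi'k)
    exact Finset.mem_biUnion.2 ⟨e, heB, Finset.mem_filter.2 ⟨hi', Finset.insert_subset he hi'T⟩⟩
  have hsub : ∀ e, (F.filter fun i' => insert e T ⊆ L i').card ≤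
      ((kept ok L s b i).filter fun i' => insert e T ⊆ L i').card := fun e =>
    Finset.card_le_card (Finset.filter_subset_filter _ (Finset.filter_subset _ _))
  have hcard : ∀ e ∈ B, (insert e T).card = T.card + 1 := fun e he =>
    Finset.card_insert_of_notMem fun h => Finset.disjoint_left.1 hTB h he
  rcases hTs.lt_or_eq with hlt | heq
  · have h1 : F.card ≤ B.card * (b + 1) ^ (s - (T.card + 1)) :=
      (Finset.card_le_card hcover).trans (Finset.card_biUnion_le_card_mul _ _ _ fun e he =>
        (hsub e).trans (by rw [← hcard e he]; exact card_kept_filter_le i _))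
    have h2 : (b + 1) ^ (s - T.card) = (b + 1) ^ (s - (T.card + 1)) * (b + 1) := by
      rw [← pow_succ]
      congr 1
      omega
    have h3 : 0 < (b + 1) ^ (s - (T.card + 1)) := by positivity
    rw [h2] at hc
    have h4 := Nat.mul_le_mul_right ((b + 1) ^ (s - (T.card + 1))) hB
    nlinarith
  · have h1 : F.card ≤ B.card * 0 :=
      (Finset.card_le_card hcover).trans (Finset.card_biUnion_le_card_mul _ _ _ fun e he => by
        rw [Nat.le_zero, Finset.card_eq_zero, Finset.filter_eq_empty_iff]
        intro i' hi' hsub'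
        have := (Finset.card_le_card hsub').trans
          (hL i' (lt_and_ok_of_mem_kept (Finset.mem_filter.1 hi').1).2)
        rw [hcard e he] at this
        omega)
    rw [heq, Nat.sub_self, pow_zero] at hc
    omega

end Kept

/-! ### Codes of ground literals -/

section Codes

variable {t u : ℕ} {r : Fin t → ℕ} {q : Fin u → ℕ} {V : Type}

/-- The index of a tuple over `{0, …, n - 1}` in the truth tables. -/
def tupleIndex (n : ℕ) (v : V → ℕ) {d : ℕ} (z : Fin d → V) : ℕ := ∑ l, v (z l) * n ^ (l : ℕ)

/-- The code of a ground literal `(¬) S j (v ∘ z)`: negative literals have even codes, and the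
complement of a negative literal has the next number. -/
def Lit.code (n : ℕ) (v : V → ℕ) : Lit r q V → ℕ
  | .input _ _ _ => 0
  | .guess pos j z => 2 * (tupleIndex n v z * u + j) + (if pos then 1 else 0)

/-- The codes of the ground literals over the quantified symbols in a conjunction of literals. -/
def codes (n : ℕ) (v : V → ℕ) (d : List (Lit r q V)) : List ℕ :=
  (d.filter Lit.isGuess).map (Lit.code n v)

theorem mem_codes {n : ℕ} {v : V → ℕ} {d : List (Lit r q V)} {c : ℕ} :
    c ∈ codes n v d ↔ ∃ l ∈ d, l.isGuess = true ∧ l.code n v = c := by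
  simp [codes, and_assoc]

theorem length_codes (n : ℕ) (v : V → ℕ) (d : List (Lit r q V)) :
    (codes n v d).length = d.countP Lit.isGuess := by
  simp [codes, List.countP_eq_length_filter]

/-- No pair of complementary literals has its codes in `C`. -/
def Consistent (C : Set ℕ) : Prop := ∀ a, 2 * a ∈ C → 2 * a + 1 ∉ C

theorem Consistent.mono {C D : Set ℕ} (hD : Consistent D) (h : C ⊆ D) : Consistent C :=
  fun a h₁ h₂ => hD a (h h₁) (h h₂)

/-- The truth of the literals over the input symbols. -/
def Lit.InputHolds {A : Type} (R : RelStr r A) (v : V → A) : Lit r q V → Prop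
  | .input true i z => v ∘ z ∈ R i
  | .input false i z => v ∘ z ∉ R i
  | .guess _ _ _ => True

variable {n : ℕ}

theorem tupleIndex_val (v : V → Fin n) {d : ℕ} (z : Fin d → V) :
    tupleIndex n (fun a => (v a : ℕ)) z = finFunctionFinEquiv (v ∘ z) := by
  simp [tupleIndex]

theorem atom_injective {j j' : Fin u} {z : Fin (q j) → Fin n} {z' : Fin (q j') → Fin n}
    (h : (finFunctionFinEquiv z : ℕ) * u + j = finFunctionFinEquiv z' * u + j') :
    (⟨j, z⟩ : (j : Fin u) × (Fin (q j) → Fin n)) = ⟨j', z'⟩ := by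
  have h₁ := congrArg (· % u) h
  simp only [Nat.mul_add_mod_of_lt j.2, Nat.mul_add_mod_of_lt j'.2] at h₁
  obtain rfl : j = j' := Fin.ext h₁
  have hu : 0 < u := j.pos
  have h₂ := Nat.eq_of_mul_eq_mul_right hu (Nat.add_right_cancel h)
  rw [finFunctionFinEquiv.injective (Fin.ext h₂)]

/-- The codes of the ground literals that are true in `S`. -/
def trueCodes (S : RelStr q (Fin n)) : Set ℕ :=
  {c | ∃ (j : Fin u) (z : Fin (q j) → Fin n),
    (c = 2 * (finFunctionFinEquiv z * u + j) + 1 ∧ z ∈ S j) ∨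
      (c = 2 * (finFunctionFinEquiv z * u + j) ∧ z ∉ S j)}

theorem consistent_trueCodes (S : RelStr q (Fin n)) : Consistent (trueCodes S) := by
  rintro a ⟨j, z, ⟨h, hz⟩ | ⟨h, hz⟩⟩ ⟨j', z', ⟨h', hz'⟩ | ⟨h', hz'⟩⟩
  · omega
  · omega
  · have := atom_injective (q := q) (z := z) (z' := z') (by omega)
    obtain ⟨rfl, h⟩ := Sigma.mk.inj_iff.1 this
    obtain rfl := eq_of_heq h
    exact hz hz'
  · omega

/-- The interpretation of the quantified symbols in which exactly the positive literals with codes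
in `C` are true. -/
def modelOf (q : Fin u → ℕ) (n : ℕ) (C : Set ℕ) : RelStr q (Fin n) :=
  fun j => {z | 2 * ((finFunctionFinEquiv z : ℕ) * u + j) + 1 ∈ C}

theorem Lit.Holds.code_mem {R : RelStr r (Fin n)} {S : RelStr q (Fin n)} {v : V → Fin n}
    {l : Lit r q V} (h : l.Holds R S v) (hl : l.isGuess = true) :
    l.code n (fun a => (v a : ℕ)) ∈ trueCodes S := by
  rcases l with _ | ⟨_ | _, j, z⟩
  · simp [Lit.isGuess] at hl
  · exact ⟨j, v ∘ z, .inr ⟨by simp [Lit.code, tupleIndex_val], h⟩⟩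
  · exact ⟨j, v ∘ z, .inl ⟨by simp [Lit.code, tupleIndex_val], h⟩⟩

theorem Lit.Holds.input {A : Type} {R : RelStr r A} {S : RelStr q A} {v : V → A}
    {l : Lit r q V} (h : l.Holds R S v) : l.InputHolds R v := by
  rcases l with ⟨_ | _, i, z⟩ | _
  · exact h
  · exact h
  · trivial

theorem Lit.holds_modelOf {C : Set ℕ} (hC : Consistent C) {R : RelStr r (Fin n)} {v : V → Fin n}
    {l : Lit r q V} (hi : l.InputHolds R v)
    (hl : l.isGuess = true → l.code n (fun a => (v a : ℕ)) ∈ C) :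
    l.Holds R (modelOf q n C) v := by
  rcases l with ⟨_ | _, i, z⟩ | ⟨_ | _, j, z⟩
  · exact hi
  · exact hi
  · have := hC _ (by simpa [Lit.code, tupleIndex_val] using hl rfl)
    exact this
  · have := hl rfl
    simp only [Lit.code, tupleIndex_val] at this
    exact this

end Codes

/-! ### Restricting the structure to representative witnesses -/

section Exchange

variable {t : ℕ} {r : Fin t → ℕ} (φ : Formula r) {n : ℕ} (R : RelStr r (Fin n))

/-- The values of the variables under the assignment of the tuples `x` and `y`. -/
abbrev assign (x : Fin φ.cx → Fin n) (y : Fin φ.cy → Fin n) : Fin φ.cx ⊕ Fin φ.cy → Fin n :=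
  Sum.elim x y

/-- The disjunct `d` can be made true at `x` and `y` by a suitable choice of the quantified
relations. -/
def Item (x : Fin φ.cx → Fin n) (y : Fin φ.cy → Fin n)
    (d : List (Lit r φ.q (Fin φ.cx ⊕ Fin φ.cy))) : Prop :=
  d ∈ φ.ψ ∧ (∀ l ∈ d, l.InputHolds R (assign φ x y)) ∧
    Consistent {c | c ∈ codes n (fun a => (assign φ x y a : ℕ)) d}

variable {φ R}

theorem length_codes_le {d : List (Lit r φ.q (Fin φ.cx ⊕ Fin φ.cy))} (hd : d ∈ φ.ψ)
    (v : Fin φ.cx ⊕ Fin φ.cy → ℕ) : (codes n v d).length ≤ φ.s := by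
  rw [length_codes, Formula.s]
  have key : ∀ (l : List ℕ) (a : ℕ), a ∈ l → a ≤ l.foldr max 0 := by
    intro l a ha
    induction l with
    | nil => simp at ha
    | cons b l ih =>
      rcases List.mem_cons.1 ha with rfl | ha
      · exact le_max_left _ _
      · exact (ih ha).trans (le_max_right _ _)
  exact key _ _ (List.mem_map_of_mem hd)

theorem exists_item_of_holds {S : RelStr φ.q (Fin n)} {x : Fin φ.cx → Fin n}
    {y : Fin φ.cy → Fin n} (h : φ.Holds R S x y) :
    ∃ d, Item φ R x y d ∧ ∀ c ∈ codes n (fun a => (assign φ x y a : ℕ)) d, c ∈ trueCodes S := by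
  obtain ⟨d, hd, h⟩ := h
  have hc : ∀ c ∈ codes n (fun a => (assign φ x y a : ℕ)) d, c ∈ trueCodes S := by
    intro c hc
    obtain ⟨l, hl, hg, rfl⟩ := mem_codes.1 hc
    exact (h l hl).code_mem hg
  exact ⟨d, ⟨hd, fun l hl => (h l hl).input, (consistent_trueCodes S).mono hc⟩, hc⟩

theorem holds_modelOf {C : Set ℕ} (hC : Consistent C) {x : Fin φ.cx → Fin n}
    {y : Fin φ.cy → Fin n} {d : List (Lit r φ.q (Fin φ.cx ⊕ Fin φ.cy))} (hd : Item φ R x y d)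
    (h : ∀ c ∈ codes n (fun a => (assign φ x y a : ℕ)) d, c ∈ C) :
    φ.Holds R (modelOf φ.q n C) x y :=
  ⟨d, hd.1, fun l hl => Lit.holds_modelOf hC (hd.2.1 l hl) fun hg =>
    h _ (mem_codes.2 ⟨l, hl, hg, rfl⟩)⟩

theorem mem_witnesses_iff {x : Fin φ.cx → Fin n} {y : Fin φ.cy → Fin n} :
    y ∈ φ.witnesses R x ↔ ∃ d, Item φ R x y d := by
  constructor
  · rintro ⟨S, hS⟩
    obtain ⟨d, hd, -⟩ := exists_item_of_holds hS
    exact ⟨d, hd⟩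
  · rintro ⟨d, hd⟩
    exact ⟨_, holds_modelOf hd.2.2 hd fun c hc => hc⟩

theorem mem_satisfiable_iff {x : Fin φ.cx → Fin n} :
    x ∈ φ.satisfiable R ↔ ∃ y d, Item φ R x y d := by
  simp only [← mem_witnesses_iff, Formula.satisfiable, Formula.witnesses, Set.mem_ofPred_eq]
  exact exists_comm

/-- The set `Y' x` is representative for the witnesses of `x`: if a witness avoids a small set of
ground literals, then so does a witness in `Y' x`. -/
def Representative (φ : Formula r) (R : RelStr r (Fin n)) (b : ℕ)
    (Y' : (Fin φ.cx → Fin n) → Set (Fin φ.cy → Fin n)) : Prop :=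
  ∀ x y d, Item φ R x y d → ∀ B : Finset ℕ, B.card ≤ b →
    (∀ c ∈ codes n (fun a => (assign φ x y a : ℕ)) d, c ∉ B) →
    ∃ y' ∈ Y' x, ∃ d', Item φ R x y' d' ∧
      ∀ c ∈ codes n (fun a => (assign φ x y' a : ℕ)) d', c ∉ B

/-- The code of the complementary literal. -/
def compl (c : ℕ) : ℕ := if c % 2 = 0 then c + 1 else c - 1

theorem compl_two_mul (a : ℕ) : compl (2 * a) = 2 * a + 1 := by simp [compl]

theorem compl_two_mul_add_one (a : ℕ) : compl (2 * a + 1) = 2 * a := by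
  simp [compl, Nat.add_mod]

open scoped Classical in
/-- Witnesses can be exchanged for representative ones, one after the other: the literals needed for
the other tuples are at most `|X| * s` many, so that some representative witness is consistent with
all of them. -/
theorem exists_model_of_representative
    {Y' : (Fin φ.cx → Fin n) → Set (Fin φ.cy → Fin n)}
    (hY : Representative φ R ((φ.satisfiable R).ncard * φ.s) Y') (S : RelStr φ.q (Fin n)) :
    ∃ S' : RelStr φ.q (Fin n), ∀ x, (∃ y, φ.Holds R S x y) → ∃ y ∈ Y' x, φ.Holds R S' x y := by
  let D := (Fin φ.cy → Fin n) × List (Lit r φ.q (Fin φ.cx ⊕ Fin φ.cy))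
  let Z : Finset (Fin φ.cx → Fin n) := Finset.univ.filter fun x => ∃ y, φ.Holds R S x y
  let cd (x : Fin φ.cx → Fin n) (p : D) : List ℕ :=
    codes n (fun a => (assign φ x p.1 a : ℕ)) p.2
  have hZ : Z.card ≤ (φ.satisfiable R).ncard := by
    rw [← Set.ncard_coe_finset]
    refine Set.ncard_le_ncard (fun x hx => ?_) (Set.toFinite _)
    obtain ⟨y, hy⟩ := (Finset.mem_filter.1 (Finset.mem_coe.1 hx)).2
    exact ⟨S, y, hy⟩
  rcases Z.eq_empty_or_nonempty with hZe | ⟨x₁, hx₁⟩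
  · exact ⟨S, fun x hx => absurd (Finset.mem_filter.2 ⟨Finset.mem_univ x, hx⟩)
      (by rw [show Finset.filter _ _ = Z from rfl, hZe]; exact Finset.notMem_empty x)⟩
  have : Nonempty D := ⟨((Finset.mem_filter.1 hx₁).2.choose, [])⟩
  have key : ∀ W ⊆ Z, ∃ g : (Fin φ.cx → Fin n) → D,
      (∀ x ∈ Z, Item φ R x (g x).1 (g x).2) ∧ Consistent {c | ∃ x ∈ Z, c ∈ cd x (g x)} ∧
      ∀ x ∈ W, (g x).1 ∈ Y' x := by
    intro W
    induction W using Finset.induction_on with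
    | empty =>
      intro _
      have : ∀ x, ∃ p : D, x ∈ Z → Item φ R x p.1 p.2 ∧ ∀ c ∈ cd x p, c ∈ trueCodes S := by
        intro x
        by_cases hx : x ∈ Z
        · obtain ⟨y, hy⟩ := (Finset.mem_filter.1 hx).2
          obtain ⟨d, hd⟩ := exists_item_of_holds hy
          exact ⟨(y, d), fun _ => hd⟩
        · exact ⟨Classical.arbitrary D, fun h => (hx h).elim⟩
      choose g hg using this
      exact ⟨g, fun x hx => (hg x hx).1, (consistent_trueCodes S).mono
        (by rintro c ⟨x, hx, hc⟩; exact (hg x hx).2 c hc), by simp⟩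
    | insert x₀ W hx₀ ih =>
      intro hW
      have hx₀Z : x₀ ∈ Z := hW (Finset.mem_insert_self _ _)
      obtain ⟨g, hg, hcons, hgW⟩ := ih ((Finset.subset_insert _ _).trans hW)
      -- The literals to be avoided are the complements of those needed for the other tuples.
      let B : Finset ℕ := ((Z.erase x₀).biUnion fun x => (cd x (g x)).toFinset).image compl
      have hB : B.card ≤ (φ.satisfiable R).ncard * φ.s := by
        refine Finset.card_image_le.trans ((Finset.card_biUnion_le_card_mul _ _ φ.s
          fun x hx => ?_).trans (Nat.mul_le_mul_right _
            ((Finset.card_le_card (Finset.erase_subset _ _)).trans hZ)))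
        exact (List.toFinset_card_le _).trans
          (length_codes_le (hg x (Finset.mem_of_mem_erase hx)).1 _)
      have hmem : ∀ x ∈ Z, x ≠ x₀ → ∀ c ∈ cd x (g x), compl c ∈ B := fun x hx hne c hc =>
        Finset.mem_image_of_mem _ (Finset.mem_biUnion.2
          ⟨x, Finset.mem_erase.2 ⟨hne, hx⟩, List.mem_toFinset.2 hc⟩)
      have havoid : ∀ c ∈ cd x₀ (g x₀), c ∉ B := by
        intro c hc hcB
        obtain ⟨c', hc', rfl⟩ := Finset.mem_image.1 hcB
        obtain ⟨x, hx, hc'⟩ := Finset.mem_biUnion.1 hc'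
        have hx' : c' ∈ {c | ∃ x ∈ Z, c ∈ cd x (g x)} :=
          ⟨x, Finset.mem_of_mem_erase hx, List.mem_toFinset.1 hc'⟩
        have hc : compl c' ∈ {c | ∃ x ∈ Z, c ∈ cd x (g x)} := ⟨x₀, hx₀Z, hc⟩
        rcases Nat.even_or_odd' c' with ⟨a, rfl | rfl⟩
        · exact hcons a hx' (compl_two_mul a ▸ hc)
        · exact hcons a (compl_two_mul_add_one a ▸ hc) hx'
      obtain ⟨y', hy', d', hd', hav⟩ := hY x₀ _ _ (hg x₀ hx₀Z) B hB havoid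
      have hupd : ∀ x, x ≠ x₀ → Function.update g x₀ (y', d') x = g x := fun x hx =>
        Function.update_of_ne hx _ _
      refine ⟨Function.update g x₀ (y', d'), fun x hx => ?_, ?_, fun x hx => ?_⟩
      · rcases eq_or_ne x x₀ with rfl | hne
        · simpa using hd'
        · rw [hupd x hne]
          exact hg x hx
      · rintro a ⟨x, hx, hc⟩ ⟨x', hx', hc'⟩
        rcases eq_or_ne x x₀ with h | hne <;> rcases eq_or_ne x' x₀ with h' | hne'
        · rw [h] at hc
          rw [h'] at hc'
          simp only [Function.update_self] at hc hc'
          exact hd'.2.2 a hc hc'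
        · rw [hupd x' hne'] at hc'
          rw [h] at hc
          simp only [Function.update_self] at hc
          exact hav _ hc (compl_two_mul_add_one a ▸ hmem x' hx' hne' _ hc')
        · rw [hupd x hne] at hc
          rw [h'] at hc'
          simp only [Function.update_self] at hc'
          exact hav _ hc' (compl_two_mul a ▸ hmem x hx hne _ hc)
        · rw [hupd x hne] at hc
          rw [hupd x' hne'] at hc'
          exact hcons a ⟨x, hx, hc⟩ ⟨x', hx', hc'⟩
      · rcases eq_or_ne x x₀ with rfl | hne
        · simpa using hy'
        · rw [hupd x hne]
          exact hgW x ((Finset.mem_insert.1 hx).resolve_left hne)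
  obtain ⟨g, hg, hcons, hgY⟩ := key Z subset_rfl
  refine ⟨modelOf φ.q n {c | ∃ x ∈ Z, c ∈ cd x (g x)}, fun x hx => ?_⟩
  have hxZ : x ∈ Z := Finset.mem_filter.2 ⟨Finset.mem_univ _, hx⟩
  exact ⟨(g x).1, hgY x hxZ, holds_modelOf hcons (hg x hxZ) fun c hc => ⟨x, hxZ, hc⟩⟩

end Exchange


/-! ### A random choice of the quantified relations -/

section Averaging

variable {t : ℕ} {r : Fin t → ℕ} (φ : Formula r) {A : Type}

/-- The interpretation of the quantified symbols with exactly the atoms in `T` true. -/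
def ofAtoms {u : ℕ} {q : Fin u → ℕ} (T : Finset ((j : Fin u) × (Fin (q j) → A))) : RelStr q A :=
  fun j => {z | ⟨j, z⟩ ∈ T}

/-- The truth of a conjunction of literals depends on few atoms over the quantified symbols. -/
theorem Lit.exists_atoms {u : ℕ} {q : Fin u → ℕ} {V : Type} (d : List (Lit r q V)) (v : V → A) :
    ∃ U : Finset ((j : Fin u) × (Fin (q j) → A)), U.card ≤ d.countP Lit.isGuess ∧
      ∀ (R : RelStr r A) (S S' : RelStr q A), (∀ p ∈ U, p.2 ∈ S p.1 ↔ p.2 ∈ S' p.1) →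
        ∀ l ∈ d, l.Holds R S v → l.Holds R S' v := by
  classical
  induction d with
  | nil => exact ⟨∅, by simp, by simp⟩
  | cons l d ih =>
    obtain ⟨U, hU, h⟩ := ih
    rcases l with ⟨p, i, z⟩ | ⟨p, j, z⟩
    · refine ⟨U, by simpa [Lit.isGuess] using hU, fun R S S' hS l hl hl' => ?_⟩
      rcases List.mem_cons.1 hl with rfl | hl
      · cases p <;> exact hl'
      · exact h R S S' hS l hl hl'
    · refine ⟨insert ⟨j, v ∘ z⟩ U, (Finset.card_insert_le _ _).trans
        (by simpa [List.countP_cons, Lit.isGuess] using hU), fun R S S' hS l hl hl' => ?_⟩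
      rcases List.mem_cons.1 hl with rfl | hl
      · have := hS ⟨j, v ∘ z⟩ (Finset.mem_insert_self _ _)
        cases p
        · exact fun hn => hl' (this.2 hn)
        · exact this.1 hl'
      · exact h R S S' (fun p hp => hS p (Finset.mem_insert_of_mem hp)) l hl hl'

theorem countP_isGuess_le {d : List (Lit r φ.q (Fin φ.cx ⊕ Fin φ.cy))} (hd : d ∈ φ.ψ) :
    d.countP Lit.isGuess ≤ φ.s := by
  rw [← length_codes 0 (fun _ => 0)]
  exact length_codes_le hd _

open scoped Classical in
/-- For `x ∈ X_A`, the sentence `∃ y, ψ(x, y, S)` holds with probability at least `2 ^ (-s)`. -/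
theorem card_le_two_pow_mul_card_holds [Fintype A] {R : RelStr r A} {x : Fin φ.cx → A}
    (hx : x ∈ φ.satisfiable R) :
    Fintype.card (Finset ((j : Fin φ.u) × (Fin (φ.q j) → A))) ≤ 2 ^ φ.s *
      (Finset.univ.filter fun T : Finset ((j : Fin φ.u) × (Fin (φ.q j) → A)) =>
        ∃ y, φ.Holds R (ofAtoms T) x y).card := by
  obtain ⟨S, y, d, hd, h⟩ := hx
  obtain ⟨U, hU, hUS⟩ := Lit.exists_atoms d (Sum.elim x y)
  let G : Finset ((j : Fin φ.u) × (Fin (φ.q j) → A)) := U.filter fun p => p.2 ∈ S p.1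
  rw [← Finset.card_univ]
  -- An interpretation is determined by its restriction to `U`, and by the interpretation that
  -- agrees with `S` on `U` and with the given one elsewhere; the latter makes the sentence true.
  refine (Finset.card_le_card_of_injOn (t := U.powerset ×ˢ
      Finset.univ.filter fun T => ∃ y, φ.Holds R (ofAtoms T) x y)
    (fun T => (T ∩ U, (T \ U) ∪ G)) (fun T _ => ?_) ?_).trans
    (by
      rw [Finset.card_product, Finset.card_powerset]
      exact Nat.mul_le_mul_right _ (Nat.pow_le_pow_right two_pos
        (hU.trans (countP_isGuess_le φ hd))))
  · refine Finset.mem_product.2 ⟨Finset.mem_powerset.2 Finset.inter_subset_right,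
      Finset.mem_filter.2 ⟨Finset.mem_univ _, y, d, hd, fun l hl =>
        hUS R S _ (fun p hp => ?_) l hl (h l hl)⟩⟩
    simp [ofAtoms, G, hp]
  · intro T _ T' _ hTT
    obtain ⟨h₁, h₂⟩ := Prod.ext_iff.1 hTT
    ext p
    by_cases hp : p ∈ U
    · simpa [hp] using Finset.ext_iff.1 h₁ p
    · simpa [hp, G] using Finset.ext_iff.1 h₂ p

/-- If `X_A` has at least `k * 2 ^ s` elements, then the average of `|{x : ∃ y, ψ(x, y, S)}|` over
all `S` is at least `k`. -/
theorem exists_le_value [Finite A] {R : RelStr r A} {k : ℕ}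
    (h : k * 2 ^ φ.s ≤ (φ.satisfiable R).ncard) : ∃ S, k ≤ φ.value R S := by
  classical
  have := Fintype.ofFinite A
  by_contra! hlt
  set X : Finset (Fin φ.cx → A) := Finset.univ.filter fun x => x ∈ φ.satisfiable R with hX
  have hXc : (φ.satisfiable R).ncard = X.card := by
    rw [← Set.ncard_coe_finset]
    congr 1
    ext x
    simp [hX]
  let N := Fintype.card (Finset ((j : Fin φ.u) × (Fin (φ.q j) → A)))
  let holds (x : Fin φ.cx → A) (T : Finset ((j : Fin φ.u) × (Fin (φ.q j) → A))) : Prop :=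
    ∃ y, φ.Holds R (ofAtoms T) x y
  have h₁ : X.card * N ≤ 2 ^ φ.s * ∑ x ∈ X, (Finset.univ.filter (holds x)).card := by
    rw [Finset.mul_sum, ← smul_eq_mul, ← Finset.sum_const]
    exact Finset.sum_le_sum fun x hx =>
      card_le_two_pow_mul_card_holds φ (Finset.mem_filter.1 hx).2
  have h₂ : ∑ x ∈ X, (Finset.univ.filter (holds x)).card =
      ∑ T, (X.filter fun x => holds x T).card :=
    Finset.sum_card_bipartiteAbove_eq_sum_card_bipartiteBelow holds
  have h₃ : ∑ T, (X.filter fun x => holds x T).card <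
      ∑ _T : Finset ((j : Fin φ.u) × (Fin (φ.q j) → A)), k := by
    refine Finset.sum_lt_sum_of_nonempty ⟨∅, Finset.mem_univ _⟩ fun T _ =>
      lt_of_le_of_lt ?_ (hlt (ofAtoms T))
    rw [← Set.ncard_coe_finset]
    exact Set.ncard_le_ncard (fun x hx => (Finset.mem_filter.1 (Finset.mem_coe.1 hx)).2)
      (Set.toFinite _)
  rw [Finset.sum_const, smul_eq_mul, Finset.card_univ] at h₃
  rw [hXc] at h
  have h₄ := Nat.mul_le_mul_right N h
  have h₅ : _ < 2 ^ φ.s * (N * k) := Nat.mul_lt_mul_of_pos_left h₃ (Nat.two_pow_pos φ.s)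
  rw [h₂] at h₁
  have : k * 2 ^ φ.s * N = 2 ^ φ.s * (N * k) := by ring
  omega

end Averaging

/-! ### The optimum of the restricted structure -/

section Restriction

variable {t : ℕ} {r : Fin t → ℕ}

theorem Lit.holds_comp {u : ℕ} {q : Fin u → ℕ} {V A B : Type} {f : A → B} {R : RelStr r B}
    {R' : RelStr r A} {S : RelStr q B} {S' : RelStr q A} (hR : ∀ i v, v ∈ R' i ↔ f ∘ v ∈ R i)
    (hS : ∀ j v, v ∈ S' j ↔ f ∘ v ∈ S j) (v : V → A) (l : Lit r q V) :
    l.Holds R' S' v ↔ l.Holds R S (f ∘ v) := by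
  rcases l with ⟨_ | _, i, z⟩ | ⟨_ | _, j, z⟩
  · exact not_congr (hR i _)
  · exact hR i _
  · exact not_congr (hS j _)
  · exact hS j _

theorem Formula.holds_comp {φ : Formula r} {A B : Type} {f : A → B} {R : RelStr r B}
    {R' : RelStr r A} {S : RelStr φ.q B} {S' : RelStr φ.q A}
    (hR : ∀ i v, v ∈ R' i ↔ f ∘ v ∈ R i) (hS : ∀ j v, v ∈ S' j ↔ f ∘ v ∈ S j)
    (x : Fin φ.cx → A) (y : Fin φ.cy → A) :
    φ.Holds R' S' x y ↔ φ.Holds R S (f ∘ x) (f ∘ y) := by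
  simp only [Formula.Holds, DNF.Holds, Lit.holds_comp hR hS, Sum.comp_elim]

theorem exists_comp_eq {A B C : Type} {f : A → B} {x : C → B} (h : Set.range x ⊆ Set.range f) :
    ∃ x', f ∘ x' = x := by
  choose x' hx' using fun c => h ⟨c, rfl⟩
  exact ⟨x', funext hx'⟩

/-- Restricting a structure to the elements that occur in the tuples of `X_A` and in their
representative witnesses does not change the optimum. -/
theorem opt_restriction_eq {Q : MaxProblem r} {φ : Formula r} (hQ : φ.Expresses Q) {n n' : ℕ}
    {R : RelStr r (Fin n)} {R' : RelStr r (Fin n')} {f : Fin n' ↪ Fin n}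
    {Y' : (Fin φ.cx → Fin n) → Set (Fin φ.cy → Fin n)}
    (hY : Representative φ R ((φ.satisfiable R).ncard * φ.s) Y')
    (hR : ∀ i v, v ∈ R' i ↔ f ∘ v ∈ R i)
    (hx : ∀ x ∈ φ.satisfiable R, Set.range x ⊆ Set.range f)
    (hy : ∀ x ∈ φ.satisfiable R, ∀ y ∈ Y' x, Set.range y ⊆ Set.range f) :
    Q (Fin n') R' = Q (Fin n) R := by
  have hinj : ∀ c, Function.Injective fun v : Fin c → Fin n' => f ∘ v := fun c =>
    f.injective.comp_left
  apply le_antisymm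
  · obtain ⟨S', hS'⟩ := (hQ _ R').1
    rw [← hS']
    let S : RelStr φ.q (Fin n) := fun j => (fun v => f ∘ v) '' S' j
    have hS : ∀ j v, v ∈ S' j ↔ f ∘ v ∈ S j := fun j v => ((hinj _).mem_set_image).symm
    refine le_trans ?_ ((hQ _ R).2 ⟨S, rfl⟩)
    refine Set.ncard_le_ncard_of_injOn (fun v => f ∘ v) ?_ (hinj _).injOn (Set.toFinite _)
    rintro x ⟨y, h⟩
    exact ⟨f ∘ y, (Formula.holds_comp hR hS x y).1 h⟩
  · obtain ⟨S, hS⟩ := (hQ _ R).1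
    rw [← hS]
    obtain ⟨S₁, hS₁⟩ := exists_model_of_representative hY S
    let S' : RelStr φ.q (Fin n') := fun j => {v | f ∘ v ∈ S₁ j}
    refine le_trans ?_ ((hQ _ R').2 ⟨S', rfl⟩)
    rw [Formula.value, Formula.value, ← Set.ncard_image_of_injective _ (hinj φ.cx)]
    refine Set.ncard_le_ncard ?_ (Set.toFinite _)
    rintro x ⟨y, h⟩
    have hxX : x ∈ φ.satisfiable R := ⟨S, y, h⟩
    obtain ⟨y₁, hy₁, h₁⟩ := hS₁ x ⟨y, h⟩
    obtain ⟨x', rfl⟩ := exists_comp_eq (hx x hxX)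
    obtain ⟨y', rfl⟩ := exists_comp_eq (hy _ hxX y₁ hy₁)
    exact ⟨x', ⟨y', (Formula.holds_comp hR (fun j v => Iff.rfl) x' y').2 h₁⟩, rfl⟩

end Restriction

/-! ### Formulas without the existential quantifier -/

section SNP

variable {t : ℕ} {r : Fin t → ℕ}

/-- Renaming the variables of a literal. -/
def Lit.rename {u : ℕ} {q : Fin u → ℕ} {V W : Type} (g : V → W) : Lit r q V → Lit r q W
  | .input p i z => .input p i (g ∘ z)
  | .guess p j z => .guess p j (g ∘ z)

theorem Lit.holds_rename {u : ℕ} {q : Fin u → ℕ} {V W A : Type} (g : V → W) (R : RelStr r A)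
    (S : RelStr q A) (v : W → A) (l : Lit r q V) :
    (l.rename g).Holds R S v ↔ l.Holds R S (v ∘ g) := by
  rcases l with ⟨_ | _, i, z⟩ | ⟨_ | _, j, z⟩ <;> exact Iff.rfl

theorem InMaxSNP.inMaxNP {Q : MaxProblem r} (h : InMaxSNP Q) : InMaxNP Q := by
  obtain ⟨u, q, c, ψ, h⟩ := h
  refine ⟨⟨q, c, 0, ψ.map fun d => d.map (Lit.rename Sum.inl)⟩, fun A _ R => ?_⟩
  convert h A R using 2
  ext S
  refine congrArg Set.ncard (Set.ext fun x => ?_)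
  simp [Formula.Holds, DNF.Holds, Lit.holds_rename]

end SNP


/-! ### Decoding instances -/

section Decoding

variable {t : ℕ} (r : Fin t → ℕ)

open scoped Classical in
/-- The number of ones at the beginning of a word: the size of the universe of the encoded
instance. -/
noncomputable def size (w : Word) : ℕ :=
  Nat.count (fun i => ∀ j < i + 1, w[j]? = some (some true)) w.length

/-- The part of an encoded instance that starts with the truth table of the relation number `i`; for
`i = t`, this is the binary number at the end. -/
noncomputable def rest (w : Word) : ℕ → Word
  | 0 => w.drop (size w + 1)
  | i + 1 => (rest w i).drop (if h : i < t then size w ^ r ⟨i, h⟩ + 1 else 0)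

/-- The entry with index `m` in the truth table of the relation number `i`. -/
def numRel (w : Word) (i : Fin t) (m : ℕ) : Prop := (rest r w i)[m]? = some (some true)

open scoped Classical in
/-- The encoding of the instance with `n` elements whose truth tables are given by `T`, and whose
number is written as `b`. -/
noncomputable def encWord (n : ℕ) (T : Fin t → ℕ → Prop) (b : Word) : Word :=
  List.replicate n (some true) ++ none ::
    ((List.ofFn fun i => (List.range (n ^ r i)).map (fun m => some (decide (T i m))) ++
      [none]).flatten ++ b)

/-- The word `b` is the binary representation of a natural number. -/
def IsBinary (b : Word) : Prop := ∃ k, b = (Computability.encodeNat k).map some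

/-- The word `w` encodes an instance: decoding and encoding it again gives back `w`, and its last
part is a binary number. -/
def Valid (w : Word) : Prop :=
  encWord r (size w) (numRel r w) (rest r w t) = w ∧ IsBinary (rest r w t)

variable {r}

open scoped Classical in
theorem encode_eq_encWord (I : Instance r) {T : Fin t → ℕ → Prop}
    (h : ∀ i (z : Fin (r i) → Fin I.n), z ∈ I.rel i ↔ T i (finFunctionFinEquiv z)) :
    I.encode = encWord r I.n T ((Computability.encodeNat I.k).map some) := by
  have : ∀ i, table (I.rel i) = (List.range (I.n ^ r i)).map fun m => some (decide (T i m)) := by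
    intro i
    refine List.ext_getElem (by simp [table]) fun m hm _ => ?_
    have hm' : m < I.n ^ r i := by simpa [table] using hm
    simp [table, h]
  simp only [Instance.encode, encWord, this]

theorem size_append (n : ℕ) (w : Word) :
    size (List.replicate n (some true) ++ none :: w) = n := by
  classical
  rw [size, Nat.count_eq_card_filter_range]
  convert Finset.card_range n using 2
  ext i
  simp only [Finset.mem_filter, Finset.mem_range, List.length_append, List.length_replicate,
    List.length_cons]
  constructor
  · rintro ⟨-, h⟩
    by_contra hi
    simpa using h n (by omega)
  · refine fun hi => ⟨by omega, fun j hj => ?_⟩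
    rw [List.getElem?_append_left (by simp; omega), List.getElem?_replicate, if_pos (by omega)]

variable (n : ℕ) (T : Fin t → ℕ → Prop) (b : Word)

theorem size_encWord : size (encWord r n T b) = n := size_append _ _

open scoped Classical in
theorem rest_encWord (i : ℕ) (hi : i ≤ t) : rest r (encWord r n T b) i =
    ((List.ofFn fun i => (List.range (n ^ r i)).map (fun m => some (decide (T i m))) ++
      [none]).drop i).flatten ++ b := by
  induction i with
  | zero =>
    rw [rest, size_encWord, encWord, List.drop_append]
    simp
  | succ i ih =>
    rw [rest, ih (by omega), size_encWord, dif_pos (show i < t by omega),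
      List.drop_eq_getElem_cons (l := List.ofFn _) (by simpa using hi)]
    simp [List.drop_append]

theorem rest_encWord_last : rest r (encWord r n T b) t = b := by
  rw [rest_encWord n T b t le_rfl, List.drop_eq_nil_of_le (by simp)]
  simp

theorem numRel_encWord (i : Fin t) {m : ℕ} (hm : m < n ^ r i) :
    numRel r (encWord r n T b) i m ↔ T i m := by
  rw [numRel, rest_encWord n T b i i.2.le, List.drop_eq_getElem_cons (l := List.ofFn _) (by simp)]
  simp [List.getElem?_append_left, hm]

theorem size_encode (I : Instance r) : size I.encode = I.n := size_append _ _

theorem rest_encode (I : Instance r) :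
    rest r I.encode t = (Computability.encodeNat I.k).map some := by
  rw [encode_eq_encWord I (T := fun i m => ∃ z ∈ I.rel i, (finFunctionFinEquiv z : ℕ) = m)
    fun i z => ?_, rest_encWord_last]
  exact ⟨fun h => ⟨z, h, rfl⟩, fun ⟨z', h, hz⟩ =>
    finFunctionFinEquiv.injective (Fin.ext hz) ▸ h⟩

theorem numRel_encode (I : Instance r) (i : Fin t) (z : Fin (r i) → Fin I.n) :
    numRel r I.encode i (finFunctionFinEquiv z) ↔ z ∈ I.rel i := by
  have h : ∀ i (z : Fin (r i) → Fin I.n), z ∈ I.rel i ↔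
      ∃ z' ∈ I.rel i, (finFunctionFinEquiv z' : ℕ) = finFunctionFinEquiv z := fun i z =>
    ⟨fun h => ⟨z, h, rfl⟩, fun ⟨z', h, hz⟩ => finFunctionFinEquiv.injective (Fin.ext hz) ▸ h⟩
  rw [encode_eq_encWord I (T := fun i m => ∃ z ∈ I.rel i, (finFunctionFinEquiv z : ℕ) = m) h,
    numRel_encWord I.n _ _ i (finFunctionFinEquiv z).2, h]

theorem valid_iff (w : Word) : Valid r w ↔ ∃ I : Instance r, I.encode = w := by
  constructor
  · rintro ⟨h, k, hk⟩
    refine ⟨⟨size w, fun i => {z | numRel r w i (finFunctionFinEquiv z)}, k⟩, ?_⟩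
    rw [encode_eq_encWord _ (T := numRel r w) fun i z => Iff.rfl, ← hk, h]
  · rintro ⟨I, rfl⟩
    refine ⟨?_, I.k, rest_encode I⟩
    rw [size_encode, rest_encode,
      ← encode_eq_encWord I fun i z => (numRel_encode I i z).symm]

/-! ### Binary representations -/

theorem exists_encodePosNum (l : List Bool) :
    ∃ p : PosNum, Computability.encodePosNum p = l ++ [true] := by
  induction l with
  | nil => exact ⟨.one, rfl⟩
  | cons b l ih =>
    obtain ⟨p, hp⟩ := ih
    cases b
    · exact ⟨.bit0 p, by rw [Computability.encodePosNum, hp, List.cons_append]⟩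
    · exact ⟨.bit1 p, by rw [Computability.encodePosNum, hp, List.cons_append]⟩

theorem encodePosNum_eq_append (p : PosNum) :
    ∃ l, Computability.encodePosNum p = l ++ [true] := by
  induction p with
  | one => exact ⟨[], rfl⟩
  | bit0 p ih => exact ih.elim fun l h => ⟨false :: l, by rw [Computability.encodePosNum, h]; rfl⟩
  | bit1 p ih => exact ih.elim fun l h => ⟨true :: l, by rw [Computability.encodePosNum, h]; rfl⟩

theorem isBinary_iff (b : Word) : IsBinary b ↔ (∀ i < b.length, b[i]? ≠ some none) ∧
    (b.length = 0 ∨ b[b.length - 1]? = some (some true)) := by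
  constructor
  · rintro ⟨k, rfl⟩
    refine ⟨fun i hi => by simp, ?_⟩
    rw [Computability.encodeNat]
    rcases (k : Num) with _ | p
    · simp [Computability.encodeNum]
    · obtain ⟨l, hl⟩ := encodePosNum_eq_append p
      simp [Computability.encodeNum, hl]
  · rintro ⟨h, h'⟩
    have : ∃ l : List Bool, b = l.map some := by
      refine ⟨b.map fun c => c.getD false, ?_⟩
      refine List.ext_getElem (by simp) fun i hi _ => ?_
      have := h i hi
      rw [List.getElem?_eq_getElem hi] at this
      rcases hb : b[i] with _ | c
      · simp [hb] at this
      · simp [hb]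
    obtain ⟨l, rfl⟩ := this
    rcases List.eq_nil_or_concat l with rfl | ⟨l, c, rfl⟩
    · exact ⟨0, rfl⟩
    · simp at h'
      subst h'
      obtain ⟨p, hp⟩ := exists_encodePosNum l
      exact ⟨(p : ℕ), by simp [Computability.encodeNat, Computability.encodeNum, hp]⟩

/-- The number with the binary representation `b`. -/
def binVal : Word → ℕ
  | [] => 0
  | c :: b => 2 * binVal b + if c = some true then 1 else 0

theorem binVal_encodeNat (k : ℕ) : binVal ((Computability.encodeNat k).map some) = k := by
  have h : ∀ p : PosNum, binVal ((Computability.encodePosNum p).map some) = p := by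
    intro p
    induction p with
    | one => rfl
    | bit0 p ih => simp [Computability.encodePosNum, binVal, ih]; omega
    | bit1 p ih => simp [Computability.encodePosNum, binVal, ih]; omega
  rw [Computability.encodeNat]
  have hk : ((k : Num) : ℕ) = k := by simp
  rcases hk' : (k : Num) with _ | p
  · rw [hk'] at hk
    simpa [Computability.encodeNum, binVal] using hk
  · rw [hk'] at hk
    simpa [Computability.encodeNum, h] using hk

theorem length_encodeNat_le (k : ℕ) : (Computability.encodeNat k).length ≤ k := by
  have h : ∀ p : PosNum, (Computability.encodePosNum p).length ≤ p := by
    intro p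
    induction p with
    | one => simp [Computability.encodePosNum]
    | bit0 p ih =>
      have := PosNum.cast_pos (α := ℕ) p
      simp [Computability.encodePosNum]; omega
    | bit1 p ih => simp [Computability.encodePosNum]; omega
  rw [Computability.encodeNat]
  have hk : ((k : Num) : ℕ) = k := by simp
  rcases hk' : (k : Num) with _ | p
  · simp [Computability.encodeNum]
  · rw [hk'] at hk
    exact (h p).trans hk.le

end Decoding

/-! ### Decoding in polynomial time -/

namespace PolyTime

variable {α : Type} [Env α] {t : ℕ} {r : Fin t → ℕ}

@[fun_prop]
theorem size {w : α → Word} (hw : PolyTime w) : PolyTime fun a => MaxNP.size (w a) := by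
  classical
  refine comp (g := MaxNP.size) ?_ hw
  refine count (P := fun (w : Word) i => ∀ j < i + 1, w[j]? = some (some true)) (by fun_prop) ?_
  exact forall_lt (α := Word × ℕ) (P := fun p j => p.1[j]? = some (some true)) (by fun_prop)
    (getElem?_eq_some (by fun_prop) (by fun_prop) _)

@[fun_prop]
theorem rest (r : Fin t → ℕ) {w : α → Word} (hw : PolyTime w) (i : ℕ) :
    PolyTime fun a => MaxNP.rest r (w a) i := by
  induction i with
  | zero => simp only [MaxNP.rest]; fun_prop
  | succ i ih =>
    simp only [MaxNP.rest]
    split_ifs <;> fun_prop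

@[fun_prop]
theorem numRel {w : α → Word} {m : α → ℕ} (i : Fin t) (hw : PolyTime w) (hm : PolyTime m) :
    PolyTime fun a => MaxNP.numRel r (w a) i (m a) :=
  getElem?_eq_some (by fun_prop) hm _

theorem flatten_ofFn {m : ℕ} {f : Fin m → α → Word} (hf : ∀ i, PolyTime (f i)) :
    PolyTime fun a => (List.ofFn fun i => f i a).flatten := by
  induction m with
  | zero => simpa using const_word (α := α) []
  | succ m ih =>
    simp only [List.ofFn_succ, List.flatten_cons]
    exact (hf 0).append (ih fun i => hf i.succ)

theorem encWord {n : α → ℕ} {T : α → Fin t → ℕ → Prop} {b : α → Word} (hn : PolyTime n)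
    (hT : ∀ i, PolyTime fun p : α × ℕ => T p.1 i p.2) (hb : PolyTime b) :
    PolyTime fun a => MaxNP.encWord r (n a) (T a) (b a) := by
  classical
  have h : ∀ i, PolyTime fun a =>
      (List.range (n a ^ r i)).map (fun m => (some (decide (T a i m)) : Symb)) := fun i =>
    map_range (F := fun a m => some (decide (T a i m))) (by fun_prop)
      (((hT i).ite (const_symb (some true)) (const_symb (some false))).of_eq fun p => by
        by_cases hp : T p.1 i p.2 <;> simp [hp])
  have h' := flatten_ofFn fun i => (h i).append (const_word [none])
  have := hn.replicate (some true)
  unfold MaxNP.encWord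
  fun_prop

theorem isBinary {b : α → Word} (hb : PolyTime b) : PolyTime fun a => IsBinary (b a) := by
  refine of_iff (.and (forall_lt (P := fun a i => (b a)[i]? ≠ some none) hb.length
    (not (getElem?_eq_some (by fun_prop) (by fun_prop) _))) (.or (.eq hb.length (const_nat 0))
      (getElem?_eq_some hb (by fun_prop) (some true)))) fun a => isBinary_iff _

theorem valid (r : Fin t → ℕ) : PolyTime (Valid r) :=
  .and (.eq_word (encWord (by fun_prop) (by fun_prop) (by fun_prop)) id) (isBinary (by fun_prop))

/-- The value of a binary number is computed by Horner's rule, and cut off in every step, since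
the value may be exponential in the length. -/
theorem min_binVal {b : α → Word} {c : α → ℕ} (hb : PolyTime b) (hc : PolyTime c) :
    PolyTime fun a => Min.min (binVal (b a)) (c a) := by
  have := iterate (B := fun a i => Min.min (binVal ((b a).drop ((b a).length - i))) (c a))
    (step := fun q => Min.min (2 * q.2 +
      if (b q.1.1)[(b q.1.1).length - (q.1.2 + 1)]? = some (some true) then 1 else 0) (c q.1.1))
    hb.length (by simpa [binVal] using const_nat 0) (by
      have : PolyTime fun q : (α × ℕ) × ℕ =>
          (b q.1.1)[(b q.1.1).length - (q.1.2 + 1)]? = some (some true) :=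
        getElem?_eq_some (by fun_prop) (by fun_prop) _
      fun_prop) (fun a i hi => by
      have h : (b a).length - (i + 1) < (b a).length := by omega
      dsimp only
      rw [List.drop_eq_getElem_cons h, binVal, List.getElem?_eq_getElem h,
        show (b a).length - (i + 1) + 1 = (b a).length - i by omega]
      simp only [Option.some.injEq]
      omega)
    ⟨_, hc.bounded_nat, fun a i _ => by simp⟩
  simpa using this

end PolyTime

open scoped Classical in
theorem hasPolyTimeParam {t : ℕ} {r : Fin t → ℕ} (Q : MaxProblem r) :
    (standardParam Q).HasPolyTimeParam := by
  refine PolyTime.nonempty_computable (f := fun w => if Valid r w then rest r w t else [])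
    ((PolyTime.valid r).ite (by fun_prop) (by fun_prop)) (fun c => c.getD false) _ _ fun w => ?_
  split_ifs with h
  · obtain ⟨I, rfl⟩ := (valid_iff w).1 h
    rw [standardParam_param_encode, rest_encode]
    simp
  · rw [valid_iff] at h
    simp only [standardParam, dif_neg h]
    rfl


/-! ### The kernelization, with tuples given by their indices -/

/-- The component number `j` of the tuple over `{0, …, n - 1}` with the index `e`. -/
def digit (n e j : ℕ) : ℕ := e / n ^ j % n

section Kernel

variable {t : ℕ} {r : Fin t → ℕ}

/-- The truth of the literals over the input symbols in the structure encoded by `w`. -/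
def Lit.NumHolds {u : ℕ} {q : Fin u → ℕ} {V : Type} (w : Word) (v : V → ℕ) : Lit r q V → Prop
  | .input true i z => numRel r w i (tupleIndex (size w) v z)
  | .input false i z => ¬ numRel r w i (tupleIndex (size w) v z)
  | .guess _ _ _ => True

variable (φ : Formula r) (w : Word)

/-- The values of the variables under the assignment of the tuples with indices `e` and `e'`. -/
noncomputable def numVal (e e' : ℕ) : Fin φ.cx ⊕ Fin φ.cy → ℕ :=
  Sum.elim (fun j => digit (size w) e j) fun j => digit (size w) e' j

/-- The disjunct `d` can be made true at the tuples with indices `e` and `e'`. -/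
def NumItem (e e' : ℕ) (d : List (Lit r φ.q (Fin φ.cx ⊕ Fin φ.cy))) : Prop :=
  (∀ l ∈ d, l.NumHolds w (numVal φ w e e')) ∧
    Consistent {c | c ∈ codes (size w) (numVal φ w e e') d}

/-- The number of candidates for pairs of a tuple `y` and a disjunct: the candidate with number `i`
consists of the tuple with index `i / |ψ|` and the disjunct number `i % |ψ|`. -/
noncomputable def candidates : ℕ := size w ^ φ.cy * φ.ψ.length

/-- At the tuple `x` with index `e`, the candidate number `i` can be made true. -/
def IsItem (e i : ℕ) : Prop :=
  ∃ d, φ.ψ[i % φ.ψ.length]? = some d ∧ NumItem φ w e (i / φ.ψ.length) d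

/-- The codes of the literals over the quantified symbols that make the candidate number `i`
true. -/
noncomputable def itemCodes (e i : ℕ) : Finset ℕ :=
  (codes (size w) (numVal φ w e (i / φ.ψ.length)) (φ.ψ[i % φ.ψ.length]?.getD [])).toFinset

/-- The code of the literal `l` at the tuples with indices `e` and `e'`. -/
noncomputable def numCode (e e' : ℕ) (l : Lit r φ.q (Fin φ.cx ⊕ Fin φ.cy)) : ℕ :=
  l.code (size w) (numVal φ w e e')

/-- The tuple with index `e` belongs to `X_A`. -/
def NumSat (e : ℕ) : Prop := ∃ i < candidates φ w, IsItem φ w e i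

open scoped Classical in
/-- The cardinality of `X_A`. -/
noncomputable def numX : ℕ := Nat.count (NumSat φ w) (size w ^ φ.cx)

/-- The candidate number `i` is kept for the tuple with index `e`. -/
def Kept (e i : ℕ) : Prop :=
  i ∈ kept (IsItem φ w e) (itemCodes φ w e) φ.s (numX φ w * φ.s) (i + 1)

/-- The literals in `d'`, taken from the candidate number `i`, belong to the candidate number
`i'`. -/
def Contains (e i i' : ℕ) (d' : List (Lit r φ.q (Fin φ.cx ⊕ Fin φ.cy))) : Prop :=
  ∀ l ∈ d', ∃ d, φ.ψ[i' % φ.ψ.length]? = some d ∧ ∃ l' ∈ d.filter Lit.isGuess,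
    numCode φ w e (i' / φ.ψ.length) l' = numCode φ w e (i / φ.ψ.length) l

open scoped Classical in
/-- The candidate number `i` is to be kept, where `b` lists which of the smaller candidates are
kept. The subsets of the codes of the candidate are given by the sublists of its disjunct on which
the codes are pairwise distinct. -/
def NumAdmissible (e i : ℕ) (b : Word) : Prop :=
  ∃ d, φ.ψ[i % φ.ψ.length]? = some d ∧ (NumItem φ w e (i / φ.ψ.length) d ∧
    ∀ d' ∈ (d.filter Lit.isGuess).sublists, (d'.map (numCode φ w e (i / φ.ψ.length))).Nodup →
      Nat.count (fun i' => b[i - (i' + 1)]? = some (some true) ∧ Contains φ w e i i' d') i <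
        (numX φ w * φ.s + 1) ^ (φ.s - d'.length))

/-- The element `a` belongs to the restricted structure. -/
def Used (a : ℕ) : Prop :=
  ∃ e < size w ^ φ.cx, NumSat φ w e ∧
    ((∃ j : Fin φ.cx, digit (size w) e j = a) ∨
      ∃ i < candidates φ w, Kept φ w e i ∧
        ∃ j : Fin φ.cy, digit (size w) (i / φ.ψ.length) j = a)

open scoped Classical in
/-- The number of elements of the restricted structure. -/
noncomputable def newSize : ℕ := Nat.count (Used φ w) (size w)

open scoped Classical in
/-- The element number `j` of the restricted structure in increasing order. -/
noncomputable def element (j : ℕ) : ℕ :=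
  Nat.count (fun a => Nat.count (Used φ w) (a + 1) ≤ j) (size w)

/-- The truth table number `i` of the restricted structure. -/
def newRel (i : Fin t) (m : ℕ) : Prop :=
  numRel r w i (tupleIndex (size w) (fun l : Fin (r i) => element φ w (digit (newSize φ w) m l)) id)

/-- An instance with the answer yes. -/
def trivialInstance (r : Fin t → ℕ) : Instance r := ⟨0, fun _ => ∅, 0⟩

open scoped Classical in
/-- The kernelization: an instance with `|X_A| ≥ k * 2 ^ s` is replaced by a trivial instance with
the answer yes, and all other instances are restricted. -/
noncomputable def kernel : Word :=
  if Valid r w then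
    if min (binVal (rest r w t)) (numX φ w / 2 ^ φ.s + 1) ≤ numX φ w / 2 ^ φ.s then
      (trivialInstance r).encode
    else encWord r (newSize φ w) (newRel φ w) (rest r w t)
  else []

end Kernel

/-! ### Recursion over the kept candidates -/

section Bits

open scoped Classical in
/-- The truth values of `P (j - 1), …, P 0` as a word. -/
noncomputable def bits (P : ℕ → Prop) (j : ℕ) : Word :=
  (List.range j).reverse.map fun i => some (decide (P i))

variable {P : ℕ → Prop}

open scoped Classical in
theorem bits_succ (j : ℕ) : bits P (j + 1) = some (decide (P j)) :: bits P j := by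
  simp [bits, List.range_succ]

theorem getElem?_bits {i j : ℕ} (h : i < j) :
    (bits P j)[j - (i + 1)]? = some (some true) ↔ P i := by
  have h₁ : j - 1 - (j - (i + 1)) = i := by omega
  have h₂ : j - (i + 1) < j := by omega
  simp [bits, h₂, h₁]

theorem length_bits (j : ℕ) : (bits P j).length = j := by simp [bits]

theorem notMem_kept_self {ok : ℕ → Prop} {L : ℕ → Finset ℕ} {s b i : ℕ} :
    i ∉ kept ok L s b i := fun h => (lt_and_ok_of_mem_kept h).1.false

theorem mem_kept_iff {ok : ℕ → Prop} {L : ℕ → Finset ℕ} {s b i m : ℕ} :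
    i ∈ kept ok L s b m ↔ i < m ∧ i ∈ kept ok L s b (i + 1) := by
  refine ⟨fun h => ⟨(lt_and_ok_of_mem_kept h).1, ?_⟩, fun h => kept_mono h.1 h.2⟩
  induction m with
  | zero => simp [kept] at h
  | succ m ih =>
    rcases (Nat.lt_succ_iff.1 (lt_and_ok_of_mem_kept h).1).lt_or_eq with hlt | rfl
    · refine ih ?_
      rw [kept] at h
      split_ifs at h
      · exact (Finset.mem_insert.1 h).resolve_left hlt.ne
      · exact h
    · exact h

theorem mem_kept_succ_iff {ok : ℕ → Prop} {L : ℕ → Finset ℕ} {s b i : ℕ} :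
    i ∈ kept ok L s b (i + 1) ↔ Admissible ok L s b (kept ok L s b i) i := by
  rw [kept]
  split_ifs with h
  · simp [h]
  · simp [h, notMem_kept_self]

theorem forall_subset_toFinset_map {ρ : Type} (l : List ρ) (f : ρ → ℕ) {p : Finset ℕ → Prop} :
    (∀ T ⊆ (l.map f).toFinset, p T) ↔
      ∀ l' ∈ l.sublists, (l'.map f).Nodup → p (l'.map f).toFinset := by
  constructor
  · intro h l' hl' _
    exact h _ fun c hc => List.mem_toFinset.2
      (((List.mem_sublists.1 hl').map f).subset (List.mem_toFinset.1 hc))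
  · intro h T hT
    have hs : ((l.map f).dedup.filter (· ∈ T)).Sublist (l.map f) :=
      List.filter_sublist.trans (List.dedup_sublist _)
    obtain ⟨l', hl', he⟩ := List.sublist_map_iff.1 hs
    have hT' : (l'.map f).toFinset = T := by
      rw [← he]
      ext c
      simpa using fun hc => List.mem_map.1 (List.mem_toFinset.1 (hT hc))
    rw [← hT']
    exact h l' (List.mem_sublists.2 hl') (he ▸ (List.nodup_dedup _).filter _)

theorem kept_iff_numAdmissible {t : ℕ} {r : Fin t → ℕ} (φ : Formula r) (w : Word) (e i : ℕ) :
    Kept φ w e i ↔ NumAdmissible φ w e i (bits (Kept φ w e) i) := by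
  classical
  have hstep : ∀ d, φ.ψ[i % φ.ψ.length]? = some d →
      ∀ d' ∈ (d.filter Lit.isGuess).sublists, (d'.map (numCode φ w e (i / φ.ψ.length))).Nodup →
      (((kept (IsItem φ w e) (itemCodes φ w e) φ.s (numX φ w * φ.s) i).filter fun i' =>
        (d'.map (numCode φ w e (i / φ.ψ.length))).toFinset ⊆ itemCodes φ w e i').card <
        (numX φ w * φ.s + 1) ^ (φ.s - (d'.map (numCode φ w e (i / φ.ψ.length))).toFinset.card) ↔
      Nat.count (fun i' => (bits (Kept φ w e) i)[i - (i' + 1)]? = some (some true) ∧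
        Contains φ w e i i' d') i < (numX φ w * φ.s + 1) ^ (φ.s - d'.length)) := by
    intro d hd d' hd' hnd
    rw [List.toFinset_card_of_nodup hnd, List.length_map, Nat.count_eq_card_filter_range]
    suffices h : ((kept (IsItem φ w e) (itemCodes φ w e) φ.s (numX φ w * φ.s) i).filter fun i' =>
        (d'.map (numCode φ w e (i / φ.ψ.length))).toFinset ⊆ itemCodes φ w e i') =
        (Finset.range i).filter fun i' => (bits (Kept φ w e) i)[i - (i' + 1)]? =
          some (some true) ∧ Contains φ w e i i' d' by rw [h]
    ext i'
    rw [Finset.mem_filter, Finset.mem_filter, Finset.mem_range, mem_kept_iff, and_assoc]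
    refine and_congr_right fun hi' => ?_
    rw [getElem?_bits hi']
    refine and_congr_right fun hk => ?_
    obtain ⟨d₁, hd₁, -⟩ := (lt_and_ok_of_mem_kept hk).2
    simp only [Contains, itemCodes, hd₁, Option.getD_some, codes, Finset.subset_iff,
      List.mem_toFinset, List.mem_map, Option.some.injEq, forall_exists_index, and_imp,
      forall_apply_eq_imp_iff₂, exists_eq_left']
    rfl
  rw [Kept, mem_kept_succ_iff, Admissible, IsItem, NumAdmissible]
  constructor
  · rintro ⟨⟨d, hd, h⟩, hT⟩
    refine ⟨d, hd, h, fun d' hd' hnd => (hstep d hd d' hd' hnd).1 ?_⟩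
    refine (forall_subset_toFinset_map (d.filter Lit.isGuess) _).1 (fun T hT' => hT T ?_) d' hd' hnd
    rw [itemCodes, hd]
    exact hT'
  · rintro ⟨d, hd, h, hT⟩
    refine ⟨⟨d, hd, h⟩, ?_⟩
    rw [itemCodes, hd]
    exact (forall_subset_toFinset_map (d.filter Lit.isGuess) _).2 fun d' hd' hnd =>
      (hstep d hd d' hd' hnd).2 (hT d' hd' hnd)

end Bits

namespace PolyTime

variable {α : Type} [Env α]

/-- A predicate on natural numbers can be decided in polynomial time if it can be decided in
polynomial time from its values at all smaller numbers. -/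
theorem course_of_values {P : α → ℕ → Prop} {step : (α × ℕ) × Word → Prop} (hs : PolyTime step)
    (h : ∀ a i, P a i ↔ step ((a, i), bits (P a) i)) : PolyTime fun p : α × ℕ => P p.1 p.2 := by
  classical
  have := iterate (α := α × ℕ) (n := fun p => p.2 + 1) (B := fun p i => bits (P p.1) i)
    (step := fun q : ((α × ℕ) × ℕ) × Word =>
      (if step ((q.1.1.1, q.1.2), q.2) then some true else some false) :: q.2) (by fun_prop)
    ((const_word []).of_eq fun p => rfl) (by
      have : PolyTime fun q : ((α × ℕ) × ℕ) × Word => step ((q.1.1.1, q.1.2), q.2) :=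
        hs.comp (f := fun q : ((α × ℕ) × ℕ) × Word => ((q.1.1.1, q.1.2), q.2)) (by fun_prop)
      fun_prop) (fun p i _ => by
      dsimp only
      rw [bits_succ, ← h]
      by_cases hP : P p.1 i <;> simp [hP])
    ⟨fun p => p.2 + 1, bounded_nat (by fun_prop), fun p i hi => by simpa [length_bits] using hi⟩
  refine (this.getElem?_eq_some (const_nat 0) (some true)).of_iff fun p => ?_
  simp [bits_succ]

theorem exists_getElem? {ρ : Type} (l : List ρ) {k : α → ℕ} {P : ρ → α → Prop} (hk : PolyTime k)
    (hP : ∀ d ∈ l, PolyTime (P d)) : PolyTime fun a => ∃ d, l[k a]? = some d ∧ P d a := by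
  refine (exists_mem_list (List.finRange l.length)
    (P := fun (j : Fin l.length) a => k a = (j : ℕ) ∧ P l[j] a)
    fun j _ => (hk.eq (const_nat _)).and (hP _ (List.getElem_mem _))).of_iff fun a => ?_
  constructor
  · rintro ⟨d, hd, h⟩
    obtain ⟨hlt, rfl⟩ := List.getElem?_eq_some_iff.1 hd
    exact ⟨⟨k a, hlt⟩, List.mem_finRange _, rfl, h⟩
  · rintro ⟨j, -, hj, h⟩
    exact ⟨l[j], by rw [hj]; exact List.getElem?_eq_getElem _, h⟩

theorem exists_fin {m : ℕ} {P : Fin m → α → Prop} (h : ∀ j, PolyTime (P j)) :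
    PolyTime fun a => ∃ j, P j a :=
  (exists_mem_list (List.finRange m) fun j _ => h j).of_iff fun a => by simp

theorem nodup_map {ρ : Type} (l : List ρ) {f : α → ρ → ℕ} (hf : ∀ d, PolyTime fun a => f a d) :
    PolyTime fun a => (l.map (f a)).Nodup := by
  induction l with
  | nil => exact (const_prop True).of_iff fun a => by simp
  | cons d l ih =>
    exact ((exists_mem_list l (P := fun d' a => f a d' = f a d)
      fun d' _ => (hf d').eq (hf d)).not.and ih).of_iff fun a => by simp

@[fun_prop]
theorem digit {n e : α → ℕ} (hn : PolyTime n) (he : PolyTime e) (j : ℕ) :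
    PolyTime fun a => MaxNP.digit (n a) (e a) j := by
  unfold MaxNP.digit
  fun_prop

theorem tupleIndex {V : Type} {n : α → ℕ} {v : α → V → ℕ} (hn : PolyTime n)
    (hv : ∀ b, PolyTime fun a => v a b) {d : ℕ} (z : Fin d → V) :
    PolyTime fun a => MaxNP.tupleIndex (n a) (v a) z :=
  sum (f := fun l a => v a (z l) * n a ^ (l : ℕ)) _ fun _ _ => (hv _).mul (hn.pow _)

section Literals

variable {t u : ℕ} {r : Fin t → ℕ} {q : Fin u → ℕ} {V : Type} {v : α → V → ℕ}

theorem code {n : α → ℕ} (hn : PolyTime n) (hv : ∀ b, PolyTime fun a => v a b)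
    (l : Lit r q V) : PolyTime fun a => l.code (n a) (v a) := by
  rcases l with _ | ⟨p, j, z⟩
  · exact const_nat 0
  · have := tupleIndex hn hv z
    unfold Lit.code
    fun_prop

theorem numHolds {w : α → Word} (hw : PolyTime w) (hv : ∀ b, PolyTime fun a => v a b)
    (l : Lit r q V) : PolyTime fun a => l.NumHolds (w a) (v a) := by
  rcases l with ⟨_ | _, i, z⟩ | _
  · exact (numRel i hw (tupleIndex hw.size hv z)).not
  · exact numRel i hw (tupleIndex hw.size hv z)
  · exact const_prop True

theorem consistent_codes {n : α → ℕ} (hn : PolyTime n) (hv : ∀ b, PolyTime fun a => v a b)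
    (d : List (Lit r q V)) : PolyTime fun a => Consistent {c | c ∈ codes (n a) (v a) d} := by
  have h := code (r := r) (q := q) hn hv
  refine (forall_mem_list (d.filter Lit.isGuess) (P := fun l a => ∀ l' ∈ d.filter Lit.isGuess,
    ¬ (l.code (n a) (v a) % 2 = 0 ∧ l'.code (n a) (v a) = l.code (n a) (v a) + 1)) fun l _ =>
      forall_mem_list _ fun l' _ => ?_).of_iff fun a => ?_
  · have h₁ := h l
    have h₂ := h l'
    fun_prop
  · simp only [Consistent, codes, List.mem_map, Set.mem_ofPred_eq]
    constructor
    · rintro hc l hl l' hl' ⟨he, hll⟩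
      exact hc (l.code (n a) (v a) / 2) ⟨l, hl, by omega⟩ ⟨l', hl', by omega⟩
    · rintro hc b ⟨l, hl, hb⟩ ⟨l', hl', hb'⟩
      exact hc l hl l' hl' ⟨by omega, by omega⟩

end Literals

section Kernel

variable {t : ℕ} {r : Fin t → ℕ} (φ : Formula r)

theorem numVal {w : α → Word} {e e' : α → ℕ} (hw : PolyTime w) (he : PolyTime e)
    (he' : PolyTime e') (b : Fin φ.cx ⊕ Fin φ.cy) :
    PolyTime fun a => MaxNP.numVal φ (w a) (e a) (e' a) b := by
  rcases b with j | j
  · exact hw.size.digit he j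
  · exact hw.size.digit he' j

@[fun_prop]
theorem numItem {w : α → Word} {e e' : α → ℕ} (hw : PolyTime w) (he : PolyTime e)
    (he' : PolyTime e') (d : List (Lit r φ.q (Fin φ.cx ⊕ Fin φ.cy))) :
    PolyTime fun a => NumItem φ (w a) (e a) (e' a) d := by
  have h := numVal φ hw he he'
  exact (forall_mem_list d fun l _ => numHolds hw h l).and (consistent_codes hw.size h d)

@[fun_prop]
theorem candidates {w : α → Word} (hw : PolyTime w) :
    PolyTime fun a => MaxNP.candidates φ (w a) := by
  unfold MaxNP.candidates
  fun_prop

@[fun_prop]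
theorem numSat {w : α → Word} {e : α → ℕ} (hw : PolyTime w) (he : PolyTime e) :
    PolyTime fun a => NumSat φ (w a) (e a) :=
  exists_lt (P := fun a i => IsItem φ (w a) (e a) i) (by fun_prop)
    (exists_getElem? _ (by fun_prop) fun d _ => by fun_prop)

@[fun_prop]
theorem numX {w : α → Word} (hw : PolyTime w) : PolyTime fun a => MaxNP.numX φ (w a) := by
  classical
  exact count (P := fun a e => NumSat φ (w a) e) (by fun_prop) (by fun_prop)

@[fun_prop]
theorem numCode {w : α → Word} {e e' : α → ℕ} (hw : PolyTime w) (he : PolyTime e)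
    (he' : PolyTime e') (l : Lit r φ.q (Fin φ.cx ⊕ Fin φ.cy)) :
    PolyTime fun a => MaxNP.numCode φ (w a) (e a) (e' a) l :=
  code hw.size (numVal φ hw he he') l

@[fun_prop]
theorem contains {w : α → Word} {e i i' : α → ℕ} (hw : PolyTime w) (he : PolyTime e)
    (hi : PolyTime i) (hi' : PolyTime i') (d' : List (Lit r φ.q (Fin φ.cx ⊕ Fin φ.cy))) :
    PolyTime fun a => Contains φ (w a) (e a) (i a) (i' a) d' :=
  forall_mem_list d' fun l _ => exists_getElem? _ (by fun_prop) fun d₁ _ =>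
    exists_mem_list _ fun l' _ => by fun_prop

theorem numAdmissible : PolyTime fun q : ((Word × ℕ) × ℕ) × Word =>
    NumAdmissible φ q.1.1.1 q.1.1.2 q.1.2 q.2 := by
  classical
  refine exists_getElem? _ (by fun_prop) fun d _ => .and (by fun_prop) (forall_mem_list _
    fun d' _ => .imp (nodup_map _ fun l => by fun_prop) (.lt ?_ (by fun_prop)))
  exact count (P := fun (q : ((Word × ℕ) × ℕ) × Word) i' =>
    q.2[q.1.2 - (i' + 1)]? = some (some true) ∧ Contains φ q.1.1.1 q.1.1.2 q.1.2 i' d')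
    (by fun_prop) (.and (getElem?_eq_some (by fun_prop) (by fun_prop) _) (by fun_prop))

@[fun_prop]
theorem kept {w : α → Word} {e i : α → ℕ} (hw : PolyTime w) (he : PolyTime e) (hi : PolyTime i) :
    PolyTime fun a => Kept φ (w a) (e a) (i a) :=
  (course_of_values (P := fun (p : Word × ℕ) i => Kept φ p.1 p.2 i) (numAdmissible φ)
    fun p i => kept_iff_numAdmissible φ p.1 p.2 i).comp
    (f := fun a => ((w a, e a), i a)) (by fun_prop)

@[fun_prop]
theorem used {w : α → Word} {b : α → ℕ} (hw : PolyTime w) (hb : PolyTime b) :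
    PolyTime fun a => Used φ (w a) (b a) :=
  exists_lt (P := fun a e => NumSat φ (w a) e ∧
    ((∃ j : Fin φ.cx, MaxNP.digit (MaxNP.size (w a)) e j = b a) ∨
      ∃ i < MaxNP.candidates φ (w a), Kept φ (w a) e i ∧
        ∃ j : Fin φ.cy, MaxNP.digit (MaxNP.size (w a)) (i / φ.ψ.length) j = b a)) (by fun_prop)
    (.and (by fun_prop) (.or (exists_fin fun j => by fun_prop)
      (exists_lt (α := α × ℕ) (P := fun p i => Kept φ (w p.1) p.2 i ∧
        ∃ j : Fin φ.cy, MaxNP.digit (MaxNP.size (w p.1)) (i / φ.ψ.length) j = b p.1) (by fun_prop)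
        (.and (by fun_prop) (exists_fin fun j => by fun_prop)))))

@[fun_prop]
theorem newSize {w : α → Word} (hw : PolyTime w) : PolyTime fun a => MaxNP.newSize φ (w a) := by
  classical
  exact count (P := fun a b => Used φ (w a) b) (by fun_prop) (by fun_prop)

@[fun_prop]
theorem element {w : α → Word} {j : α → ℕ} (hw : PolyTime w) (hj : PolyTime j) :
    PolyTime fun a => MaxNP.element φ (w a) (j a) := by
  classical
  refine count (P := fun a b => Nat.count (Used φ (w a)) (b + 1) ≤ j a) (by fun_prop) (.le ?_ ?_)
  · exact count (α := α × ℕ) (P := fun p b => Used φ (w p.1) b) (by fun_prop) (by fun_prop)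
  · fun_prop

theorem kernel : PolyTime (MaxNP.kernel φ) := by
  classical
  refine (valid r).ite (.ite (.le (min_binVal (by fun_prop) (by fun_prop)) (by fun_prop))
    (const_word _) (encWord (by fun_prop) (fun i => ?_) (by fun_prop))) (const_word [])
  exact numRel i (by fun_prop) (tupleIndex (by fun_prop) (fun l => by fun_prop) _)

end Kernel

end PolyTime


/-! ### The meaning of the numerical notions -/

theorem digit_val {n c : ℕ} (x : Fin c → Fin n) (j : Fin c) :
    digit n (finFunctionFinEquiv x) j = x j := by
  have := congrArg Fin.val (congrFun (finFunctionFinEquiv.symm_apply_apply x) j)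
  rwa [finFunctionFinEquiv_symm_apply_val] at this

theorem exists_lt_pow_iff {n c : ℕ} {P : ℕ → Prop} :
    (∃ e < n ^ c, P e) ↔ ∃ x : Fin c → Fin n, P (finFunctionFinEquiv x) := by
  constructor
  · rintro ⟨e, he, h⟩
    exact ⟨finFunctionFinEquiv.symm ⟨e, he⟩, by simpa using h⟩
  · rintro ⟨x, h⟩
    exact ⟨_, (finFunctionFinEquiv x).2, h⟩

theorem count_pow_eq_ncard {n c : ℕ} {P : ℕ → Prop} [DecidablePred P] {S : Set (Fin c → Fin n)}
    (h : ∀ x, P (finFunctionFinEquiv x) ↔ x ∈ S) : Nat.count P (n ^ c) = S.ncard := by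
  have hinj : Function.Injective fun x : Fin c → Fin n => (finFunctionFinEquiv x : ℕ) :=
    Fin.val_injective.comp finFunctionFinEquiv.injective
  rw [Nat.count_eq_card_filter_range, ← Set.ncard_coe_finset, ← Set.ncard_image_of_injective S hinj]
  congr 1
  ext e
  simp only [Finset.coe_filter, Finset.mem_range, Set.mem_ofPred_eq, Set.mem_image]
  constructor
  · rintro ⟨he, hP⟩
    exact ⟨finFunctionFinEquiv.symm ⟨e, he⟩, by rw [← h]; simpa using hP, by simp⟩
  · rintro ⟨x, hx, rfl⟩
    exact ⟨(finFunctionFinEquiv x).2, (h x).2 hx⟩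

section Enumeration

variable {P : ℕ → Prop} [DecidablePred P] {n : ℕ}

theorem count_count_le {a : ℕ} (ha : a < n) (hP : P a) :
    Nat.count (fun b => Nat.count P (b + 1) ≤ Nat.count P a) n = a := by
  rw [Nat.count_eq_card_filter_range]
  convert Finset.card_range a using 2
  ext b
  rw [Finset.mem_filter, Finset.mem_range, Finset.mem_range]
  constructor
  · rintro ⟨-, hb⟩
    by_contra hab
    have h₁ := Nat.count_monotone P (show a + 1 ≤ b + 1 by omega)
    rw [Nat.count_succ, if_pos hP] at h₁
    omega
  · exact fun hb => ⟨hb.trans ha, Nat.count_monotone P hb⟩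

theorem exists_count_eq {j : ℕ} (hj : j < Nat.count P n) : ∃ a < n, P a ∧ Nat.count P a = j := by
  induction n with
  | zero => simp at hj
  | succ n ih =>
    by_cases h : j < Nat.count P n
    · obtain ⟨a, ha, h⟩ := ih h
      exact ⟨a, by omega, h⟩
    · rw [Nat.count_succ] at hj
      split_ifs at hj with hP
      · exact ⟨n, by omega, hP, by omega⟩
      · omega

end Enumeration

section Semantics

variable {t : ℕ} {r : Fin t → ℕ} (φ : Formula r)

/-- The function `element` enumerates the elements of the restricted structure. -/
theorem exists_embedding (w : Word) (n : ℕ) (hn : size w = n) :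
    ∃ f : Fin (newSize φ w) ↪ Fin n, (∀ j, (f j : ℕ) = element φ w j) ∧
      ∀ a, a ∈ Set.range f ↔ Used φ w a := by
  classical
  subst hn
  have h : ∀ j < newSize φ w, element φ w j < size w ∧ Used φ w (element φ w j) ∧
      Nat.count (Used φ w) (element φ w j) = j := by
    intro j hj
    obtain ⟨a, ha, hu, rfl⟩ := exists_count_eq hj
    rw [element, count_count_le ha hu]
    exact ⟨ha, hu, rfl⟩
  refine ⟨⟨fun j => ⟨element φ w j, (h j j.2).1⟩, fun j j' hjj => ?_⟩, fun j => rfl, fun a =>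
    ⟨?_, fun ha => ?_⟩⟩
  · have := congrArg (Nat.count (Used φ w)) (Fin.ext_iff.1 hjj)
    rw [(h j j.2).2.2, (h j' j'.2).2.2] at this
    exact Fin.ext this
  · rintro ⟨j, rfl⟩
    exact (h j j.2).2.1
  · exact ⟨⟨Nat.count (Used φ w) a, Nat.count_strict_mono ha a.2⟩,
      Fin.ext (count_count_le a.2 ha)⟩

variable (I : Instance r)

/-- The number of the candidate that consists of the tuple `y` and the disjunct number `k`. -/
def candidate (y : Fin φ.cy → Fin I.n) (k : Fin φ.ψ.length) : ℕ :=
  finFunctionFinEquiv y * φ.ψ.length + k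

/-- The representative witnesses of `x`. -/
def keptWitnesses (x : Fin φ.cx → Fin I.n) : Set (Fin φ.cy → Fin I.n) :=
  {y | ∃ k, Kept φ I.encode (finFunctionFinEquiv x) (candidate φ I y k)}

variable {φ I}

theorem candidate_div (y : Fin φ.cy → Fin I.n) (k : Fin φ.ψ.length) :
    candidate φ I y k / φ.ψ.length = finFunctionFinEquiv y := by
  rw [candidate, mul_comm, Nat.mul_add_div k.pos, Nat.div_eq_of_lt k.2, add_zero]

theorem getElem?_candidate_mod (y : Fin φ.cy → Fin I.n) (k : Fin φ.ψ.length) :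
    φ.ψ[candidate φ I y k % φ.ψ.length]? = some φ.ψ[k] := by
  rw [candidate, Nat.mul_add_mod_of_lt k.2]
  exact List.getElem?_eq_getElem k.2

theorem exists_lt_candidates {P : ℕ → Prop} :
    (∃ i < candidates φ I.encode, P i) ↔ ∃ y k, P (candidate φ I y k) := by
  rw [candidates, size_encode]
  constructor
  · rintro ⟨i, hi, h⟩
    have hD : 0 < φ.ψ.length := Nat.pos_of_ne_zero fun h => by simp [h] at hi
    have hy : i / φ.ψ.length < I.n ^ φ.cy := Nat.div_lt_of_lt_mul (by rwa [mul_comm] at hi)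
    refine ⟨finFunctionFinEquiv.symm ⟨_, hy⟩, ⟨i % φ.ψ.length, Nat.mod_lt _ hD⟩, ?_⟩
    rw [candidate, Equiv.apply_symm_apply]
    simpa [Nat.div_add_mod'] using h
  · rintro ⟨y, k, h⟩
    refine ⟨_, ?_, h⟩
    have h₁ := Nat.mul_le_mul_right φ.ψ.length (finFunctionFinEquiv y).2
    have h₂ := k.2
    rw [candidate]
    rw [Nat.succ_mul] at h₁
    omega

theorem candidate_lt (y : Fin φ.cy → Fin I.n) (k : Fin φ.ψ.length) :
    candidate φ I y k < candidates φ I.encode := by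
  obtain ⟨i, hi, h⟩ := exists_lt_candidates.2 ⟨y, k, (rfl : _ = candidate φ I y k)⟩
  exact h ▸ hi

theorem numVal_encode (x : Fin φ.cx → Fin I.n) (y : Fin φ.cy → Fin I.n) :
    numVal φ I.encode (finFunctionFinEquiv x) (finFunctionFinEquiv y) =
      fun a => (assign φ x y a : ℕ) := by
  funext a
  rcases a with j | j <;> simp only [numVal, size_encode, Sum.elim_inl, Sum.elim_inr, digit_val]

theorem Lit.numHolds_encode {u : ℕ} {q : Fin u → ℕ} {V : Type} (v : V → Fin I.n)
    (l : Lit r q V) : l.NumHolds I.encode (fun a => (v a : ℕ)) ↔ l.InputHolds I.rel v := by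
  rcases l with ⟨_ | _, i, z⟩ | _
  · rw [NumHolds, size_encode, tupleIndex_val, numRel_encode]
    rfl
  · rw [NumHolds, size_encode, tupleIndex_val, numRel_encode]
    rfl
  · rfl

theorem isItem_candidate (x : Fin φ.cx → Fin I.n) (y : Fin φ.cy → Fin I.n)
    (k : Fin φ.ψ.length) :
    IsItem φ I.encode (finFunctionFinEquiv x) (candidate φ I y k) ↔ Item φ I.rel x y φ.ψ[k] := by
  simp only [IsItem, getElem?_candidate_mod, candidate_div, Option.some.injEq, exists_eq_left',
    NumItem, Item, numVal_encode, Lit.numHolds_encode, size_encode]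
  exact ⟨fun h => ⟨List.getElem_mem _, h⟩, fun h => h.2⟩

theorem itemCodes_candidate (x : Fin φ.cx → Fin I.n) (y : Fin φ.cy → Fin I.n)
    (k : Fin φ.ψ.length) :
    itemCodes φ I.encode (finFunctionFinEquiv x) (candidate φ I y k) =
      (codes I.n (fun a => (assign φ x y a : ℕ)) φ.ψ[k]).toFinset := by
  rw [itemCodes, getElem?_candidate_mod, candidate_div, numVal_encode, size_encode]
  rfl

theorem numSat_encode (x : Fin φ.cx → Fin I.n) :
    NumSat φ I.encode (finFunctionFinEquiv x) ↔ x ∈ φ.satisfiable I.rel := by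
  rw [NumSat, exists_lt_candidates, mem_satisfiable_iff]
  refine exists_congr fun y => ⟨fun ⟨k, h⟩ => ⟨_, (isItem_candidate x y k).1 h⟩, fun ⟨d, hd⟩ => ?_⟩
  obtain ⟨k, hk, rfl⟩ := List.getElem_of_mem hd.1
  exact ⟨⟨k, hk⟩, (isItem_candidate x y ⟨k, hk⟩).2 hd⟩

theorem numX_encode : numX φ I.encode = (φ.satisfiable I.rel).ncard := by
  classical
  rw [numX, size_encode]
  exact count_pow_eq_ncard numSat_encode

theorem keptWitnesses_subset (x : Fin φ.cx → Fin I.n) :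
    keptWitnesses φ I x ⊆ φ.witnesses I.rel x := by
  rintro y ⟨k, h⟩
  exact mem_witnesses_iff.2 ⟨_, (isItem_candidate x y k).1 (lt_and_ok_of_mem_kept h).2⟩

theorem ncard_keptWitnesses_le (x : Fin φ.cx → Fin I.n) :
    (keptWitnesses φ I x).ncard ≤ ((φ.satisfiable I.rel).ncard * φ.s + 1) ^ φ.s := by
  classical
  rw [← numX_encode]
  refine le_trans ?_ (card_kept_le (ok := IsItem φ I.encode (finFunctionFinEquiv x))
    (L := itemCodes φ I.encode (finFunctionFinEquiv x)) (candidates φ I.encode))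
  refine le_trans ?_ (Finset.card_image_le (f := fun i => i / φ.ψ.length))
  rw [← Set.ncard_coe_finset]
  refine Set.ncard_le_ncard_of_injOn (fun y => (finFunctionFinEquiv y : ℕ)) ?_
    (Fin.val_injective.comp finFunctionFinEquiv.injective).injOn (Finset.finite_toSet _)
  rintro y ⟨k, h⟩
  exact Finset.mem_coe.2 (Finset.mem_image.2
    ⟨_, mem_kept_iff.2 ⟨candidate_lt y k, h⟩, candidate_div y k⟩)

theorem card_itemCodes_le {w : Word} {e i : ℕ} (h : IsItem φ w e i) :
    (itemCodes φ w e i).card ≤ φ.s := by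
  obtain ⟨d, hd, -⟩ := h
  rw [itemCodes, hd]
  exact (List.toFinset_card_le _).trans (length_codes_le (List.mem_of_getElem? hd) _)

theorem representative_keptWitnesses :
    Representative φ I.rel ((φ.satisfiable I.rel).ncard * φ.s) (keptWitnesses φ I) := by
  intro x y d hd B hB hdB
  obtain ⟨k, hk, rfl⟩ := List.getElem_of_mem hd.1
  have hi := (isItem_candidate x y ⟨k, hk⟩).2 hd
  have hdisj : Disjoint (itemCodes φ I.encode (finFunctionFinEquiv x) (candidate φ I y ⟨k, hk⟩))
      B := by
    rw [itemCodes_candidate]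
    exact Finset.disjoint_left.2 fun c hc => hdB c (List.mem_toFinset.1 hc)
  rw [← numX_encode] at hB
  obtain ⟨i', hi', hdisj'⟩ := exists_mem_kept_disjoint
    (ok := IsItem φ I.encode (finFunctionFinEquiv x))
    (L := itemCodes φ I.encode (finFunctionFinEquiv x)) (fun i => card_itemCodes_le)
    (candidate_lt y ⟨k, hk⟩) hi hB hdisj
  obtain ⟨hlt, hkept⟩ := mem_kept_iff.1 hi'
  obtain ⟨y', k', rfl⟩ := exists_lt_candidates.1 ⟨i', hlt, (rfl : _ = i')⟩
  refine ⟨y', ⟨k', hkept⟩, _, (isItem_candidate x y' k').1 (lt_and_ok_of_mem_kept hi').2,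
    fun c hc => ?_⟩
  rw [itemCodes_candidate] at hdisj'
  exact Finset.disjoint_left.1 hdisj' (List.mem_toFinset.2 hc)

theorem used_encode (a : Fin I.n) : Used φ I.encode a ↔ ∃ x ∈ φ.satisfiable I.rel,
    a ∈ Set.range x ∨ ∃ y ∈ keptWitnesses φ I x, a ∈ Set.range y := by
  rw [Used, size_encode, exists_lt_pow_iff]
  refine exists_congr fun x => and_congr (numSat_encode x) (or_congr ?_ ?_)
  · simp only [digit_val, Set.mem_range, Fin.ext_iff]
  · rw [exists_lt_candidates]
    simp only [candidate_div, digit_val, keptWitnesses, Set.mem_ofPred_eq, Set.mem_range,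
      Fin.ext_iff]
    exact exists_congr fun y => ⟨fun ⟨k, h, h'⟩ => ⟨⟨k, h⟩, h'⟩, fun ⟨⟨k, h⟩, h'⟩ => ⟨k, h, h'⟩⟩

theorem newRel_encode {f : Fin (newSize φ I.encode) ↪ Fin I.n}
    (hf : ∀ j, (f j : ℕ) = element φ I.encode j) (i : Fin t)
    (v : Fin (r i) → Fin (newSize φ I.encode)) :
    newRel φ I.encode i (finFunctionFinEquiv v) ↔ f ∘ v ∈ I.rel i := by
  simp only [newRel, digit_val, ← hf]
  rw [← numRel_encode I i, size_encode, tupleIndex_val (fun l => f (v l))]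
  rfl

variable (φ I)

theorem kernel_encode_of_le (h : I.k * 2 ^ φ.s ≤ (φ.satisfiable I.rel).ncard) :
    kernel φ I.encode = (trivialInstance r).encode := by
  rw [kernel, if_pos ((valid_iff _).2 ⟨I, rfl⟩), if_pos]
  rw [numX_encode, rest_encode, binVal_encodeNat]
  exact (min_le_left _ _).trans ((Nat.le_div_iff_mul_le (by positivity)).2 h)

theorem kernel_encode_of_lt (h : (φ.satisfiable I.rel).ncard < I.k * 2 ^ φ.s) :
    ∃ (I' : Instance r) (f : Fin I'.n ↪ Fin I.n), kernel φ I.encode = I'.encode ∧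
      IsRestriction φ I I' (keptWitnesses φ I) f := by
  obtain ⟨f, hf, hrange⟩ := exists_embedding φ I.encode I.n (size_encode I)
  refine ⟨⟨newSize φ I.encode, fun i => {v | f ∘ v ∈ I.rel i}, I.k⟩, f, ?_,
    Set.ext fun a => (hrange a).trans (used_encode a), fun i v => Iff.rfl, rfl⟩
  rw [kernel, if_pos ((valid_iff _).2 ⟨I, rfl⟩), if_neg, rest_encode]
  · exact (encode_eq_encWord ⟨newSize φ I.encode, fun i => {v | f ∘ v ∈ I.rel i}, I.k⟩
      (T := newRel φ I.encode) fun i v => (newRel_encode hf i v).symm).symm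
  · rw [numX_encode, rest_encode, binVal_encodeNat]
    have := (Nat.div_lt_iff_lt_mul (Nat.two_pow_pos φ.s)).2 h
    omega

end Semantics


/-! ### The size of the kernel -/

section Size

variable {t : ℕ} {r : Fin t → ℕ}

theorem length_encode (I : Instance r) : I.encode.length =
    I.n + 1 + (∑ i, (I.n ^ r i + 1)) + (Computability.encodeNat I.k).length := by
  simp [Instance.encode, table, List.length_flatten, List.map_ofFn, Function.comp_def,
    List.sum_ofFn]
  omega

theorem IsRestriction.size_le {φ : Formula r} {I I' : Instance r}
    {Y' : (Fin φ.cx → Fin I.n) → Set (Fin φ.cy → Fin I.n)} {f : Fin I'.n ↪ Fin I.n}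
    (h : IsRestriction φ I I' Y' f) {c : ℕ} (hY : ∀ x, (Y' x).ncard ≤ c) :
    I'.n ≤ (φ.satisfiable I.rel).ncard * (φ.cx + c * φ.cy) := by
  classical
  have hn : I'.n = (Set.range f).ncard := by
    rw [← Set.image_univ, Set.ncard_image_of_injective _ f.injective, Set.ncard_univ]
    simp
  let X : Finset (Fin φ.cx → Fin I.n) := (Set.toFinite (φ.satisfiable I.rel)).toFinset
  let Y (x : Fin φ.cx → Fin I.n) : Finset (Fin φ.cy → Fin I.n) := (Set.toFinite (Y' x)).toFinset
  have hrange {c : ℕ} (x : Fin c → Fin I.n) : (Finset.univ.image x).card ≤ c :=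
    Finset.card_image_le.trans (by simp)
  have hsub : Set.range f ⊆ ↑(X.biUnion fun x => Finset.univ.image x ∪
      (Y x).biUnion fun y => Finset.univ.image y) := by
    rw [h.1]
    rintro a ⟨x, hx, ⟨j, rfl⟩ | ⟨y, hy, j, rfl⟩⟩
    · exact Finset.mem_coe.2 (Finset.mem_biUnion.2 ⟨x, by simpa [X] using hx,
        Finset.mem_union_left _ (Finset.mem_image_of_mem _ (Finset.mem_univ j))⟩)
    · exact Finset.mem_coe.2 (Finset.mem_biUnion.2 ⟨x, by simpa [X] using hx,
        Finset.mem_union_right _ (Finset.mem_biUnion.2 ⟨y, by simpa [Y] using hy,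
          Finset.mem_image_of_mem _ (Finset.mem_univ j)⟩)⟩)
  rw [hn, Set.ncard_eq_toFinset_card (φ.satisfiable I.rel)]
  refine (Set.ncard_le_ncard hsub (Finset.finite_toSet _)).trans ?_
  rw [Set.ncard_coe_finset]
  refine Finset.card_biUnion_le_card_mul _ _ _ fun x _ => (Finset.card_union_le _ _).trans
    (Nat.add_le_add (hrange x) ((Finset.card_biUnion_le_card_mul _ _ φ.cy fun y _ =>
      hrange y).trans (Nat.mul_le_mul_right _ ?_)))
  rw [← Set.ncard_eq_toFinset_card]
  exact hY x

variable (φ : Formula r)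

/-- A constant `c` such that `|Y' x| ≤ c * k ^ s`. -/
def witnessConst : ℕ := (2 ^ φ.s * φ.s + 1) ^ φ.s

/-- A constant `c` such that `|A'| ≤ c * k ^ (s + 1)`. -/
def universeConst : ℕ := 2 ^ φ.s * (φ.cx + witnessConst φ * φ.cy)

/-- A constant `c` such that the kernel has size at most `c * (k ^ ((s + 1) * m) + 1)`. -/
noncomputable def kernelConst : ℕ :=
  (universeConst φ + 1) ^ max 1 (Finset.univ.sup r) * (t + 1) + (t + 2) + witnessConst φ +
    (trivialInstance r).encode.length

theorem pow_le_witnessConst {x k : ℕ} (h : x < k * 2 ^ φ.s) :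
    (x * φ.s + 1) ^ φ.s ≤ witnessConst φ * k ^ φ.s := by
  rw [witnessConst, ← mul_pow]
  refine Nat.pow_le_pow_left ?_ _
  have hk : 0 < k := Nat.pos_of_ne_zero fun hk => by simp [hk] at h
  calc x * φ.s + 1 ≤ k * 2 ^ φ.s * φ.s + k := Nat.add_le_add (Nat.mul_le_mul_right _ h.le) hk
    _ = (2 ^ φ.s * φ.s + 1) * k := by ring

theorem mul_le_universeConst {x k : ℕ} (h : x < k * 2 ^ φ.s) :
    x * (φ.cx + witnessConst φ * k ^ φ.s * φ.cy) ≤ universeConst φ * k ^ (φ.s + 1) := by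
  have hk : 0 < k := Nat.pos_of_ne_zero fun hk => by simp [hk] at h
  have hks : 1 ≤ k ^ φ.s := Nat.one_le_pow _ _ hk
  calc x * (φ.cx + witnessConst φ * k ^ φ.s * φ.cy)
      ≤ k * 2 ^ φ.s * (φ.cx * k ^ φ.s + witnessConst φ * k ^ φ.s * φ.cy) :=
        Nat.mul_le_mul h.le (Nat.add_le_add_right (Nat.le_mul_of_pos_right _ hks) _)
    _ = universeConst φ * k ^ (φ.s + 1) := by rw [universeConst]; ring

theorem length_encode_le {I : Instance r} (hk : 0 < I.k)
    (hn : I.n ≤ universeConst φ * I.k ^ (φ.s + 1)) : I.encode.length ≤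
      kernelConst φ * (I.k ^ ((φ.s + 1) * max 1 (Finset.univ.sup r)) + 1) := by
  set m := max 1 (Finset.univ.sup r) with hm
  set N := (universeConst φ + 1) ^ m * I.k ^ ((φ.s + 1) * m) with hN
  have hpow : ∀ j ≤ m, I.n ^ j ≤ N := by
    intro j hj
    rw [hN, pow_mul, ← mul_pow]
    calc I.n ^ j ≤ ((universeConst φ + 1) * I.k ^ (φ.s + 1)) ^ j :=
          Nat.pow_le_pow_left (hn.trans (Nat.mul_le_mul_right _ (Nat.le_succ _))) j
      _ ≤ _ := Nat.pow_le_pow_right (by positivity) hj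
  have h₁ : I.n ≤ N := by simpa using hpow 1 (le_max_left _ _)
  have h₂ : ∑ i, (I.n ^ r i + 1) ≤ t * (N + 1) := by
    refine (Finset.sum_le_card_nsmul _ _ (N + 1) fun i _ => Nat.add_le_add_right
      (hpow _ ((Finset.le_sup (f := r) (Finset.mem_univ i)).trans (le_max_right _ _))) 1).trans ?_
    simp
  have h₃ : (Computability.encodeNat I.k).length ≤ I.k ^ ((φ.s + 1) * m) :=
    (length_encodeNat_le _).trans (Nat.le_self_pow (by positivity) _)
  rw [length_encode, kernelConst, ← hm]
  calc I.n + 1 + (∑ i, (I.n ^ r i + 1)) + (Computability.encodeNat I.k).length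
      ≤ N + 1 + t * (N + 1) + I.k ^ ((φ.s + 1) * m) := by omega
    _ = ((universeConst φ + 1) ^ m * (t + 1) + 1) * I.k ^ ((φ.s + 1) * m) + (t + 1) := by
        rw [hN]; ring
    _ ≤ _ := by
        rw [mul_add_one]
        refine Nat.add_le_add (Nat.mul_le_mul_right _ ?_) ?_ <;> omega

end Size

/-! ### The kernelization theorem -/

section Kernelization

variable {t : ℕ} {r : Fin t → ℕ} {Q : MaxProblem r} {φ : Formula r}

theorem Formula.Expresses.le_opt (hφ : φ.Expresses Q) {A : Type} [Finite A] {R : RelStr r A}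
    {k : ℕ} (h : k * 2 ^ φ.s ≤ (φ.satisfiable R).ncard) : k ≤ Q A R := by
  obtain ⟨S, hS⟩ := exists_le_value φ h
  exact hS.trans ((hφ A R).2 ⟨S, rfl⟩)

theorem exists_restriction (φ : Formula r) {I : Instance r}
    (h : (φ.satisfiable I.rel).ncard < I.k * 2 ^ φ.s) :
    ∃ (I' : Instance r) (Y' : (Fin φ.cx → Fin I.n) → Set (Fin φ.cy → Fin I.n))
      (f : Fin I'.n ↪ Fin I.n), kernel φ I.encode = I'.encode ∧
      (∀ x, Y' x ⊆ φ.witnesses I.rel x ∧ (Y' x).ncard ≤ witnessConst φ * I.k ^ φ.s) ∧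
      IsRestriction φ I I' Y' f ∧
      Representative φ I.rel ((φ.satisfiable I.rel).ncard * φ.s) Y' := by
  obtain ⟨I', f, hK, hres⟩ := kernel_encode_of_lt φ I h
  exact ⟨I', _, f, hK, fun x => ⟨keptWitnesses_subset x,
    (ncard_keptWitnesses_le x).trans (pow_le_witnessConst φ h)⟩, hres,
    representative_keptWitnesses⟩

theorem IsRestriction.opt_eq (hφ : φ.Expresses Q) {I I' : Instance r}
    {Y' : (Fin φ.cx → Fin I.n) → Set (Fin φ.cy → Fin I.n)} {f : Fin I'.n ↪ Fin I.n}
    (h : IsRestriction φ I I' Y' f)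
    (hY : Representative φ I.rel ((φ.satisfiable I.rel).ncard * φ.s) Y') :
    Q (Fin I'.n) I'.rel = Q (Fin I.n) I.rel := by
  refine opt_restriction_eq hφ hY h.2.1 (fun x hx a ha => ?_) fun x hx y hy a ha => ?_
  · rw [h.1]
    exact ⟨x, hx, .inl ha⟩
  · rw [h.1]
    exact ⟨x, hx, .inr ⟨y, hy, ha⟩⟩

theorem isKernelization_kernel (hφ : φ.Expresses Q) :
    (standardParam Q).IsKernelization (kernel φ) fun k =>
      kernelConst φ * (k ^ ((φ.s + 1) * max 1 (Finset.univ.sup r)) + 1) := by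
  refine ⟨(PolyTime.kernel φ).nonempty_computable id id _ fun w => by simp, fun w => ?_⟩
  by_cases hw : ∃ I : Instance r, I.encode = w
  · obtain ⟨I, rfl⟩ := hw
    rw [standardParam_param_encode, encode_mem_standardParam_lang]
    rcases le_or_gt (I.k * 2 ^ φ.s) (φ.satisfiable I.rel).ncard with h | h
    · rw [kernel_encode_of_le φ I h, encode_mem_standardParam_lang]
      refine ⟨iff_of_true (hφ.le_opt h) (Nat.zero_le _), ?_⟩
      refine le_trans ?_ (Nat.le_mul_of_pos_right _ (Nat.succ_pos _))
      exact Nat.le_add_left _ _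
    · obtain ⟨I', Y', f, hK, hY, hres, hrep⟩ := exists_restriction φ h
      rw [hK, encode_mem_standardParam_lang, hres.opt_eq hφ hrep, hres.2.2]
      refine ⟨Iff.rfl, ?_⟩
      rw [← hres.2.2]
      refine length_encode_le φ ?_ ?_
      · rw [hres.2.2]
        exact Nat.pos_of_ne_zero fun hk => by simp [hk] at h
      · rw [hres.2.2]
        exact (hres.size_le fun x => (hY x).2).trans (mul_le_universeConst φ h)
  · -- The empty word encodes no instance.
    have hnil : ([] : Word) ∉ (standardParam Q).lang := by
      rintro ⟨I, hI, -⟩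
      simp [Instance.encode] at hI
    rw [kernel, if_neg (by rwa [valid_iff])]
    exact ⟨iff_of_false (fun ⟨I, hI, _⟩ => hw ⟨I, hI⟩) hnil, Nat.zero_le _⟩

theorem InMaxNP.admitsPolyKernelization (h : InMaxNP Q) :
    (standardParam Q).AdmitsPolyKernelization := by
  obtain ⟨φ, hφ⟩ := h
  refine ⟨kernel φ, .C (kernelConst φ) *
    (.X ^ ((φ.s + 1) * max 1 (Finset.univ.sup r)) + 1), ?_⟩
  simpa using isKernelization_kernel hφ

end Kernelization

end MaxNP

theorem mainTheorem2 {t : ℕ} (r : Fin t → ℕ) (Q : MaxNP.MaxProblem r) :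
    (MaxNP.standardParam Q).HasPolyTimeParam ∧
    (MaxNP.InMaxNP Q → (MaxNP.standardParam Q).AdmitsPolyKernelization) ∧
    (MaxNP.InMaxSNP Q → (MaxNP.standardParam Q).AdmitsPolyKernelization) ∧
    ∀ φ : MaxNP.Formula r, φ.Expresses Q →
      (∀ (A : Type) [Finite A] (R : MaxNP.RelStr r A) (k : ℕ),
        k * 2 ^ φ.s ≤ (φ.satisfiable R).ncard → k ≤ Q A R) ∧
      ∃ (K : List MaxNP.Symb → List MaxNP.Symb) (C : ℕ),
        (MaxNP.standardParam Q).IsKernelization K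
          (fun k => C * (k ^ ((φ.s + 1) * max 1 (Finset.univ.sup r)) + 1)) ∧
        ∀ I : MaxNP.Instance r, (φ.satisfiable I.rel).ncard < I.k * 2 ^ φ.s →
          ∃ (I' : MaxNP.Instance r) (Y' : (Fin φ.cx → Fin I.n) → Set (Fin φ.cy → Fin I.n))
            (f : Fin I'.n ↪ Fin I.n),
            K I.encode = I'.encode ∧
            (∀ x ∈ φ.satisfiable I.rel,
              Y' x ⊆ φ.witnesses I.rel x ∧ (Y' x).ncard ≤ C * I.k ^ φ.s) ∧
            MaxNP.IsRestriction φ I I' Y' f := by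
  refine ⟨MaxNP.hasPolyTimeParam Q, fun h => h.admitsPolyKernelization,
    fun h => h.inMaxNP.admitsPolyKernelization, fun φ hφ => ⟨fun A _ R k h => hφ.le_opt h,
      MaxNP.kernel φ, MaxNP.kernelConst φ, MaxNP.isKernelization_kernel hφ, fun I h => ?_⟩⟩
  obtain ⟨I', Y', f, hK, hY, hres, -⟩ := MaxNP.exists_restriction φ h
  have hC : MaxNP.witnessConst φ ≤ MaxNP.kernelConst φ := by
    rw [MaxNP.kernelConst]
    omega
  exact ⟨I', Y', f, hK, fun x _ => ⟨(hY x).1, (hY x).2.trans (Nat.mul_le_mul_right _ hC)⟩, hres⟩
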